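/- **Time complexities.** Let $n\ge 1$ and let $p(x)=1+a_1x+\dots+a_{n-1}x^{n-1}+x^n$ be an irreducible polynomial over $\mathbb F_2$. Identify the integers $0\le l<2^n$, $l=\sum_r l_r2^r$, with the binary vectors $(l_0,\dots,l_{n-1})$ and with the polynomials $\sum_r l_rx^r$, and let $\odot$ be multiplication of polynomials over $\mathbb F_2$ modulo $p$, i.e. multiplication in $GF(2^n)$. For $0\le j<2^n$ put $$\alpha^j_l=\prod_{s,t=0}^{n-1}\overline{(\sqrt{-1})^{\,j\odot(l_s2^s)\odot(l_t2^t)}},\qquad U(j)=\frac1{\sqrt{2^n}}\sum_{k,l=0}^{2^n-1}(-1)^{\sum_r k_rl_r}\,\alpha_l^j\,|l\rangle\langle k| ,$$ where the values of $\odot$ in exponents are read as integers. Let $a_r(j)\in\{0,1,2,3\}$ $(0\le r<n)$ and $b_m(j)\in\{0,1\}$ $(1\le m\le 2n-3)$ be given by $$(\sqrt{-1})^{a_r(j)x}=\overline{(\sqrt{-1})^{\,j\odot(x2^r)\odot(x2^r)}},\qquad (-1)^{b_{s+t}(j)xy}=(-1)^{\,j\odot(x2^s)\odot(y2^t)}\quad(s<t;\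 x,y\in\{0,1\}),$$ so that $U(j)=\prod_{s<t}CZ(s,t)^{b_{s+t}(j)}\cdot\bigotimes_rS^{a_r(j)}\cdot H^{\otimes n}$. Computing the circuit $U(j)$ means to compute all these coefficients, for which this identity then holds. Time is the number of steps of a program on a word RAM (unit-cost word operations and memory accesses) with $w$-bit words, where $w$ may be any integer that is at least a fixed constant times $\log_2(n+T)+1$ and $T\ge0$ is the number of circuits. 1. (Input: $n$ and the indices.) There is one randomized program, which may toss fair coins and whose output is always correct, with the following property. It uses an irreducible polynomial $p$ of degree $n$ that depends only on $n$ and on the coin tosses, not on the indices, on $T$ or on $w$. For every $n\ge1$ and every $j\in\{0,\dots,2^n-1\}$ it computes the circuit $U(j)$ in expected time $O(n^3)$, and for every $T$ and all $j^{(1)},\dots,j^{(T)}$ it computes the $T$ circuits $U(j^{(1)}),\dots,U(j^{(T)})$ in expected time $O(n^3+Tn^2)$. 2. (Input: $n$, $p$ and the indices.) There is one deterministic program that, given $n\ge1$, any irreducible polynomial $p$ as above and any $j$, computes the circuit $U(j)$ in worst-case time $O(n^3)$, and, given $T$ indices, computes the $T$ circuits in worst-case time $O(n^3+Tn^2)$.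 The implied constants are absolute. -/

import Mathlib

/-! Word-RAM programs with unit-cost steps and fair coins; the field `GF(2^n)` in polynomial basis;
the MUB circuits `U(j)` and their coefficients. -/

noncomputable section

namespace MUB

/-! ### Machine model -/

/-- Word operations of the word RAM (each takes one step). -/
inductive BinOp
  | add | sub | mul | and | or | xor | shl | shr | lt | eq

/-- Arithmetic is modulo `2 ^ w`; a comparison yields the word `1` (true) or `0` (false). -/
def BinOp.eval {w : ℕ} : BinOp → BitVec w → BitVec w → BitVec w
  | .add, a, b => a + b
  | .sub, a, b => a - b
  | .mul, a, b => a * b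
  | .and, a, b => a &&& b
  | .or, a, b => a ||| b
  | .xor, a, b => a ^^^ b
  | .shl, a, b => a <<< b.toNat
  | .shr, a, b => a >>> b.toNat
  | .lt, a, b => if a.toNat < b.toNat then BitVec.ofNat w 1 else BitVec.ofNat w 0
  | .eq, a, b => if a = b then BitVec.ofNat w 1 else BitVec.ofNat w 0

/-- Programs. A program is a fixed finite object; registers are named by numbers. -/
inductive Prog
  /-- do nothing -/
  | skip
  /-- `x := c` -/
  | const (x c : ℕ)
  /-- `x := y o z` -/
  | op (o : BinOp) (x y z : ℕ)
  /-- `x := mem[y]` -/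
  | load (x y : ℕ)
  /-- `mem[x] := y` -/
  | store (x y : ℕ)
  /-- `x :=` a fresh random bit -/
  | coin (x : ℕ)
  /-- run the first program, then the second one -/
  | seq (P Q : Prog)
  /-- if `x ≠ 0` then the first program, else the second one -/
  | ite (x : ℕ) (P Q : Prog)
  /-- while `x ≠ 0` do -/
  | loop (x : ℕ) (P : Prog)

/-- A deterministic program: it never tosses a coin. -/
def Prog.CoinFree : Prog → Prop
  | .coin _ => False
  | .seq P Q => P.CoinFree ∧ Q.CoinFree
  | .ite _ P Q => P.CoinFree ∧ Q.CoinFree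
  | .loop _ P => P.CoinFree
  | _ => True

/-- State of a machine with words of `w` bits: registers, a memory addressed by words, and the
sequence of the coin tosses that have not yet been used. -/
structure State (w : ℕ) where
  reg : ℕ → BitVec w
  mem : BitVec w → BitVec w
  tape : ℕ → Bool

/-- The state after the assignment `x := v`. -/
def State.setReg {w : ℕ} (σ : State w) (x : ℕ) (v : BitVec w) : State w :=
  { σ with reg := Function.update σ.reg x v }

/-- `Exec P σ t τ`: started in `σ`, the program `P` halts in the state `τ` after exactly `t` steps.
Every assignment, memory access, coin toss and test of a branch or loop condition is one step. -/
inductive Exec {w : ℕ} : Prog → State w → ℕ → State w → Prop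
  | skip (σ : State w) : Exec .skip σ 1 σ
  | const (σ : State w) (x c : ℕ) : Exec (.const x c) σ 1 (σ.setReg x (BitVec.ofNat w c))
  | op (σ : State w) (o : BinOp) (x y z : ℕ) :
      Exec (.op o x y z) σ 1 (σ.setReg x (o.eval (σ.reg y) (σ.reg z)))
  | load (σ : State w) (x y : ℕ) : Exec (.load x y) σ 1 (σ.setReg x (σ.mem (σ.reg y)))
  | store (σ : State w) (x y : ℕ) :
      Exec (.store x y) σ 1 { σ with mem := Function.update σ.mem (σ.reg x) (σ.reg y) }
  | coin (σ : State w) (x : ℕ) :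
      Exec (.coin x) σ 1
        { σ.setReg x (BitVec.ofNat w (σ.tape 0).toNat) with tape := fun i => σ.tape (i + 1) }
  | seq {P Q : Prog} {σ τ υ : State w} {t u : ℕ} :
      Exec P σ t τ → Exec Q τ u υ → Exec (.seq P Q) σ (t + u) υ
  | ite_true {x : ℕ} {P Q : Prog} {σ τ : State w} {t : ℕ} :
      σ.reg x ≠ 0 → Exec P σ t τ → Exec (.ite x P Q) σ (t + 1) τ
  | ite_false {x : ℕ} {P Q : Prog} {σ τ : State w} {t : ℕ} :
      σ.reg x = 0 → Exec Q σ t τ → Exec (.ite x P Q) σ (t + 1) τ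
  | loop_stop {x : ℕ} {P : Prog} {σ : State w} :
      σ.reg x = 0 → Exec (.loop x P) σ 1 σ
  | loop_step {x : ℕ} {P : Prog} {σ τ υ : State w} {t u : ℕ} :
      σ.reg x ≠ 0 → Exec P σ t τ → Exec (.loop x P) τ u υ → Exec (.loop x P) σ (t + u + 1) υ

/-- The running time: the number of steps, `∞` if the program does not halt. (The execution is
determined by the state, so the infimum is over at most one number.) -/
def runTime {w : ℕ} (P : Prog) (σ : State w) : ENNReal :=
  ⨅ (t : ℕ) (τ : State w) (_ : Exec P σ t τ), (t : ENNReal)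

/-- The law of a sequence of independent fair coin tosses. -/
def coinLaw : MeasureTheory.Measure (ℕ → Bool) :=
  MeasureTheory.Measure.infinitePi fun _ : ℕ => (PMF.uniformOfFintype Bool).toMeasure

/-- Start: `n` and `T` in registers `0` and `1`, the list `data` in the memory cells `0, 1, …`,
zero elsewhere, and the coin tosses `ω`. -/
def startState (w n T : ℕ) (data : List ℕ) (ω : ℕ → Bool) : State w where
  reg x := BitVec.ofNat w (if x = 0 then n else if x = 1 then T else 0)
  mem a := BitVec.ofNat w (data.getD a.toNat 0)
  tape := ω

/-- The `k`-th output word; the output block begins at the address held in register `0`. -/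
def State.out {w : ℕ} (τ : State w) (k : ℕ) : ℕ :=
  (τ.mem (τ.reg 0 + BitVec.ofNat w k)).toNat

/-! ### The field `GF(2^n)` -/

/-- Binary vectors `(l_0, …, l_{n-1})`, that is, integers `0 ≤ l < 2^n`, that is, elements of
`GF(2^n)`. -/
abbrev Bits (n : ℕ) := Fin n → ZMod 2

/-- `p(x) = 1 + a_1 x + ⋯ + a_{n-1} x^{n-1} + x^n`, irreducible over `𝔽₂`. -/
def IsModulus (n : ℕ) (p : Polynomial (ZMod 2)) : Prop :=
  Irreducible p ∧ p.natDegree = n ∧ p.coeff 0 = 1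

/-- The polynomial `l_0 + l_1 x + ⋯ + l_{n-1} x^{n-1}`. -/
def toPoly {n : ℕ} (l : Bits n) : Polynomial (ZMod 2) :=
  ∑ r : Fin n, Polynomial.C (l r) * Polynomial.X ^ (r : ℕ)

/-- The integer `l_0 + l_1 2 + ⋯ + l_{n-1} 2^{n-1}`. -/
def toInt {n : ℕ} (l : Bits n) : ℕ := ∑ r : Fin n, (l r).val * 2 ^ (r : ℕ)

/-- Multiplication in `GF(2^n)`: multiply the polynomials and reduce modulo `p`. -/
def odot {n : ℕ} (p : Polynomial (ZMod 2)) (j k : Bits n) : Bits n :=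
  fun r => ((toPoly j * toPoly k) % p).coeff r

/-! ### The operation `U(j)` and its circuit -/

/-- `j ⊙ (x · 2^s) ⊙ (y · 2^t)`, as an integer. -/
def expo {n : ℕ} (p : Polynomial (ZMod 2)) (j : Bits n) (s t : Fin n) (x y : ZMod 2) : ℕ :=
  toInt (odot p (odot p j (Pi.single s x)) (Pi.single t y))

/-- `α_l^j`, the product over all `s, t` of the conjugate of `i ^ (j ⊙ (l_s 2^s) ⊙ (l_t 2^t))`. -/
def alpha {n : ℕ} (p : Polynomial (ZMod 2)) (j l : Bits n) : ℂ :=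
  ∏ s : Fin n, ∏ t : Fin n, (starRingEnd ℂ) (Complex.I ^ expo p j s t (l s) (l t))

/-- `U(j)`; its `k`-th column is `2^{-n/2} ∑_l (-1)^{k · l} α_l^j |l⟩`. -/
def U {n : ℕ} (p : Polynomial (ZMod 2)) (j : Bits n) : Matrix (Bits n) (Bits n) ℂ :=
  Matrix.of fun l k =>
    ((1 / Real.sqrt (2 ^ n) : ℝ) : ℂ) * (-1) ^ (∑ r : Fin n, (k r).val * (l r).val) * alpha p j l

/-- Elementary gates on `n` qubits. -/
inductive Gate (n : ℕ)
  | H (q : Fin n)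
  | S (q : Fin n)
  | CZ (s t : Fin n)

/-- The one-qubit matrix `M` acting on qubit `q`. -/
def onQubit {n : ℕ} (q : Fin n) (M : Matrix (ZMod 2) (ZMod 2) ℂ) : Matrix (Bits n) (Bits n) ℂ :=
  Matrix.of fun l k => if ∀ r, r ≠ q → l r = k r then M (l q) (k q) else 0

/-- The unitary operation of a gate. -/
def Gate.matrix {n : ℕ} : Gate n → Matrix (Bits n) (Bits n) ℂ
  | .H q => onQubit q
      (Matrix.of fun a b => ((1 / Real.sqrt 2 : ℝ) : ℂ) * (-1) ^ (a.val * b.val))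
  | .S q => onQubit q (Matrix.diagonal fun a => Complex.I ^ a.val)
  | .CZ s t => Matrix.diagonal fun l => (-1) ^ ((l s).val * (l t).val)

/-- The operation of a circuit, whose gates are listed in the order of application. -/
def circuitMatrix {n : ℕ} : List (Gate n) → Matrix (Bits n) (Bits n) ℂ
  | [] => 1
  | g :: gs => circuitMatrix gs * g.matrix

/-- The three-stage circuit `-H-S-CZ-`: `H` on every qubit, then `S` applied `a_r` times on each
qubit `r`, then `CZ(s, t)` applied `b_{s+t}` times for all `s < t`. -/
def circuit {n : ℕ} (a : Fin n → ℕ) (b : ℕ → ℕ) : List (Gate n) :=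
  (List.finRange n).map Gate.H
    ++ (List.finRange n).flatMap (fun r => List.replicate (a r) (Gate.S r))
    ++ (List.finRange n).flatMap (fun s => (List.finRange n).flatMap fun t =>
        if s < t then List.replicate (b (s.val + t.val)) (Gate.CZ s t) else [])

/-- `a_r = a_r(j) ∈ {0,1,2,3}` and `b_{s+t} = b_{s,t}(j) ∈ {0,1}` for `s < t`: the coefficients
of `U(j)`. They are determined by `j` (only `b_m` with `1 ≤ m ≤ 2n-3` matters). -/
def IsCoefficients {n : ℕ} (p : Polynomial (ZMod 2)) (j : Bits n)
    (a : Fin n → ℕ) (b : ℕ → ℕ) : Prop :=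
  (∀ r : Fin n, a r < 4 ∧ ∀ x : ZMod 2,
    Complex.I ^ (a r * x.val) = (starRingEnd ℂ) (Complex.I ^ expo p j r r x x)) ∧
  (∀ s t : Fin n, s < t → b (s.val + t.val) < 2 ∧ ∀ x y : ZMod 2,
    (-1 : ℤ) ^ (b (s.val + t.val) * (x.val * y.val)) = (-1) ^ expo p j s t x y)

/-! ### The computational task -/

/-- The words of the binary vectors `j⁽⁰⁾, …, j⁽ᵀ⁻¹⁾`, one bit per word. -/
def encodeIndices {n T : ℕ} (j : Fin T → Bits n) : List ℕ :=
  (List.ofFn j).flatMap fun v => List.ofFn fun r => (v r).val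

/-- The words of `p_0, …, p_{n-1}`, one bit per word. -/
def encodePoly (n : ℕ) (p : Polynomial (ZMod 2)) : List ℕ :=
  (List.range n).map fun i => (p.coeff i).val

/-- The output consists of `T` blocks of `3n` words. Words `0, …, n-1` of the `i`-th block are the
`a_r(j⁽ⁱ⁾)`, and its word `n + m` is `b_m(j⁽ⁱ⁾)`; the circuit with these coefficients is
`U(j⁽ⁱ⁾)`. -/
def IsOutput {w n T : ℕ} (p : Polynomial (ZMod 2)) (j : Fin T → Bits n) (τ : State w) : Prop :=
  ∀ i : Fin T,
    IsCoefficients p (j i) (fun r => τ.out (3 * n * i + r)) (fun m => τ.out (3 * n * i + n + m)) ∧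
    circuitMatrix (circuit (n := n) (fun r => τ.out (3 * n * i + r))
      (fun m => τ.out (3 * n * i + n + m))) = U p (j i)

end MUB

end

/-! The exponent `j ⊙ (x 2^s) ⊙ (y 2^t)` is `x y` times the integer that encodes `j X^(s+t) mod p`,
so it depends on `s + t` only (`expo_eq`). With `v_m = j X^m mod p` read as an integer, `a_r` is
`-v_{2r}` modulo 4 and `b_m` is `v_m` modulo 2. A circuit therefore costs `2n` successive
multiplications by `X` modulo `p`, each a shift and a conditional xor of a row of `n` bits. This
gives O(n²) per circuit and settles the deterministic half. These coefficients do yield `U(j)`: the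
product `alpha` splits into its diagonal, which the `S` gates produce, and the pairs `(s, t), (t,
s)`, which the `CZ` gates produce because the square of the conjugate of `i^e` is `(-1)^e`
(`circuitMatrix_circuit`).

In the randomized half, polynomials of degree `n` with constant term 1 are drawn until one is
irreducible. A polynomial of degree `n` is irreducible exactly if it is coprime to `X^(2^i) + X` for
`1 ≤ i ≤ n/2` (`noFactor_succ`, `irreducible_iff_noFactor`). A round of this test is one modular
squaring and one binary gcd, that is, O(n) operations on rows; after the first failure a round costs
O(1). A row packs about `log n` bits into each word, hence has `W`, about `n / log n`, words, and a
round costs O(nW).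

Two counts bound the expected time, both drawn from the identity `card_rough_identity`, which counts
pairs of a polynomial and a prime power dividing it. At most `2^n / i` polynomials of degree `n`
have no factor of degree at most `i` (`mul_card_rough_le`), so a draw survives O(log n) rounds on
average (`sum_rounds_le`) and costs O(n²) on average. At least one in `n` of the polynomials drawn
is irreducible (`two_pow_le_card_coinPoly`). The draws use disjoint, hence independent, blocks of
coins, so the expected cost of the search is a geometric series with sum O(n³)
(`lintegral_searchCost_le`).

The programs are written in a small structured language over natural numbers with a read-only input,
an output block and two-dimensional arrays. It is compiled to the machine, and `HT` is a Hoare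
triple with a step bound for the compiled code. -/

namespace MUB

/-! ### Determinism of the machine -/

/-- The guards of the two rules for a branch or a loop exclude each other, so induction on the first
execution determines the second. Exhibiting one execution thus settles what every execution does. -/
theorem Exec.det {w : ℕ} {P : Prog} {σ τ τ' : State w} {t t' : ℕ}
    (h : Exec P σ t τ) (h' : Exec P σ t' τ') : t = t' ∧ τ = τ' := by
  induction h generalizing t' τ' with
  | skip | const | op | load | store | coin => cases h'; exact ⟨rfl, rfl⟩
  | seq _ _ ih₁ ih₂ =>
    cases h' with
    | seq a b =>
      obtain ⟨rfl, rfl⟩ := ih₁ a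
      obtain ⟨rfl, rfl⟩ := ih₂ b
      exact ⟨rfl, rfl⟩
  | ite_true hx _ ih =>
    cases h' with
    | ite_true _ a => obtain ⟨rfl, rfl⟩ := ih a; exact ⟨rfl, rfl⟩
    | ite_false hx' _ => exact absurd hx' hx
  | ite_false hx _ ih =>
    cases h' with
    | ite_false _ a => obtain ⟨rfl, rfl⟩ := ih a; exact ⟨rfl, rfl⟩
    | ite_true hx' _ => exact absurd hx hx'
  | loop_stop hx =>
    cases h' with
    | loop_stop => exact ⟨rfl, rfl⟩
    | loop_step hx' => exact absurd hx hx'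
  | loop_step hx _ _ ih₁ ih₂ =>
    cases h' with
    | loop_stop hx' => exact absurd hx' hx
    | loop_step _ a b =>
      obtain ⟨rfl, rfl⟩ := ih₁ a
      obtain ⟨rfl, rfl⟩ := ih₂ b
      exact ⟨rfl, rfl⟩

theorem runTime_le {w : ℕ} {P : Prog} {σ τ : State w} {t : ℕ} (h : Exec P σ t τ) :
    runTime P σ ≤ t :=
  iInf_le_of_le t <| iInf_le_of_le τ <| iInf_le_of_le h le_rfl

/-! ### A structured language over natural numbers -/

/-- The effect of a word operation on natural numbers. -/
def BinOp.nat : BinOp → ℕ → ℕ → ℕ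
  | .add, a, b => a + b
  | .sub, a, b => a - b
  | .mul, a, b => a * b
  | .and, a, b => a &&& b
  | .or, a, b => a ||| b
  | .xor, a, b => a ^^^ b
  | .shl, a, b => a <<< b
  | .shr, a, b => a >>> b
  | .lt, a, b => if a < b then 1 else 0
  | .eq, a, b => if a = b then 1 else 0

/-- The operation does not over- or underflow on words of `w` bits. -/
def BinOp.Ok (w : ℕ) : BinOp → ℕ → ℕ → Prop
  | .add, a, b => a + b < 2 ^ w
  | .sub, a, b => b ≤ a
  | .mul, a, b => a * b < 2 ^ w
  | .shl, a, b => a <<< b < 2 ^ w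
  | _, _, _ => True

theorem BinOp.toNat_eval {w : ℕ} (hw : 1 < 2 ^ w) (o : BinOp) (a b : BitVec w)
    (h : o.Ok w a.toNat b.toNat) : (o.eval a b).toNat = o.nat a.toNat b.toNat := by
  cases o <;> simp only [BinOp.eval, BinOp.nat, BinOp.Ok] at *
  · rw [BitVec.toNat_add, Nat.mod_eq_of_lt h]
  · rw [BitVec.toNat_sub_of_le h]
  · rw [BitVec.toNat_mul, Nat.mod_eq_of_lt h]
  · simp
  · simp
  · simp
  · rw [BitVec.toNat_shiftLeft, Nat.mod_eq_of_lt h]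
  · simp
  · split_ifs <;> simp [Nat.mod_eq_of_lt hw]
  · simp only [BitVec.toNat_inj]
    split_ifs <;> simp [Nat.mod_eq_of_lt hw]

/-- Expressions: constants, variables, operations, input cells and array cells. -/
inductive Expr
  | c (k : ℕ)
  | v (x : ℕ)
  | op (o : BinOp) (e f : Expr)
  | inp (e : Expr)
  | ld (a : ℕ) (e f : Expr)

/-- Structured programs with a read-only input, an output block, and two-dimensional arrays. -/
inductive Stmt
  | skip
  | set (x : ℕ) (e : Expr)
  | st (a : ℕ) (e f g : Expr)
  | out (e f : Expr)
  | coin (x : ℕ)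
  | seq (P Q : Stmt)
  | ite (e : Expr) (P Q : Stmt)
  | loop (e : Expr) (P : Stmt)

infixr:60 " ;; " => Stmt.seq

/-- States of the structured language. -/
structure NState where
  reg : ℕ → ℕ
  out : ℕ → ℕ
  arr : ℕ → ℕ → ℕ → ℕ
  tape : ℕ → Bool

/-- Memory layout: word size, lengths of input and output, numbers of rows and columns of the
arrays, and the contents of the input. -/
structure Layout where
  w : ℕ
  L : ℕ
  M : ℕ
  R : ℕ
  D : ℕ
  inp : ℕ → ℕ

def NState.set (s : NState) (x v : ℕ) : NState := { s with reg := Function.update s.reg x v }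

def NState.setOut (s : NState) (i v : ℕ) : NState := { s with out := Function.update s.out i v }

def NState.put (s : NState) (a i j v : ℕ) : NState :=
  { s with arr := fun a' i' j' => if a' = a ∧ i' = i ∧ j' = j then v else s.arr a' i' j' }

def NState.flip (s : NState) (x : ℕ) : NState :=
  { s.set x (s.tape 0).toNat with tape := fun i => s.tape (i + 1) }

@[simp] theorem NState.set_reg (s : NState) (x v y : ℕ) :
    (s.set x v).reg y = if y = x then v else s.reg y := by
  simp [NState.set, Function.update_apply]

@[simp] theorem NState.set_out (s : NState) (x v : ℕ) : (s.set x v).out = s.out := rfl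
@[simp] theorem NState.set_arr (s : NState) (x v : ℕ) : (s.set x v).arr = s.arr := rfl
@[simp] theorem NState.set_tape (s : NState) (x v : ℕ) : (s.set x v).tape = s.tape := rfl

@[simp] theorem NState.setOut_reg (s : NState) (x v : ℕ) : (s.setOut x v).reg = s.reg := rfl
@[simp] theorem NState.setOut_out (s : NState) (x v y : ℕ) :
    (s.setOut x v).out y = if y = x then v else s.out y := by
  simp [NState.setOut, Function.update_apply]
@[simp] theorem NState.setOut_arr (s : NState) (x v : ℕ) : (s.setOut x v).arr = s.arr := rfl

@[simp] theorem NState.put_reg (s : NState) (a i j v : ℕ) : (s.put a i j v).reg = s.reg := rfl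
@[simp] theorem NState.put_out (s : NState) (a i j v : ℕ) : (s.put a i j v).out = s.out := rfl
@[simp] theorem NState.put_arr (s : NState) (a i j v a' i' j' : ℕ) :
    (s.put a i j v).arr a' i' j' = if a' = a ∧ i' = i ∧ j' = j then v else s.arr a' i' j' := rfl

@[simp] theorem NState.flip_reg (s : NState) (x y : ℕ) :
    (s.flip x).reg y = if y = x then (s.tape 0).toNat else s.reg y := by
  simp [NState.flip]
@[simp] theorem NState.flip_out (s : NState) (x : ℕ) : (s.flip x).out = s.out := rfl
@[simp] theorem NState.flip_arr (s : NState) (x : ℕ) : (s.flip x).arr = s.arr := rfl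
@[simp] theorem NState.flip_tape (s : NState) (x i : ℕ) : (s.flip x).tape i = s.tape (i + 1) := rfl

/-- Value of an expression. -/
@[simp] def Expr.ev (ℓ : Layout) (s : NState) : Expr → ℕ
  | .c k => k
  | .v x => s.reg x
  | .op o e f => o.nat (e.ev ℓ s) (f.ev ℓ s)
  | .inp e => ℓ.inp (e.ev ℓ s)
  | .ld a e f => s.arr a (e.ev ℓ s) (f.ev ℓ s)

/-- The evaluation neither overflows nor leaves the memory blocks. -/
@[simp] def Expr.Ok (ℓ : Layout) (s : NState) : Expr → Prop
  | .c k => k < 2 ^ ℓ.w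
  | .v _ => True
  | .op o e f => e.Ok ℓ s ∧ f.Ok ℓ s ∧ o.Ok ℓ.w (e.ev ℓ s) (f.ev ℓ s)
  | .inp e => e.Ok ℓ s ∧ e.ev ℓ s < ℓ.L
  | .ld a e f => e.Ok ℓ s ∧ f.Ok ℓ s ∧ a < 16 ∧ e.ev ℓ s < ℓ.R ∧ f.ev ℓ s < ℓ.D

@[simp] def Expr.cost : Expr → ℕ
  | .c _ => 1
  | .v _ => 1
  | .op _ e f => e.cost + f.cost + 1
  | .inp e => e.cost + 1
  | .ld _ e f => e.cost + f.cost + 8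

/-- `T := 16 * (T * D + U) + a + base`, where `U` is the register after `T`. -/
def addrProg (a t : ℕ) : Prog :=
  .seq (.op .mul (2 * t + 6) (2 * t + 6) 4) <|
  .seq (.op .add (2 * t + 6) (2 * t + 6) (2 * (t + 1) + 6)) <|
  .seq (.const (2 * (t + 1) + 6) 16) <|
  .seq (.op .mul (2 * t + 6) (2 * t + 6) (2 * (t + 1) + 6)) <|
  .seq (.const (2 * (t + 1) + 6) a) <|
  .seq (.op .add (2 * t + 6) (2 * t + 6) (2 * (t + 1) + 6)) <|
  .op .add (2 * t + 6) (2 * t + 6) 3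

/-- Variable `x` lives in register `2x + 5` and temporary `t` in register `2t + 6`, so the two kinds
differ in parity and avoid the layout registers `2`, `3`, `4`. The value ends up in temporary `t`,
and no temporary below `t` is touched. -/
def Expr.compile : Expr → ℕ → Prog
  | .c k, t => .const (2 * t + 6) k
  | .v x, t => .op .or (2 * t + 6) (2 * x + 5) (2 * x + 5)
  | .op o e f, t => .seq (e.compile t) <| .seq (f.compile (t + 1)) <|
      .op o (2 * t + 6) (2 * t + 6) (2 * (t + 1) + 6)
  | .inp e, t => .seq (e.compile t) (.load (2 * t + 6) (2 * t + 6))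
  | .ld a e f, t => .seq (e.compile t) <| .seq (f.compile (t + 1)) <|
      .seq (addrProg a t) (.load (2 * t + 6) (2 * t + 6))

/-- Registers `6`, `8`, `10` are the temporaries `0`, `1`, `2`. The machine loop only tests a
register, so the condition is evaluated before entry and again at the end of each round. -/
def Stmt.compile : Stmt → Prog
  | .skip => .skip
  | .set x e => .seq (e.compile 0) (.op .or (2 * x + 5) 6 6)
  | .st a e f g => .seq (g.compile 0) <| .seq (e.compile 1) <| .seq (f.compile 2) <|
      .seq (addrProg a 1) (.store 8 6)
  | .out e f => .seq (f.compile 0) <| .seq (e.compile 1) <| .seq (.op .add 8 8 2) (.store 8 6)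
  | .coin x => .coin (2 * x + 5)
  | .seq P Q => .seq P.compile Q.compile
  | .ite e P Q => .seq (e.compile 0) (.ite 6 P.compile Q.compile)
  | .loop e P => .seq (e.compile 0) (.loop 6 (.seq P.compile (e.compile 0)))

/-- Interleaving the sixteen arrays lets a single base address and a single row length serve all of
them. -/
def Layout.addr (ℓ : Layout) (a i j : ℕ) : ℕ := ℓ.L + ℓ.M + (16 * (i * ℓ.D + j) + a)

/-- The machine state `σ` represents the state `s`. -/
structure Rep (ℓ : Layout) (σ : State ℓ.w) (s : NState) : Prop where
  reg : ∀ x, (σ.reg (2 * x + 5)).toNat = s.reg x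
  regL : (σ.reg 2).toNat = ℓ.L
  regB : (σ.reg 3).toNat = ℓ.L + ℓ.M
  regD : (σ.reg 4).toNat = ℓ.D
  fit : ℓ.L + ℓ.M + 16 * (ℓ.R * ℓ.D) < 2 ^ ℓ.w
  pos : 16 < 2 ^ ℓ.w
  inp : ∀ i < ℓ.L, (σ.mem (BitVec.ofNat ℓ.w i)).toNat = ℓ.inp i
  out : ∀ i < ℓ.M, (σ.mem (BitVec.ofNat ℓ.w (ℓ.L + i))).toNat = s.out i
  arr : ∀ a < 16, ∀ i < ℓ.R, ∀ j < ℓ.D,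
    (σ.mem (BitVec.ofNat ℓ.w (ℓ.addr a i j))).toNat = s.arr a i j
  tape : σ.tape = s.tape

theorem Layout.cell_lt (ℓ : Layout) {i j : ℕ} (hi : i < ℓ.R) (hj : j < ℓ.D) :
    i * ℓ.D + j + 1 ≤ ℓ.R * ℓ.D := by
  have := Nat.mul_le_mul_right ℓ.D hi
  rw [Nat.succ_mul] at this
  omega

/-- The remainder of the offset modulo `16` gives the array; dividing the quotient by `D` gives row
and column. -/
theorem Layout.addr_inj (ℓ : Layout) {a i j a' i' j' : ℕ} (ha : a < 16) (ha' : a' < 16)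
    (hj : j < ℓ.D) (hj' : j' < ℓ.D) (h : ℓ.addr a i j = ℓ.addr a' i' j') :
    a = a' ∧ i = i' ∧ j = j' := by
  unfold Layout.addr at h
  have h1 : a = a' := by omega
  have h2 : i * ℓ.D + j = i' * ℓ.D + j' := by omega
  have hD : 0 < ℓ.D := by omega
  have h3 : i = i' := by
    have := congrArg (· / ℓ.D) h2
    simpa [Nat.add_div_of_dvd_right, mul_comm _ ℓ.D, Nat.mul_add_div hD, Nat.div_eq_of_lt hj,
      Nat.div_eq_of_lt hj'] using this
  subst h3
  exact ⟨h1, rfl, by omega⟩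

@[simp] theorem State.setReg_reg {w : ℕ} (σ : State w) (x : ℕ) (v : BitVec w) (y : ℕ) :
    (σ.setReg x v).reg y = if y = x then v else σ.reg y := by
  simp [State.setReg, Function.update_apply]

@[simp] theorem State.setReg_mem {w : ℕ} (σ : State w) (x : ℕ) (v : BitVec w) :
    (σ.setReg x v).mem = σ.mem := rfl

/-- `τ` differs from `σ` at most in the temporary registers from number `t` on. -/
def Frame {w : ℕ} (t : ℕ) (σ τ : State w) : Prop :=
  τ.mem = σ.mem ∧ τ.tape = σ.tape ∧ ∀ r, r % 2 = 1 ∨ r < 2 * t + 6 → τ.reg r = σ.reg r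

theorem Frame.trans {w t t' : ℕ} {σ τ υ : State w} (h : Frame t σ τ) (h' : Frame t' τ υ)
    (ht : t ≤ t') : Frame t σ υ :=
  ⟨h'.1.trans h.1, h'.2.1.trans h.2.1, fun r hr => (h'.2.2 r (by omega)).trans (h.2.2 r hr)⟩

theorem Frame.setReg {w t t' : ℕ} (σ : State w) (v : BitVec w) (ht : t ≤ t') :
    Frame t σ (σ.setReg (2 * t' + 6) v) :=
  ⟨rfl, rfl, fun r hr => by
    rw [State.setReg_reg, if_neg (by omega)]⟩

theorem Rep.frame {ℓ : Layout} {σ τ : State ℓ.w} {s : NState} {t : ℕ} (h : Rep ℓ σ s)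
    (hf : Frame t σ τ) : Rep ℓ τ s where
  reg x := by rw [hf.2.2 _ (by omega), h.reg]
  regL := by rw [hf.2.2 _ (by omega), h.regL]
  regB := by rw [hf.2.2 _ (by omega), h.regB]
  regD := by rw [hf.2.2 _ (by omega), h.regD]
  fit := h.fit
  pos := h.pos
  inp i hi := by rw [hf.1, h.inp i hi]
  out i hi := by rw [hf.1, h.out i hi]
  arr a ha i hi j hj := by rw [hf.1, h.arr a ha i hi j hj]
  tape := by rw [hf.2.1, h.tape]

theorem exec_op {w : ℕ} (hw : 1 < 2 ^ w) (σ : State w) (o : BinOp) (x y z : ℕ)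
    (h : o.Ok w (σ.reg y).toNat (σ.reg z).toNat) :
    ∃ v : BitVec w, Exec (.op o x y z) σ 1 (σ.setReg x v) ∧
      v.toNat = o.nat (σ.reg y).toNat (σ.reg z).toNat :=
  ⟨_, Exec.op σ o x y z, BinOp.toNat_eval hw o _ _ h⟩

theorem exec_const {w : ℕ} (σ : State w) (x k : ℕ) (h : k < 2 ^ w) :
    ∃ v : BitVec w, Exec (.const x k) σ 1 (σ.setReg x v) ∧ v.toNat = k :=
  ⟨_, Exec.const σ x k, by simp [Nat.mod_eq_of_lt h]⟩

/-- Nothing overflows: each partial result is at most the final address, which `fit` keeps below `2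
^ w`, and the constants are covered by `pos`. -/
theorem exec_addrProg {ℓ : Layout} {σ : State ℓ.w} {s : NState} (h : Rep ℓ σ s) (a t : ℕ)
    {i j : ℕ} (hi : (σ.reg (2 * t + 6)).toNat = i) (hj : (σ.reg (2 * (t + 1) + 6)).toNat = j)
    (ha : a < 16) (hiR : i < ℓ.R) (hjD : j < ℓ.D) :
    ∃ τ, Exec (addrProg a t) σ 7 τ ∧ (τ.reg (2 * t + 6)) = BitVec.ofNat ℓ.w (ℓ.addr a i j) ∧
      Frame t σ τ := by
  have hp := h.pos
  have hfit := h.fit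
  have hc := ℓ.cell_lt hiR hjD
  obtain ⟨v1, e1, n1⟩ := exec_op (by omega) σ .mul (2 * t + 6) (2 * t + 6) 4
    (by rw [hi, h.regD]; simp only [BinOp.Ok]; omega)
  obtain ⟨v2, e2, n2⟩ := exec_op (by omega) (σ.setReg (2 * t + 6) v1) .add (2 * t + 6) (2 * t + 6)
    (2 * (t + 1) + 6) (by
      rw [State.setReg_reg, State.setReg_reg, if_pos rfl, if_neg (by omega), n1, hi, h.regD, hj]
      simp only [BinOp.Ok, BinOp.nat]; omega)
  rw [State.setReg_reg, State.setReg_reg, if_pos rfl, if_neg (by omega), n1, hi, h.regD, hj] at n2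
  simp only [BinOp.nat] at n2
  set σ2 := (σ.setReg (2 * t + 6) v1).setReg (2 * t + 6) v2 with hσ2
  have f2 : Frame t σ σ2 := (Frame.setReg σ v1 le_rfl).trans (Frame.setReg _ v2 le_rfl) le_rfl
  have r2 : (σ2.reg (2 * t + 6)).toNat = i * ℓ.D + j := by rw [hσ2, State.setReg_reg, if_pos rfl, n2]
  clear_value σ2
  obtain ⟨v3, e3, n3⟩ := exec_const σ2 (2 * (t + 1) + 6) 16 hp
  obtain ⟨v4, e4, n4⟩ := exec_op (by omega) (σ2.setReg (2 * (t + 1) + 6) v3) .mul (2 * t + 6)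
    (2 * t + 6) (2 * (t + 1) + 6) (by
      rw [State.setReg_reg, State.setReg_reg, if_neg (by omega), if_pos rfl, r2, n3]
      simp only [BinOp.Ok]; omega)
  rw [State.setReg_reg, State.setReg_reg, if_neg (by omega), if_pos rfl, r2, n3] at n4
  simp only [BinOp.nat] at n4
  set σ4 := (σ2.setReg (2 * (t + 1) + 6) v3).setReg (2 * t + 6) v4 with hσ4
  have f4 : Frame t σ σ4 := f2.trans
    ((Frame.setReg σ2 v3 (t := t) (by omega)).trans (Frame.setReg _ v4 le_rfl) le_rfl) le_rfl
  have r4 : (σ4.reg (2 * t + 6)).toNat = (i * ℓ.D + j) * 16 := by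
    rw [hσ4, State.setReg_reg, if_pos rfl, n4]
  clear_value σ4
  obtain ⟨v5, e5, n5⟩ := exec_const σ4 (2 * (t + 1) + 6) a (by omega)
  obtain ⟨v6, e6, n6⟩ := exec_op (by omega) (σ4.setReg (2 * (t + 1) + 6) v5) .add (2 * t + 6)
    (2 * t + 6) (2 * (t + 1) + 6) (by
      rw [State.setReg_reg, State.setReg_reg, if_neg (by omega), if_pos rfl, r4, n5]
      simp only [BinOp.Ok]; omega)
  rw [State.setReg_reg, State.setReg_reg, if_neg (by omega), if_pos rfl, r4, n5] at n6
  simp only [BinOp.nat] at n6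
  set σ6 := (σ4.setReg (2 * (t + 1) + 6) v5).setReg (2 * t + 6) v6 with hσ6
  have f6 : Frame t σ σ6 := f4.trans
    ((Frame.setReg σ4 v5 (t := t) (by omega)).trans (Frame.setReg _ v6 le_rfl) le_rfl) le_rfl
  have r6 : (σ6.reg (2 * t + 6)).toNat = (i * ℓ.D + j) * 16 + a := by
    rw [hσ6, State.setReg_reg, if_pos rfl, n6]
  clear_value σ6
  obtain ⟨v7, e7, n7⟩ := exec_op (by omega) σ6 .add (2 * t + 6) (2 * t + 6) 3 (by
      rw [r6, (h.frame f6).regB]; simp only [BinOp.Ok]; omega)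
  rw [r6, (h.frame f6).regB] at n7
  simp only [BinOp.nat] at n7
  refine ⟨_, Exec.seq e1 (Exec.seq e2 (Exec.seq e3 (Exec.seq e4 (Exec.seq e5 (Exec.seq e6 e7))))),
    ?_, f6.trans (Frame.setReg _ v7 le_rfl) le_rfl⟩
  rw [State.setReg_reg, if_pos rfl, ← BitVec.toNat_inj, n7, BitVec.toNat_ofNat, Nat.mod_eq_of_lt]
  · unfold Layout.addr; ring
  · unfold Layout.addr; omega

/-- The frame clause carries the induction: the value of a first operand waits in temporary `t`
while the second operand is computed from temporary `t + 1` on. -/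
theorem exec_expr {ℓ : Layout} {s : NState} (e : Expr) : ∀ {σ : State ℓ.w} (_ : Rep ℓ σ s)
    (_ : e.Ok ℓ s) (t : ℕ), ∃ τ, Exec (e.compile t) σ e.cost τ ∧
      (τ.reg (2 * t + 6)).toNat = e.ev ℓ s ∧ Frame t σ τ := by
  induction e with
  | c k =>
    intro σ h ok t
    obtain ⟨v, e, n⟩ := exec_const σ (2 * t + 6) k ok
    exact ⟨_, e, by simp [n], Frame.setReg _ _ le_rfl⟩
  | v x =>
    intro σ h ok t
    have := h.pos
    obtain ⟨v, e, n⟩ := exec_op (by omega) σ .or (2 * t + 6) (2 * x + 5) (2 * x + 5) trivial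
    exact ⟨_, e, by simp [n, BinOp.nat, h.reg], Frame.setReg _ _ le_rfl⟩
  | op o e f ihe ihf =>
    intro σ h ok t
    have := h.pos
    obtain ⟨τ, e1, n1, f1⟩ := ihe h ok.1 t
    obtain ⟨υ, e2, n2, f2⟩ := ihf (h.frame f1) ok.2.1 (t + 1)
    have n1' : (υ.reg (2 * t + 6)).toNat = e.ev ℓ s := by rw [f2.2.2 _ (by omega), n1]
    obtain ⟨v, e3, n3⟩ := exec_op (by omega) υ o (2 * t + 6) (2 * t + 6) (2 * (t + 1) + 6)
      (by rw [n1', n2]; exact ok.2.2)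
    refine ⟨_, ?_, ?_, (f1.trans f2 (by omega)).trans (Frame.setReg _ v le_rfl) le_rfl⟩
    · have := Exec.seq e1 (Exec.seq e2 e3)
      rwa [← add_assoc] at this
    · simp [n3, n1', n2]
  | inp e ihe =>
    intro σ h ok t
    obtain ⟨τ, e1, n1, f1⟩ := ihe h ok.1 t
    refine ⟨_, Exec.seq e1 (Exec.load τ _ _), ?_, f1.trans (Frame.setReg _ _ le_rfl) le_rfl⟩
    have := (h.frame f1).inp _ ok.2
    rw [← n1, BitVec.ofNat_toNat, BitVec.setWidth_eq] at this
    simp [this, n1]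
  | ld a e f ihe ihf =>
    intro σ h ok t
    obtain ⟨ok1, ok2, ha, hi, hj⟩ := ok
    obtain ⟨τ, e1, n1, f1⟩ := ihe h ok1 t
    obtain ⟨υ, e2, n2, f2⟩ := ihf (h.frame f1) ok2 (t + 1)
    have n1' : (υ.reg (2 * t + 6)).toNat = e.ev ℓ s := by rw [f2.2.2 _ (by omega), n1]
    have f2' := f1.trans f2 (Nat.le_succ t)
    obtain ⟨φ, e3, n3, f3⟩ := exec_addrProg (h.frame f2') a t n1' n2 ha hi hj
    have f3' := f2'.trans f3 le_rfl
    refine ⟨_, ?_, ?_, f3'.trans (Frame.setReg _ (φ.mem (φ.reg (2 * t + 6))) le_rfl) le_rfl⟩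
    · have := Exec.seq e1 (Exec.seq e2 (Exec.seq e3 (Exec.load φ (2 * t + 6) (2 * t + 6))))
      rwa [← add_assoc] at this
    · simp [n3, (h.frame f3').arr a ha _ hi _ hj]

end MUB

namespace MUB

/-! ### Timed Hoare triples -/

/-- From every representation of `s`, the program `P` halts within `B` steps in a representation
of a state that satisfies `Q`. -/
def HT (ℓ : Layout) (P : Stmt) (s : NState) (B : ℕ) (Q : NState → Prop) : Prop :=
  ∀ σ : State ℓ.w, Rep ℓ σ s → ∃ t τ s', Exec P.compile σ t τ ∧ t ≤ B ∧ Rep ℓ τ s' ∧ Q s'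

theorem Rep.set {ℓ : Layout} {σ : State ℓ.w} {s : NState} (h : Rep ℓ σ s) (x : ℕ)
    (v : BitVec ℓ.w) : Rep ℓ (σ.setReg (2 * x + 5) v) (s.set x v.toNat) where
  reg y := by
    rw [State.setReg_reg, NState.set_reg]
    split_ifs with h1 h2 h2
    · rfl
    · omega
    · omega
    · exact h.reg y
  regL := by rw [State.setReg_reg, if_neg (by omega), h.regL]
  regB := by rw [State.setReg_reg, if_neg (by omega), h.regB]
  regD := by rw [State.setReg_reg, if_neg (by omega), h.regD]
  fit := h.fit
  pos := h.pos
  inp := h.inp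
  out := h.out
  arr := h.arr
  tape := h.tape

variable {ℓ : Layout} {s : NState} {B B₁ B₂ : ℕ} {P P₁ P₂ : Stmt} {Q Q' : NState → Prop}

theorem HT.mono {B' : ℕ} (h : HT ℓ P s B Q) (hB : B ≤ B') (hQ : ∀ s', Q s' → Q' s') :
    HT ℓ P s B' Q' := fun σ r =>
  let ⟨t, τ, s', e, ht, r', q⟩ := h σ r
  ⟨t, τ, s', e, ht.trans hB, r', hQ _ q⟩

theorem HT.post (h : HT ℓ P s B Q) (hQ : ∀ s', Q s' → Q' s') : HT ℓ P s B Q' :=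
  h.mono le_rfl hQ

theorem HT.skip (hB : 1 ≤ B) (hQ : Q s) : HT ℓ .skip s B Q := fun σ r =>
  ⟨1, σ, s, Exec.skip σ, hB, r, hQ⟩

theorem HT.seq (h₁ : HT ℓ P₁ s B₁ fun s' => HT ℓ P₂ s' B₂ Q) (hB : B₁ + B₂ ≤ B) :
    HT ℓ (P₁ ;; P₂) s B Q := fun σ r =>
  let ⟨t, τ, _, e, ht, r', q⟩ := h₁ σ r
  let ⟨t', τ', s'', e', ht', r'', q'⟩ := q τ r'
  ⟨t + t', τ', s'', Exec.seq e e', (Nat.add_le_add ht ht').trans hB, r'', q'⟩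

theorem HT.set {x : ℕ} {e : Expr} (ok : e.Ok ℓ s) (hQ : Q (s.set x (e.ev ℓ s)))
    (hB : e.cost + 1 ≤ B) : HT ℓ (.set x e) s B Q := by
  intro σ r
  obtain ⟨τ, e1, n1, f1⟩ := exec_expr e r ok 0
  have hp := r.pos
  obtain ⟨v, e2, n2⟩ := exec_op (by omega) τ .or (2 * x + 5) 6 6 trivial
  have := (r.frame f1).set x v
  rw [n2, BinOp.nat, show (τ.reg 6).toNat = _ from n1, Nat.or_self] at this
  exact ⟨_, _, _, Exec.seq e1 e2, hB, this, hQ⟩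

theorem HT.out {e f : Expr} (ok₁ : e.Ok ℓ s) (ok₂ : f.Ok ℓ s) (hM : e.ev ℓ s < ℓ.M)
    (hQ : Q (s.setOut (e.ev ℓ s) (f.ev ℓ s))) (hB : e.cost + f.cost + 2 ≤ B) :
    HT ℓ (.out e f) s B Q := by
  intro σ r
  have hp := r.pos
  have hfit := r.fit
  obtain ⟨τ, e1, n1, f1⟩ := exec_expr f r ok₂ 0
  obtain ⟨υ, e2, n2, f2⟩ := exec_expr e (r.frame f1) ok₁ 1
  have f2' := f1.trans f2 (Nat.zero_le 1)
  have r2 := r.frame f2'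
  have n1' : (υ.reg 6).toNat = f.ev ℓ s := by rw [f2.2.2 _ (by omega)]; exact n1
  obtain ⟨v, e3, n3⟩ := exec_op (by omega) υ .add 8 8 2
    (by rw [show (υ.reg 8).toNat = _ from n2, r2.regL]; simp only [BinOp.Ok]; omega)
  rw [BinOp.nat, show (υ.reg 8).toNat = _ from n2, r2.regL] at n3
  have f3 : Frame 0 υ (υ.setReg 8 v) := Frame.setReg (t' := 1) υ v (by omega)
  have r3 := r2.frame f3
  have hv : v = BitVec.ofNat ℓ.w (ℓ.L + e.ev ℓ s) := by
    rw [← BitVec.toNat_inj, n3, BitVec.toNat_ofNat, Nat.mod_eq_of_lt (by omega), add_comm]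
  -- Addresses below `2 ^ w` are distinct as words, so the store changes this cell only.
  have key : ∀ k, k < 2 ^ ℓ.w → BitVec.ofNat ℓ.w k = v → k = ℓ.L + e.ev ℓ s := by
    intro k hk h
    have := congrArg BitVec.toNat h
    rwa [BitVec.toNat_ofNat, Nat.mod_eq_of_lt hk, n3, add_comm] at this
  refine ⟨_, _, _, Exec.seq e1 (Exec.seq e2 (Exec.seq e3 (Exec.store _ 8 6))), by omega, ?_, hQ⟩
  refine ⟨r3.reg, r3.regL, r3.regB, r3.regD, r3.fit, r3.pos, fun i hi => ?_, fun i hi => ?_,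
    fun a ha i hi j hj => ?_, r3.tape⟩
  · dsimp only
    rw [Function.update_apply, if_neg]
    · exact r3.inp i hi
    · intro h
      have := key i (by omega) (by simpa using h)
      omega
  · dsimp only
    rw [Function.update_apply, NState.setOut_out]
    by_cases h : i = e.ev ℓ s
    · rw [if_pos h, if_pos (by rw [h]; simpa using hv.symm)]
      simpa using n1'
    · rw [if_neg h, if_neg]
      · exact r3.out i hi
      · intro h'
        have := key (ℓ.L + i) (by omega) (by simpa using h')
        omega
  · dsimp only
    rw [Function.update_apply, if_neg]
    · exact r3.arr a ha i hi j hj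
    · have := ℓ.cell_lt hi hj
      intro h
      have := key (ℓ.addr a i j) (by unfold Layout.addr; omega) (by simpa using h)
      unfold Layout.addr at this
      omega

theorem HT.st {a : ℕ} {e f g : Expr} (ok₁ : e.Ok ℓ s) (ok₂ : f.Ok ℓ s) (ok₃ : g.Ok ℓ s)
    (ha : a < 16) (hR : e.ev ℓ s < ℓ.R) (hD : f.ev ℓ s < ℓ.D)
    (hQ : Q (s.put a (e.ev ℓ s) (f.ev ℓ s) (g.ev ℓ s)))
    (hB : e.cost + f.cost + g.cost + 8 ≤ B) : HT ℓ (.st a e f g) s B Q := by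
  intro σ r
  have hp := r.pos
  have hfit := r.fit
  obtain ⟨τ, e1, n1, f1⟩ := exec_expr g r ok₃ 0
  obtain ⟨υ, e2, n2, f2⟩ := exec_expr e (r.frame f1) ok₁ 1
  have f2' := f1.trans f2 (Nat.zero_le 1)
  have n1' : (υ.reg 6).toNat = g.ev ℓ s := by rw [f2.2.2 _ (by omega)]; exact n1
  obtain ⟨φ, e3, n3, f3⟩ := exec_expr f (r.frame f2') ok₂ 2
  have f3' := f2'.trans f3 (Nat.zero_le 2)
  have n1'' : (φ.reg 6).toNat = g.ev ℓ s := by rw [f3.2.2 _ (by omega)]; exact n1'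
  have n2' : (φ.reg (2 * 1 + 6)).toNat = e.ev ℓ s := by rw [f3.2.2 _ (by omega)]; exact n2
  obtain ⟨ψ, e4, n4, f4⟩ := exec_addrProg (r.frame f3') a 1 n2' n3 ha hR hD
  have r4 := r.frame (f3'.trans f4 (Nat.zero_le 1))
  have n1₃ : (ψ.reg 6).toNat = g.ev ℓ s := by rw [f4.2.2 _ (by omega)]; exact n1''
  have hc := ℓ.cell_lt hR hD
  have key : ∀ k, k < 2 ^ ℓ.w → BitVec.ofNat ℓ.w k = ψ.reg 8 →
      k = ℓ.addr a (e.ev ℓ s) (f.ev ℓ s) := by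
    intro k hk h
    have := congrArg BitVec.toNat h
    rw [show ψ.reg 8 = _ from n4] at this
    rwa [BitVec.toNat_ofNat, Nat.mod_eq_of_lt hk, BitVec.toNat_ofNat, Nat.mod_eq_of_lt] at this
    unfold Layout.addr
    omega
  refine ⟨_, _, _, Exec.seq e1 (Exec.seq e2 (Exec.seq e3 (Exec.seq e4 (Exec.store _ 8 6)))),
    by omega, ?_, hQ⟩
  refine ⟨r4.reg, r4.regL, r4.regB, r4.regD, r4.fit, r4.pos, fun i hi => ?_, fun i hi => ?_,
    fun a' ha' i hi j hj => ?_, r4.tape⟩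
  · dsimp only
    rw [Function.update_apply, if_neg]
    · exact r4.inp i hi
    · intro h
      have := key i (by omega) h
      unfold Layout.addr at this
      omega
  · dsimp only
    rw [Function.update_apply, if_neg]
    · exact r4.out i hi
    · intro h
      have := key _ (by omega) h
      unfold Layout.addr at this
      omega
  · have := ℓ.cell_lt hi hj
    dsimp only
    rw [Function.update_apply, NState.put_arr]
    by_cases h : a' = a ∧ i = e.ev ℓ s ∧ j = f.ev ℓ s
    · rw [if_pos h, if_pos, n1₃]
      obtain ⟨rfl, rfl, rfl⟩ := h
      exact n4.symm
    · rw [if_neg h, if_neg]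
      · exact r4.arr a' ha' i hi j hj
      · intro h'
        exact h (ℓ.addr_inj ha' ha hj hD (key _ (by unfold Layout.addr; omega) h'))

theorem HT.coin {x : ℕ} (hQ : Q (s.flip x)) (hB : 1 ≤ B) : HT ℓ (.coin x) s B Q := by
  intro σ r
  have hp := r.pos
  refine ⟨_, _, _, Exec.coin σ _, hB, ?_, hQ⟩
  have h := r.set x (BitVec.ofNat ℓ.w (σ.tape 0).toNat)
  refine ⟨fun y => ?_, h.regL, h.regB, h.regD, h.fit, h.pos, h.inp, h.out, h.arr, ?_⟩
  · rw [show ((_ : State ℓ.w).reg _).toNat = _ from h.reg y, r.tape, NState.set_reg,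
      NState.flip_reg, BitVec.toNat_ofNat, Nat.mod_eq_of_lt]
    have := Bool.toNat_le (s.tape 0)
    omega
  · funext i
    simp [r.tape]

theorem HT.ite {e : Expr} (ok : e.Ok ℓ s) (h₁ : e.ev ℓ s ≠ 0 → HT ℓ P₁ s B₁ Q)
    (h₂ : e.ev ℓ s = 0 → HT ℓ P₂ s B₁ Q) (hB : e.cost + B₁ + 1 ≤ B) :
    HT ℓ (.ite e P₁ P₂) s B Q := by
  intro σ r
  obtain ⟨τ, e1, n1, f1⟩ := exec_expr e r ok 0
  by_cases h : e.ev ℓ s = 0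
  · obtain ⟨t, υ, s', e2, ht, r', q⟩ := h₂ h τ (r.frame f1)
    refine ⟨_, _, _, Exec.seq e1 (Exec.ite_false ?_ e2), by omega, r', q⟩
    rw [← BitVec.toNat_inj, show (τ.reg 6).toNat = _ from n1, h]
    simp
  · obtain ⟨t, υ, s', e2, ht, r', q⟩ := h₁ h τ (r.frame f1)
    refine ⟨_, _, _, Exec.seq e1 (Exec.ite_true ?_ e2), by omega, r', q⟩
    rw [Ne, ← BitVec.toNat_inj, show (τ.reg 6).toNat = _ from n1]
    simpa using h

/-- The index of `I` counts completed rounds, and `m` is the exact number of rounds. Each round is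
charged for the body, the new evaluation of the condition and the test. -/
theorem HT.loop {e : Expr} {I : ℕ → NState → Prop} {m : ℕ} {b : ℕ → ℕ}
    (step : ∀ k < m, ∀ s', I k s' →
      e.Ok ℓ s' ∧ e.ev ℓ s' ≠ 0 ∧ HT ℓ P s' (b k) (I (k + 1)))
    (last : ∀ s', I m s' → e.Ok ℓ s' ∧ e.ev ℓ s' = 0 ∧ Q s') (h0 : I 0 s)
    (hB : ∑ k ∈ Finset.range m, (b k + e.cost + 1) + e.cost + 1 ≤ B) :
    HT ℓ (.loop e P) s B Q := by
  -- Induction on the number `d` of rounds left; register `6` already holds the value of the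
  -- condition.
  have main : ∀ d k, k + d = m → ∀ (σ : State ℓ.w) s', Rep ℓ σ s' → I k s' →
      (σ.reg 6).toNat = e.ev ℓ s' →
      ∃ t τ s'', Exec (.loop 6 (.seq P.compile (e.compile 0))) σ t τ ∧
        t ≤ ∑ i ∈ Finset.Ico k m, (b i + e.cost + 1) + 1 ∧ Rep ℓ τ s'' ∧ Q s'' := by
    intro d
    induction d with
    | zero =>
      intro k hk σ s' r i n
      obtain rfl : k = m := by omega
      obtain ⟨_, ev, q⟩ := last s' i
      refine ⟨1, σ, s', Exec.loop_stop ?_, by simp, r, q⟩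
      rw [← BitVec.toNat_inj, n, ev]
      simp
    | succ d ih =>
      intro k hk σ s' r i n
      obtain ⟨_, ev, body⟩ := step k (by omega) s' i
      obtain ⟨t, τ, s₁, e1, ht, r1, i1⟩ := body σ r
      have ok1 : e.Ok ℓ s₁ := by
        rcases Nat.lt_or_ge (k + 1) m with h | h
        · exact (step _ h _ i1).1
        · obtain rfl : k + 1 = m := by omega
          exact (last _ i1).1
      obtain ⟨υ, e2, n2, f2⟩ := exec_expr e r1 ok1 0
      obtain ⟨t', φ, s₂, e3, ht', r3, q⟩ := ih (k + 1) (by omega) υ s₁ (r1.frame f2) i1 n2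
      refine ⟨_, φ, s₂, Exec.loop_step ?_ (Exec.seq e1 e2) e3, ?_, r3, q⟩
      · rw [Ne, ← BitVec.toNat_inj, n]
        simpa using ev
      · rw [Finset.sum_eq_sum_Ico_succ_bot (by omega)]
        omega
  intro σ r
  have ok0 : e.Ok ℓ s := by
    rcases Nat.eq_zero_or_pos m with rfl | h
    · exact (last _ h0).1
    · exact (step 0 h _ h0).1
  obtain ⟨υ, e2, n2, f2⟩ := exec_expr e r ok0 0
  obtain ⟨t', φ, s₂, e3, ht', r3, q⟩ := main m 0 (by omega) υ s (r.frame f2) h0 n2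
  refine ⟨_, φ, s₂, Exec.seq e2 e3, ?_, r3, q⟩
  rw [← Finset.range_eq_Ico] at ht'
  omega

/-- A halting run of the loop contains, after one round, a strictly shorter halting run from a state
that satisfies the invariant again; strong induction on the number of steps excludes this. -/
theorem HT.loop_diverges {e : Expr} {I : ℕ → NState → Prop} {b : ℕ → ℕ}
    (step : ∀ k, ∀ s', I k s' → e.Ok ℓ s' ∧ e.ev ℓ s' ≠ 0 ∧ HT ℓ P s' (b k) (I (k + 1)))
    (h0 : I 0 s) {σ τ : State ℓ.w} (r : Rep ℓ σ s) {t : ℕ} :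
    ¬ Exec (Stmt.loop e P).compile σ t τ := by
  have main : ∀ t k (σ : State ℓ.w) s', Rep ℓ σ s' → I k s' → (σ.reg 6).toNat = e.ev ℓ s' →
      ¬ Exec (.loop 6 (.seq P.compile (e.compile 0))) σ t τ := by
    intro t
    induction t using Nat.strong_induction_on with
    | _ t ih =>
      intro k σ s' r i n h
      obtain ⟨_, ev, body⟩ := step k s' i
      obtain ⟨t₁, τ₁, s₁, e1, -, r1, i1⟩ := body σ r
      obtain ⟨υ, e2, n2, f2⟩ := exec_expr e r1 (step _ _ i1).1 0
      cases h with
      | loop_stop h =>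
        rw [h] at n
        exact ev (by simpa using n.symm)
      | @loop_step _ _ _ τ' _ t' u _ h1 h2 =>
        obtain ⟨rfl, rfl⟩ := (Exec.seq e1 e2).det h1
        exact ih u (by omega) (k + 1) υ s₁ (r1.frame f2) i1 n2 h2
  intro h
  obtain ⟨υ, e2, n2, f2⟩ := exec_expr e r (step _ _ h0).1 0
  cases h with
  | seq h1 h2 =>
    obtain ⟨rfl, rfl⟩ := e2.det h1
    exact main _ 0 _ s (r.frame f2) h0 n2 h2

/-- `for x < y do P`; the body must not change `x` or `y`. -/
def Stmt.for (x y : ℕ) (P : Stmt) : Stmt :=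
  .set x (.c 0) ;; .loop (.op .lt (.v x) (.v y)) (P ;; .set x (.op .add (.v x) (.c 1)))

/-- A triple speaks only of states that have a representation on the machine, so the size bounds
implied by a representation may be assumed in its proof. The same holds for `HT.of_pos`. -/
theorem HT.reg_lt {x : ℕ} (h : s.reg x < 2 ^ ℓ.w → HT ℓ P s B Q) : HT ℓ P s B Q := fun σ r =>
  h (by rw [← r.reg]; exact BitVec.isLt _) σ r

theorem HT.of_pos (h : 16 < 2 ^ ℓ.w → ℓ.L + ℓ.M + 16 * (ℓ.R * ℓ.D) < 2 ^ ℓ.w → HT ℓ P s B Q) :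
    HT ℓ P s B Q := fun σ r => h r.pos r.fit σ r

/-- A round costs 8 extra steps: 4 for the increment, 3 to evaluate the condition, 1 for the test.
The remaining 6 are 2 for the initialisation and 4 for the last evaluation and test. The body has to
establish the invariant for the state in which the counter has already been increased. -/
theorem HT.for_sum {x y m : ℕ} {I : ℕ → NState → Prop} {b : ℕ → ℕ} (hxy : y ≠ x)
    (hm : s.reg y = m) (h0 : I 0 (s.set x 0))
    (step : ∀ k < m, ∀ s', I k s' → s'.reg x = k → s'.reg y = m →
      HT ℓ P s' (b k) fun s'' => I (k + 1) (s''.set x (k + 1)) ∧ s''.reg x = k ∧ s''.reg y = m)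
    (last : ∀ s', I m s' → s'.reg x = m → Q s')
    (hB : ∑ k ∈ Finset.range m, (b k + 8) + 6 ≤ B) : HT ℓ (.for x y P) s B Q := by
  refine HT.of_pos fun hp _ => HT.reg_lt (x := y) fun hlt => ?_
  rw [hm] at hlt
  refine HT.seq (B₁ := 2) (B₂ := ∑ k ∈ Finset.range m, (b k + 8) + 4)
    (HT.set (by simp) ?_ (by simp)) (by omega)
  refine HT.loop (I := fun k s' => I k s' ∧ s'.reg x = k ∧ s'.reg y = m) (m := m)
    (b := fun k => b k + 4) ?_ ?_ ?_ (by simp [add_assoc])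
  · rintro k hk s' ⟨i, hx, hy⟩
    refine ⟨by simp [BinOp.Ok], by simp [BinOp.nat, hx, hy, hk], ?_⟩
    refine HT.seq ((step k hk s' i hx hy).post ?_) le_rfl
    rintro s'' ⟨i', hx', hy'⟩
    refine HT.set ?_ ?_ (by simp)
    · simp only [Expr.Ok, Expr.ev, BinOp.Ok, hx', true_and]
      omega
    · simp only [Expr.ev, BinOp.nat, hx']
      exact ⟨i', by simp, by simp [hy', hxy]⟩
  · rintro s' ⟨i, hx, hy⟩
    exact ⟨by simp [BinOp.Ok], by simp [BinOp.nat, hx, hy], last s' i hx⟩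
  · exact ⟨h0, by simp, by simp [hm, hxy]⟩

theorem HT.for {x y m b : ℕ} {I : ℕ → NState → Prop} (hxy : y ≠ x)
    (hm : s.reg y = m) (h0 : I 0 (s.set x 0))
    (step : ∀ k < m, ∀ s', I k s' → s'.reg x = k → s'.reg y = m →
      HT ℓ P s' b fun s'' => I (k + 1) (s''.set x (k + 1)) ∧ s''.reg x = k ∧ s''.reg y = m)
    (last : ∀ s', I m s' → s'.reg x = m → Q s')
    (hB : m * (b + 8) + 6 ≤ B) : HT ℓ (.for x y P) s B Q :=
  HT.for_sum (b := fun _ => b) hxy hm h0 step last (by simpa using hB)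

end MUB

namespace MUB

/-! ### Natural numbers in blocks of `B` bits -/

/-- The `q`-th digit of `v` in base `2 ^ B`. -/
def wd (B v q : ℕ) : ℕ := v / 2 ^ (B * q) % 2 ^ B

theorem wd_lt (B v q : ℕ) : wd B v q < 2 ^ B := Nat.mod_lt _ (Nat.two_pow_pos B)

theorem wd_eq_zero {B v q W : ℕ} (hv : v < 2 ^ (B * W)) (hq : W ≤ q) : wd B v q = 0 := by
  rw [wd, Nat.div_eq_of_lt, Nat.zero_mod]
  exact hv.trans_le (Nat.pow_le_pow_right two_pos (Nat.mul_le_mul_left B hq))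

@[simp] theorem wd_zero (B q : ℕ) : wd B 0 q = 0 := by simp [wd]

theorem wd_zero_right (B v : ℕ) : wd B v 0 = v % 2 ^ B := by simp [wd]

theorem wd_xor (B u v q : ℕ) : wd B (u ^^^ v) q = wd B u q ^^^ wd B v q := by
  simp only [wd, ← Nat.shiftRight_eq_div_pow, Nat.shiftRight_xor_distrib, Nat.xor_mod_two_pow]

theorem wd_succ (B v q : ℕ) : wd B v (q + 1) = v / 2 ^ (B * q) / 2 ^ B % 2 ^ B := by
  rw [wd, Nat.mul_succ, pow_add, Nat.div_div_eq_div_mul]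

/-- Halving shifts each digit, and the lowest bit of the next digit becomes its top bit, number `B -
1`. -/
theorem wd_half {B : ℕ} (hB : 1 ≤ B) (v q : ℕ) :
    wd B (v / 2) q = wd B v q / 2 + wd B v (q + 1) % 2 * 2 ^ (B - 1) := by
  rw [wd_succ, wd, wd, Nat.div_div_eq_div_mul, mul_comm 2, ← Nat.div_div_eq_div_mul]
  generalize v / 2 ^ (B * q) = y
  obtain ⟨b, rfl⟩ : ∃ b, B = b + 1 := ⟨B - 1, by omega⟩
  rw [Nat.add_sub_cancel, Nat.mod_mod_of_dvd _ ⟨2 ^ b, by ring⟩]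
  have hH := Nat.two_pow_pos b
  rw [pow_succ]
  generalize 2 ^ b = H at *
  -- With `H = 2 ^ (B - 1)`, write `y = 2 H (2 k' + e) + r`; then `e` is the bit that crosses the
  -- digit boundary.
  have h1 : y = H * 2 * (y / (H * 2)) + y % (H * 2) := (Nat.div_add_mod y (H * 2)).symm
  have hr := Nat.mod_lt y (show 0 < H * 2 by omega)
  generalize y / (H * 2) = k at *
  generalize y % (H * 2) = r at *
  have h2 : k = 2 * (k / 2) + k % 2 := (Nat.div_add_mod k 2).symm
  have he := Nat.mod_lt k two_pos
  generalize k / 2 = k' at *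
  generalize k % 2 = e at *
  have h3 : y / 2 = H * 2 * k' + (r / 2 + e * H) := by
    have : y = 2 * (H * 2 * k' + e * H) + r := by rw [h1, h2]; ring
    omega
  rw [h3, Nat.mul_add_mod, Nat.mod_eq_of_lt]
  have : e * H ≤ 1 * H := Nat.mul_le_mul_right H (by omega)
  omega

/-- The carry into digit `q` when `2 * v + c` is computed. -/
def carry (B v c q : ℕ) : ℕ := (2 * v + c) / 2 ^ (B * q) - 2 * (v / 2 ^ (B * q))

/-- The subtraction in `carry` is never truncated. -/
theorem carry_spec {c : ℕ} (B v q : ℕ) :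
    (2 * v + c) / 2 ^ (B * q) = 2 * (v / 2 ^ (B * q)) + carry B v c q := by
  have : 2 * (v / 2 ^ (B * q)) ≤ (2 * v + c) / 2 ^ (B * q) := by
    rw [Nat.le_div_iff_mul_le (Nat.two_pow_pos _)]
    have := Nat.div_mul_le_self v (2 ^ (B * q))
    nlinarith
  unfold carry
  omega

theorem carry_zero (B v c : ℕ) : carry B v c 0 = c := by simp [carry]

theorem wd_double (B v c q : ℕ) :
    wd B (2 * v + c) q = (2 * wd B v q + carry B v c q) % 2 ^ B := by
  rw [wd, wd, carry_spec, Nat.add_mod, Nat.mul_mod, Nat.add_mod (2 * _), Nat.mul_mod 2 (_ % _)]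
  simp

theorem carry_succ (B v c q : ℕ) :
    carry B v c (q + 1) = (2 * wd B v q + carry B v c q) / 2 ^ B := by
  have h1 := carry_spec (c := c) B v q
  have h2 := carry_spec (c := c) B v (q + 1)
  rw [Nat.mul_succ, pow_add, ← Nat.div_div_eq_div_mul, ← Nat.div_div_eq_div_mul, h1] at h2
  rw [wd]
  generalize v / 2 ^ (B * q) = y at *
  generalize carry B v c q = d at *
  generalize carry B v c (q + 1) = d' at *
  have h3 : y = 2 ^ B * (y / 2 ^ B) + y % 2 ^ B := (Nat.div_add_mod _ _).symm
  have h4 : 2 * y + d = 2 ^ B * (2 * (y / 2 ^ B)) + (2 * (y % 2 ^ B) + d) := by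
    conv_lhs => rw [h3]
    ring
  rw [h4, Nat.mul_add_div (Nat.two_pow_pos B)] at h2
  omega

theorem carry_lt {c : ℕ} (hc : c < 2) (B v q : ℕ) : carry B v c q < 2 := by
  have h1 : (2 * v + c) / 2 ^ (B * q) < 2 * (v / 2 ^ (B * q)) + 2 := by
    rw [Nat.div_lt_iff_lt_mul (Nat.two_pow_pos _)]
    have := Nat.div_add_mod v (2 ^ (B * q))
    have := Nat.mod_lt v (Nat.two_pow_pos (B * q))
    nlinarith
  unfold carry
  omega

theorem wd_testBit {B v q r : ℕ} (hr : r < B) :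
    (wd B v q >>> r) &&& 1 = (v.testBit (q * B + r)).toNat := by
  rw [Nat.and_one_is_mod, Nat.shiftRight_eq_div_pow, ← Nat.toNat_testBit, wd,
    Nat.testBit_mod_two_pow, Nat.testBit_div_two_pow]
  simp [hr, mul_comm, add_comm]

theorem wd_of_lt {B v : ℕ} (hv : v < 2 ^ B) (q : ℕ) : wd B v q = if q = 0 then v else 0 := by
  split_ifs with h
  · rw [h, wd_zero_right, Nat.mod_eq_of_lt hv]
  · exact wd_eq_zero (W := 1) (by simpa using hv) (by omega)

/-! ### Operations on rows -/

/-- All but the registers from number `m` on and the arrays in `A` is unchanged. -/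
def Keep (m : ℕ) (A : List ℕ) (s s' : NState) : Prop :=
  (∀ r < m, s'.reg r = s.reg r) ∧ s'.out = s.out ∧ s'.tape = s.tape ∧
    ∀ a, a ∉ A → s'.arr a = s.arr a

theorem Keep.refl (m : ℕ) (A : List ℕ) (s : NState) : Keep m A s s :=
  ⟨fun _ _ => rfl, rfl, rfl, fun _ _ => rfl⟩

theorem Keep.trans {m m₁ m₂ : ℕ} {A A₁ A₂ : List ℕ} {s s' s'' : NState} (h : Keep m₁ A₁ s s')
    (h' : Keep m₂ A₂ s' s'') (hm₁ : m ≤ m₁) (hm₂ : m ≤ m₂) (hA₁ : A₁ ⊆ A) (hA₂ : A₂ ⊆ A) :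
    Keep m A s s'' :=
  ⟨fun r hr => (h'.1 r (by omega)).trans (h.1 r (by omega)), h'.2.1.trans h.2.1,
    h'.2.2.1.trans h.2.2.1, fun a ha => (h'.2.2.2 a fun h => ha (hA₂ h)).trans
      (h.2.2.2 a fun h => ha (hA₁ h))⟩

theorem Keep.mono {m m₁ : ℕ} {A A₁ : List ℕ} {s s' : NState} (h : Keep m₁ A₁ s s')
    (hm₁ : m ≤ m₁) (hA₁ : A₁ ⊆ A) : Keep m A s s' :=
  h.trans (Keep.refl m A s') hm₁ le_rfl hA₁ (List.Subset.refl A)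

theorem Keep.set {m x v : ℕ} {A : List ℕ} {s s' : NState} (h : Keep m A s s') (hx : m ≤ x) :
    Keep m A s (s'.set x v) :=
  ⟨fun r hr => by rw [NState.set_reg, if_neg (by omega), h.1 r hr], h.2⟩

theorem Keep.put {m a i j v : ℕ} {A : List ℕ} {s s' : NState} (h : Keep m A s s') (ha : a ∈ A) :
    Keep m A s (s'.put a i j v) :=
  ⟨h.1, h.2.1, h.2.2.1, fun a' ha' => by
    rw [← h.2.2.2 a' ha']
    have : a' ≠ a := fun e => ha' (e ▸ ha)
    funext i' j'
    simp [this]⟩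

/-- Fill the row number `e` of the array `a` with the values of `g`, an expression in the column
index `v 30`. -/
def rowMap (a : ℕ) (e g : Expr) : Stmt := .for 30 5 (.st a e (.v 30) g)

/-- When column `q` is computed, `g` may rely on the old contents of all other rows and arrays and
of the columns from `q` on in its own row. This suffices for updates in place that look at the
right-hand neighbour. -/
theorem rowMap_spec {ℓ : Layout} {s : NState} {a i W B : ℕ} {e g : Expr} {F : ℕ → ℕ}
    {Q : NState → Prop} (hW : s.reg 5 = W) (ha : a < 16) (hi : i < ℓ.R) (hD : W ≤ ℓ.D)
    (he : ∀ s', (∀ r < 30, s'.reg r = s.reg r) → e.Ok ℓ s' ∧ e.ev ℓ s' = i)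
    (hg : ∀ q < W, ∀ s', (∀ r < 30, s'.reg r = s.reg r) → s'.reg 30 = q →
      (∀ a' i' j, (a' ≠ a ∨ i' ≠ i ∨ q ≤ j) → s'.arr a' i' j = s.arr a' i' j) →
      g.Ok ℓ s' ∧ g.ev ℓ s' = F q)
    (hQ : ∀ s', Keep 30 [a] s s' → s'.arr a = Function.update (s.arr a) i
      (fun q => if q < W then F q else s.arr a i q) → Q s')
    (hB : W * (e.cost + g.cost + 17) + 6 ≤ B) :
    HT ℓ (rowMap a e g) s B Q := by
  refine HT.for (b := e.cost + g.cost + 9) (m := W)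
    (I := fun k s' => Keep 30 [a] s s' ∧ s'.arr a = Function.update (s.arr a) i
      (fun q => if q < k then F q else s.arr a i q)) (by decide) hW ?_ ?_ ?_ hB
  · refine ⟨(Keep.refl 30 [a] s).set le_rfl, ?_⟩
    simp
  · rintro k hk s' ⟨h1, h2⟩ hx hy
    obtain ⟨ok1, ev1⟩ := he s' h1.1
    obtain ⟨ok2, ev2⟩ := hg k hk s' h1.1 hx (by
      intro a' i' j h
      by_cases hh : a' = a
      · subst hh
        rw [h2]
        by_cases hi' : i' = i
        · subst hi'
          simp only [ne_eq, not_true_eq_false, false_or] at h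
          simp [not_lt.mpr h]
        · simp [hi']
      · rw [h1.2.2.2 a' (by simpa using hh)])
    refine HT.st ok1 trivial ok2 ha (by rw [ev1]; exact hi) (by simp [hx]; omega) ?_
      (by simp; omega)
    rw [ev1, ev2, Expr.ev, hx]
    refine ⟨⟨(h1.put (List.mem_singleton_self a)).set le_rfl, ?_⟩, by simp [hx], by simp [hy]⟩
    funext i' q
    simp only [NState.set_arr, NState.put_arr, h2, Function.update_apply, true_and]
    by_cases hi' : i' = i
    · subst hi'
      by_cases hq : q = k
      · subst hq; simp
      · have : (q < k + 1) = (q < k) := by apply propext; omega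
        simp [hq, this]
    · simp [hi']
  · rintro s' ⟨h1, h2⟩ -
    exact hQ s' h1 h2

end MUB

/-! ### Rows of packed bits: xor, copy, shifts and multiplication by `X`. -/

namespace MUB

/-- Parameters of the packing: `n = nq * B + nr`, and a row consists of `nq + 1` words that hold
`B` bits each. -/
structure Ctx where
  n : ℕ
  B : ℕ
  nq : ℕ
  nr : ℕ

def Ctx.W (c : Ctx) : ℕ := c.nq + 1

/-- A digit has at least two bits, so the constants `0, …, 3` and residues modulo 4 lie in the
lowest digit. The bound `word` leaves room for the bit that overflows when a digit is doubled. The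
`n + 2` columns exceed `W`, so the column just beyond a row can still be read; it holds zero. -/
structure Ctx.Fits (c : Ctx) (ℓ : Layout) : Prop where
  one_le : 1 ≤ c.n
  two_le : 2 ≤ c.B
  eq : c.nq * c.B + c.nr = c.n
  lt : c.nr < c.B
  R : ℓ.R = c.n + 1
  D : ℓ.D = c.n + 2
  word : 2 ^ (c.B + 1) < 2 ^ ℓ.w
  cells : 16 * ((c.n + 1) * (c.n + 2)) < 2 ^ ℓ.w

/-- The registers that hold the parameters. -/
structure Env (c : Ctx) (s : NState) : Prop where
  n : s.reg 0 = c.n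
  B : s.reg 2 = c.B
  nq : s.reg 3 = c.nq
  nr : s.reg 4 = c.nr
  W : s.reg 5 = c.W
  mask : s.reg 6 = 2 ^ c.B - 1
  half : s.reg 7 = 2 ^ (c.B - 1)
  steps : s.reg 8 = c.n / 2
  gcdSteps : s.reg 9 = 2 * c.n + 2

theorem Env.of_eq {c : Ctx} {s s' : NState} (h : Env c s) (hs : ∀ r < 10, s'.reg r = s.reg r) :
    Env c s' := by
  constructor <;> rw [hs _ (by decide)]
  exacts [h.n, h.B, h.nq, h.nr, h.W, h.mask, h.half, h.steps, h.gcdSteps]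

theorem Keep.env {c : Ctx} {s s' : NState} {m : ℕ} {A : List ℕ} (h : Keep m A s s')
    (e : Env c s) (hm : 10 ≤ m) : Env c s' :=
  e.of_eq fun r hr => h.1 r (by omega)

/-- All rows hold numbers of at most `n + 1` bits. -/
def Good (c : Ctx) (s : NState) : Prop :=
  ∀ a i, ∃ u < 2 ^ (c.n + 1), s.arr a i = wd c.B u

/-- The common frame condition of the row operations. Since `good` is an implication, it composes
even where `Good` is not known. -/
structure Pres (c : Ctx) (m : ℕ) (A : List ℕ) (s s' : NState) : Prop where
  keep : Keep m A s s'
  good : Good c s → Good c s'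

namespace Pres

variable {c : Ctx} {s s' s'' : NState} {m m₁ m₂ : ℕ} {A A₁ A₂ : List ℕ}

theorem refl (c : Ctx) (m : ℕ) (A : List ℕ) (s : NState) : Pres c m A s s :=
  ⟨Keep.refl m A s, id⟩

theorem trans (h : Pres c m₁ A₁ s s') (h' : Pres c m₂ A₂ s' s'') (hm₁ : m ≤ m₁) (hm₂ : m ≤ m₂)
    (hA₁ : A₁ ⊆ A) (hA₂ : A₂ ⊆ A) : Pres c m A s s'' :=
  ⟨h.keep.trans h'.keep hm₁ hm₂ hA₁ hA₂, fun g => h'.good (h.good g)⟩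

theorem mono (h : Pres c m₁ A₁ s s') (hm₁ : m ≤ m₁) (hA₁ : A₁ ⊆ A) : Pres c m A s s' :=
  ⟨h.keep.mono hm₁ hA₁, h.good⟩

theorem comp (h : Pres c m A s s') (h' : Pres c m₁ A₁ s' s'') (hm : m ≤ m₁ := by decide)
    (hA : A₁ ⊆ A := by simp) : Pres c m A s s'' :=
  h.trans h' le_rfl hm (List.Subset.refl A) hA

theorem set (h : Pres c m A s s') {x v : ℕ} (hx : m ≤ x) : Pres c m A s (s'.set x v) :=
  ⟨h.keep.set hx, h.good⟩

theorem of_update {a i v : ℕ} (h : Keep m [a] s s') (hv : v < 2 ^ (c.n + 1))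
    (h' : s'.arr a = Function.update (s.arr a) i (wd c.B v)) : Pres c m [a] s s' := by
  refine ⟨h, fun g a' i' => ?_⟩
  by_cases ha : a' = a
  · subst ha
    rw [h', Function.update_apply]
    split_ifs
    · exact ⟨v, hv, rfl⟩
    · exact g a' i'
  · rw [h.2.2.2 a' (by simpa using ha)]
    exact g a' i'

theorem env (h : Pres c m A s s') (e : Env c s) (hm : 10 ≤ m) : Env c s' := h.keep.env e hm

theorem reg (h : Pres c m A s s') {r : ℕ} (hr : r < m) : s'.reg r = s.reg r := h.keep.1 r hr

theorem arr (h : Pres c m A s s') {a : ℕ} (ha : a ∉ A) : s'.arr a = s.arr a := h.keep.2.2.2 a ha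

end Pres

variable {c : Ctx} {ℓ : Layout} {s : NState} {Q : NState → Prop} {T : ℕ}

namespace Ctx.Fits

theorem W_lt (h : c.Fits ℓ) : c.W < ℓ.D := by
  have := h.eq
  have := h.two_le
  rw [h.D, Ctx.W]
  nlinarith

theorem n_lt (h : c.Fits ℓ) : 16 * (c.n + 2) < 2 ^ ℓ.w := by
  have := h.cells
  nlinarith

theorem lt_pow (h : c.Fits ℓ) {v : ℕ} (hv : v < 2 ^ (c.n + 1)) : v < 2 ^ (c.B * c.W) := by
  refine hv.trans_le (Nat.pow_le_pow_right two_pos ?_)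
  have := h.eq
  have := h.lt
  rw [Ctx.W, Nat.mul_succ, mul_comm c.B]
  omega

end Ctx.Fits

/-- Beyond column `W` both the old and the new number have zero digits, so overwriting the first `W`
columns replaces the entire row. -/
theorem update_wd {f : ℕ → ℕ → ℕ} {F : ℕ → ℕ} {B W i v v₀ : ℕ} (h0 : f i = wd B v₀)
    (hv₀ : v₀ < 2 ^ (B * W)) (hv : v < 2 ^ (B * W)) (hF : ∀ q < W, F q = wd B v q) :
    Function.update f i (fun q => if q < W then F q else f i q) =
      Function.update f i (wd B v) := by
  congr 1
  funext q
  split_ifs with h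
  · exact hF q h
  · rw [h0, wd_eq_zero hv₀ (not_lt.mp h), wd_eq_zero hv (not_lt.mp h)]

def xorRow (a b : ℕ) (f : Expr) : Stmt :=
  rowMap a (.c 0) (.op .xor (.ld a (.c 0) (.v 30)) (.ld b f (.v 30)))

theorem xorRow_spec {a b i u v : ℕ} {f : Expr} (hc : c.Fits ℓ) (he : Env c s) (ha : a < 16)
    (hb : b < 16) (hab : b ≠ a) (hi : i < ℓ.R) (hf1 : f.cost = 1)
    (hf : ∀ s', (∀ r < 30, s'.reg r = s.reg r) → f.Ok ℓ s' ∧ f.ev ℓ s' = i)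
    (hu : s.arr a 0 = wd c.B u) (hu' : u < 2 ^ (c.n + 1))
    (hv : s.arr b i = wd c.B v) (hv' : v < 2 ^ (c.n + 1))
    (hQ : ∀ s', Pres c 30 [a] s s' → s'.arr a 0 = wd c.B (u ^^^ v) → Q s')
    (hT : 50 * c.W + 10 ≤ T) : HT ℓ (xorRow a b f) s T Q := by
  have h1 := hc.n_lt
  have h2 := hc.W_lt
  have hR := hc.R
  refine rowMap_spec (F := wd c.B (u ^^^ v)) he.W ha (i := 0) (by omega) h2.le ?_ ?_ ?_ ?_
  · exact fun s' _ => ⟨by simp, rfl⟩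
  · intro q hq s' hs hx harr
    obtain ⟨ok, ev⟩ := hf s' hs
    refine ⟨?_, ?_⟩
    · simp only [Expr.Ok, Expr.ev, hx, ok, ev, hi, ha, hb, BinOp.Ok, and_true, true_and]
      refine ⟨⟨?_, ?_, ?_⟩, ?_⟩ <;> omega
    · simp only [Expr.ev, hx, ev, BinOp.nat]
      rw [harr a 0 q (by simp), harr b i q (by simp [hab]), hu, hv, wd_xor]
  · intro s' hk h
    rw [update_wd hu (hc.lt_pow hu') (hc.lt_pow (Nat.xor_lt_two_pow hu' hv'))
      (fun _ _ => rfl)] at h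
    exact hQ s' (.of_update hk (Nat.xor_lt_two_pow hu' hv') h) (by simp [h])
  · simp [hf1]
    omega

def copyRow (a : ℕ) (e : Expr) (b : ℕ) : Stmt := rowMap a e (.ld b (.c 0) (.v 30))

theorem copyRow_spec {a b i v : ℕ} {e : Expr} (hc : c.Fits ℓ) (he : Env c s) (ha : a < 16)
    (hb : b < 16) (hab : b ≠ a) (hi : i < ℓ.R) (hf1 : e.cost = 1)
    (hf : ∀ s', (∀ r < 30, s'.reg r = s.reg r) → e.Ok ℓ s' ∧ e.ev ℓ s' = i)
    (hg : Good c s) (hv : s.arr b 0 = wd c.B v) (hv' : v < 2 ^ (c.n + 1))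
    (hQ : ∀ s', Pres c 30 [a] s s' → s'.arr a = Function.update (s.arr a) i (wd c.B v) → Q s')
    (hT : 50 * c.W + 10 ≤ T) : HT ℓ (copyRow a e b) s T Q := by
  obtain ⟨u, hu', hu⟩ := hg a i
  have h1 := hc.n_lt
  have h2 := hc.W_lt
  have hR := hc.R
  refine rowMap_spec (F := wd c.B v) he.W ha hi h2.le hf ?_ ?_ ?_
  · intro q hq s' hs hx harr
    refine ⟨?_, ?_⟩
    · simp only [Expr.Ok, Expr.ev, hx, hb]
      refine ⟨?_, trivial, trivial, ?_, ?_⟩ <;> omega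
    · simp only [Expr.ev, hx]
      rw [harr b 0 q (by simp [hab]), hv]
  · intro s' hk h
    rw [update_wd hu (hc.lt_pow hu') (hc.lt_pow hv') (fun _ _ => rfl)] at h
    exact hQ s' (.of_update hk hv' h) h
  · simp [hf1]
    omega

/-- Set the row to the number `k`. -/
def setRow (a k : ℕ) : Stmt := rowMap a (.c 0) (.c 0) ;; .st a (.c 0) (.c 0) (.c k)

theorem setRow_spec {a k : ℕ} (hc : c.Fits ℓ) (he : Env c s) (ha : a < 16)
    (hg : Good c s) (hk : k < 4)
    (hQ : ∀ s', Pres c 30 [a] s s' → s'.arr a 0 = wd c.B k → Q s')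
    (hT : 50 * c.W + 10 ≤ T) : HT ℓ (setRow a k) s T Q := by
  obtain ⟨u, hu', hu⟩ := hg a 0
  have h1 := hc.n_lt
  have h2 := hc.W_lt
  have hR := hc.R
  have hD := hc.D
  have hW : 1 ≤ c.W := by simp [Ctx.W]
  have hk' : k < 2 ^ c.B := by
    have := Nat.pow_le_pow_right two_pos hc.two_le
    omega
  have hk₁ : k < 2 ^ (c.n + 1) := by
    have := Nat.pow_le_pow_right two_pos (Nat.succ_le_succ hc.one_le)
    omega
  have hk'' : k < 2 ^ ℓ.w := by
    have := hc.word
    rw [pow_succ] at this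
    omega
  refine HT.seq (B₁ := 25 * c.W + 6) (B₂ := 20)
    (rowMap_spec (F := wd c.B 0) he.W ha (i := 0) (by omega) h2.le ?_ ?_ ?_ (by simp; omega))
    (by omega)
  · exact fun s' _ => ⟨by simp, rfl⟩
  · exact fun q hq s' hs hx harr => ⟨by simp, by simp⟩
  · intro s' hkp h
    rw [update_wd (v := 0) hu (hc.lt_pow hu') (Nat.two_pow_pos _) (fun _ _ => rfl)] at h
    refine HT.st (by simp) (by simp) hk'' ha (by simp; omega) (by simp; omega) ?_ (by simp)
    have hrow : (s'.put a 0 0 k).arr a 0 = wd c.B k := by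
      funext q
      simp [h, wd_of_lt hk']
    simp only [Expr.ev]
    refine hQ _ (.of_update (i := 0) (hkp.put (List.mem_singleton_self a)) hk₁ ?_) hrow
    funext i q
    by_cases hi : i = 0
    · subst hi
      rw [hrow, Function.update_self]
    · simp [hi, h]

def shrRow (a : ℕ) : Stmt :=
  rowMap a (.c 0) (.op .add (.op .shr (.ld a (.c 0) (.v 30)) (.c 1))
    (.op .mul (.op .and (.ld a (.c 0) (.op .add (.v 30) (.c 1))) (.c 1)) (.v 7)))

theorem shrRow_spec {a u : ℕ} (hc : c.Fits ℓ) (he : Env c s) (ha : a < 16)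
    (hu : s.arr a 0 = wd c.B u) (hu' : u < 2 ^ (c.n + 1))
    (hQ : ∀ s', Pres c 30 [a] s s' → s'.arr a 0 = wd c.B (u / 2) → Q s')
    (hT : 50 * c.W + 10 ≤ T) : HT ℓ (shrRow a) s T Q := by
  have h1 := hc.n_lt
  have h2 := hc.W_lt
  have hR := hc.R
  have hD := hc.D
  have hB := hc.two_le
  refine rowMap_spec (F := wd c.B (u / 2)) he.W ha (i := 0) (by omega) h2.le ?_ ?_ ?_ ?_
  · exact fun s' _ => ⟨by simp, rfl⟩
  · intro q hq s' hs hx harr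
    have key := wd_half (B := c.B) (by omega) u q
    have hlt := wd_lt c.B (u / 2) q
    have hlt2 : 2 ^ c.B < 2 ^ ℓ.w := lt_trans (Nat.pow_lt_pow_right one_lt_two (by omega)) hc.word
    have e7 : s'.reg 7 = 2 ^ (c.B - 1) := by rw [hs 7 (by decide), he.half]
    have a1 : s'.arr a 0 q = wd c.B u q := by rw [harr a 0 q (by simp), hu]
    have a2 : s'.arr a 0 (q + 1) = wd c.B u (q + 1) := by
      rw [harr a 0 (q + 1) (by simp), hu]
    refine ⟨?_, ?_⟩
    · simp only [Expr.Ok, Expr.ev, hx, ha, BinOp.Ok, BinOp.nat, a1, a2, e7, and_true, true_and,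
        Nat.and_one_is_mod, Nat.shiftRight_succ, Nat.shiftRight_zero, ← key]
      refine ⟨⟨⟨?_, ?_, ?_⟩, ?_⟩, ⟨⟨⟨?_, ⟨?_, ?_⟩, ?_, ?_⟩, ?_⟩, ?_⟩, ?_⟩ <;> omega
    · simp only [Expr.ev, hx, BinOp.nat, a1, a2, e7, Nat.and_one_is_mod, Nat.shiftRight_succ,
        Nat.shiftRight_zero, ← key]
  · intro s' hk h
    rw [update_wd hu (hc.lt_pow hu') (hc.lt_pow (v := u / 2) (by omega)) (fun _ _ => rfl)] at h
    exact hQ s' (.of_update hk (v := u / 2) (by omega) h) (by simp [h])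
  · simp
    omega

/-- `row := 2 * row + e`, where `e` is a bit. -/
def shlRow (a : ℕ) (e : Expr) : Stmt :=
  .set 31 e ;; .for 30 5
    (.set 32 (.op .add (.op .add (.ld a (.c 0) (.v 30)) (.ld a (.c 0) (.v 30))) (.v 31)) ;;
      .st a (.c 0) (.v 30) (.op .and (.v 32) (.v 6)) ;; .set 31 (.op .shr (.v 32) (.v 2)))

/-- Register `31` passes the overflow bit from digit to digit. A doubled digit plus carry stays
below `2 ^ (B + 1)`, hence within a word, and `u < 2 ^ n` ensures that no bit leaves the row at the
top. -/
theorem shlRow_spec {a u : ℕ} {e : Expr} (hc : c.Fits ℓ) (he : Env c s) (ha : a < 16)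
    (hu : s.arr a 0 = wd c.B u) (hu' : u < 2 ^ c.n) (ok : e.Ok ℓ s) (ev : e.ev ℓ s < 2)
    (hQ : ∀ s', Pres c 30 [a] s s' → s'.arr a 0 = wd c.B (2 * u + e.ev ℓ s) → Q s')
    (hT : 50 * c.W + e.cost + 10 ≤ T) : HT ℓ (shlRow a e) s T Q := by
  have h1 := hc.n_lt
  have h2 := hc.W_lt
  have hR := hc.R
  have hD := hc.D
  have hB := hc.two_le
  have hu1 : u < 2 ^ (c.n + 1) := by rw [pow_succ]; omega
  have hu2 : 2 * u + e.ev ℓ s < 2 ^ (c.n + 1) := by rw [pow_succ]; omega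
  generalize hb : e.ev ℓ s = b at *
  refine HT.seq (B₁ := e.cost + 1) (B₂ := c.W * (41 + 8) + 6) (HT.set ok ?_ le_rfl) (by omega)
  rw [hb]
  refine HT.for (m := c.W) (b := 41)
    (I := fun k s' => Keep 30 [a] s s' ∧ s'.reg 31 = carry c.B u b k ∧
      (∀ q, s'.arr a 0 q = if q < k then wd c.B (2 * u + b) q else wd c.B u q) ∧
      ∀ i, i ≠ 0 → s'.arr a i = s.arr a i)
    (by decide) ?_ ?_ ?_ ?_ le_rfl
  · simp [he.W]
  · exact ⟨((Keep.refl 30 [a] s).set (by decide)).set (by decide), by simp [carry_zero],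
      by simp [hu], fun _ _ => rfl⟩
  · rintro k hk s' ⟨hkp, hcy, hrow, hrest⟩ hx hy
    have e' := hkp.env he (by decide)
    have hb1 := wd_lt c.B u k
    have hb2 := carry_lt ev c.B u k
    have hw := hc.word
    rw [pow_succ] at hw
    refine HT.seq (B₁ := 24) (B₂ := 17) (HT.set ?_ ?_ (by simp)) le_rfl
    · simp only [Expr.Ok, Expr.ev, hx, ha, BinOp.Ok, BinOp.nat, hrow, lt_irrefl, if_false, hcy,
        true_and]
      refine ⟨⟨⟨?_, ?_, ?_⟩, ⟨?_, ?_, ?_⟩, ?_⟩, ?_⟩ <;> omega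
    · simp only [Expr.ev, hx, BinOp.nat, hrow, lt_irrefl, if_false, hcy]
      refine HT.seq (B₁ := 13) (B₂ := 4) (HT.st (by simp) (by simp) (by simp [BinOp.Ok]) ha
        (by simp; omega) (by simp [hx]; omega) ?_ (by simp)) le_rfl
      refine HT.set (by simp [BinOp.Ok]) ⟨⟨?_, ?_, ?_, fun i hi => ?_⟩, ?_, ?_⟩ (by simp)
      · refine Keep.set (Keep.set (Keep.put (Keep.set hkp ?_) ?_) ?_) ?_ <;> simp
      · simp [BinOp.nat, e'.B, carry_succ, Nat.shiftRight_eq_div_pow, two_mul]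
      · intro q
        simp only [Expr.ev, BinOp.nat, NState.set_arr, NState.put_arr, NState.set_reg, e'.mask,
          hrow, true_and, hx]
        by_cases hq : q = k
        · subst hq
          simp [wd_double, Nat.and_two_pow_sub_one_eq_mod, ← two_mul]
        · have : (q < k + 1) = (q < k) := by apply propext; omega
          simp [hq, this]
      · funext q
        simp [hi, hrest i hi]
      · simp [hx]
      · simp [hy]
  · rintro s' ⟨hkp, -, hrow, hrest⟩ -
    have hrow' : s'.arr a 0 = wd c.B (2 * u + b) := by
      funext q
      rw [hrow]
      split_ifs with h
      · rfl
      · rw [wd_eq_zero (hc.lt_pow hu1) (not_lt.mp h), wd_eq_zero (hc.lt_pow hu2) (not_lt.mp h)]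
    refine hQ s' (.of_update (i := 0) hkp hu2 ?_) hrow'
    funext i
    by_cases hi : i = 0
    · subst hi
      rw [hrow', Function.update_self]
    · rw [hrest i hi, Function.update_of_ne hi]

/-- Multiplication by `X` modulo the polynomial `f` of degree `n`. -/
def mulX (n f v : ℕ) : ℕ := if (2 * v).testBit n then 2 * v ^^^ f else 2 * v

/-- Bit `n` is the highest possible one, and the two equal bits there cancel; this is how xor with
the modulus lowers the degree. -/
theorem xor_lt_of_testBit {n u v : ℕ} (hu : u < 2 ^ (n + 1)) (hv : v < 2 ^ (n + 1))
    (h : u.testBit n = v.testBit n) : u ^^^ v < 2 ^ n := by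
  refine Nat.lt_pow_two_of_testBit _ fun i hi => ?_
  rw [Nat.testBit_xor]
  rcases eq_or_lt_of_le hi with rfl | hi
  · simp [h]
  · rw [Nat.testBit_lt_two_pow (hu.trans_le (Nat.pow_le_pow_right two_pos hi)),
      Nat.testBit_lt_two_pow (hv.trans_le (Nat.pow_le_pow_right two_pos hi))]
    rfl

theorem mulX_lt {n f v : ℕ} (hf : f < 2 ^ (n + 1)) (hf' : f.testBit n = true)
    (hv : v < 2 ^ n) : mulX n f v < 2 ^ n := by
  have h2 : 2 * v < 2 ^ (n + 1) := by rw [pow_succ]; omega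
  unfold mulX
  split_ifs with h
  · exact xor_lt_of_testBit h2 hf (by rw [h, hf'])
  · have := xor_lt_of_testBit (v := 0) h2 (by positivity) (by simpa using h)
    simpa using this

/-- `V := X * V mod F`; the arrays `F` and `V` have the numbers `0` and `1`. -/
def mulXRow : Stmt :=
  shlRow 1 (.c 0) ;;
    .ite (.op .and (.op .shr (.ld 1 (.c 0) (.v 3)) (.v 4)) (.c 1)) (xorRow 1 0 (.c 0)) .skip

theorem mulXRow_spec {f v : ℕ} (hc : c.Fits ℓ) (he : Env c s)
    (hf : s.arr 0 0 = wd c.B f) (hf' : f < 2 ^ (c.n + 1))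
    (hv : s.arr 1 0 = wd c.B v) (hv' : v < 2 ^ c.n)
    (hQ : ∀ s', Pres c 30 [1] s s' → s'.arr 1 0 = wd c.B (mulX c.n f v) → Q s')
    (hT : 100 * c.W + 40 ≤ T) : HT ℓ mulXRow s T Q := by
  have h1 := hc.n_lt
  have h2 := hc.W_lt
  have hR := hc.R
  have hD := hc.D
  have hB := hc.two_le
  have hv2 : 2 * v < 2 ^ (c.n + 1) := by rw [pow_succ]; omega
  refine HT.seq (B₁ := 50 * c.W + 11) (B₂ := 50 * c.W + 29)
    (shlRow_spec hc he (by decide) hv hv' (by simp) (by simp) ?_ (by simp)) (by omega)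
  intro s' hk hrow
  have e' := hk.env he (by decide)
  simp only [Expr.ev, add_zero] at hrow
  -- Since `n = nq * B + nr`, bit `n` of the row is bit `nr` of word `nq`.
  have hbit : (Expr.op .and (.op .shr (.ld 1 (.c 0) (.v 3)) (.v 4)) (.c 1)).ev ℓ s' =
      ((2 * v).testBit c.n).toNat := by
    simp only [Expr.ev, BinOp.nat, e'.nq, e'.nr, hrow]
    rw [wd_testBit hc.lt, hc.eq]
  refine HT.ite (B₁ := 50 * c.W + 10) ?_ ?_ ?_ (by simp; omega)
  · simp only [Expr.Ok, Expr.ev, BinOp.Ok, e'.nq, and_true, true_and]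
    have : c.nq + 1 < ℓ.D := h2
    have := hc.R
    omega
  · rw [hbit]
    intro hb
    refine xorRow_spec (u := 2 * v) (v := f) (i := 0) hc e' (by decide) (by decide) (by decide)
      (by omega) rfl (fun s' _ => ⟨by simp, rfl⟩) hrow hv2 ?_ hf' ?_ le_rfl
    · rw [hk.arr (by decide), hf]
    · intro s'' hk' hrow'
      refine hQ s'' (hk.trans hk' le_rfl le_rfl (by simp) (by simp)) ?_
      rw [hrow', mulX, if_pos (by simpa using hb)]
  · rw [hbit]
    intro hb
    refine HT.skip (by omega) (hQ s' hk ?_)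
    rw [hrow, mulX, if_neg (by simpa using hb)]

end MUB

namespace MUB

open Polynomial

/-! ### Polynomials over `𝔽₂` as natural numbers -/

/-- The polynomial whose coefficients are the binary digits of `v`. -/
noncomputable def np (v : ℕ) : (ZMod 2)[X] :=
  ∑ k ∈ Finset.range v, C (if v.testBit k then 1 else 0) * X ^ k

theorem coeff_np (v k : ℕ) : (np v).coeff k = if v.testBit k then 1 else 0 := by
  simp only [np, finsetSum_coeff, coeff_C_mul_X_pow]
  rw [Finset.sum_ite_eq]
  by_cases h : v.testBit k
  · rw [if_pos]
    exact Finset.mem_range.mpr ((Nat.lt_two_pow_self).trans_le (Nat.ge_two_pow_of_testBit h))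
  · simp [h]

theorem np_injective : Function.Injective np := by
  intro u v h
  refine Nat.eq_of_testBit_eq fun k => ?_
  have := congrArg (fun p => p.coeff k) h
  simp only [coeff_np] at this
  cases h1 : u.testBit k <;> cases h2 : v.testBit k <;> simp_all

@[simp] theorem np_zero : np 0 = 0 := by ext k; simp [coeff_np]

theorem np_two_mul_add (v b : ℕ) (hb : b < 2) : np (2 * v + b) = X * np v + C (b : ZMod 2) := by
  ext k
  rcases k with _ | k
  · rw [coeff_np, coeff_add, coeff_X_mul_zero, coeff_C_zero, Nat.testBit_zero]
    interval_cases b <;> simp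
  · rw [coeff_np, coeff_add, coeff_X_mul, coeff_np, coeff_C_succ, add_zero, Nat.testBit_succ]
    rw [show (2 * v + b) / 2 = v by omega]

theorem np_two_mul (v : ℕ) : np (2 * v) = X * np v := by
  simpa using np_two_mul_add v 0 two_pos

@[simp] theorem np_one : np 1 = 1 := by simpa using np_two_mul_add 0 1 one_lt_two

@[simp] theorem np_two : np 2 = X := by simpa using np_two_mul 1

theorem np_half (v : ℕ) : np v = X * np (v / 2) + C ((v % 2 : ℕ) : ZMod 2) := by
  rw [← np_two_mul_add _ _ (Nat.mod_lt v two_pos), Nat.div_add_mod]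

theorem np_xor (u v : ℕ) : np (u ^^^ v) = np u + np v := by
  ext k
  rw [coeff_add, coeff_np, coeff_np, coeff_np, Nat.testBit_xor]
  cases u.testBit k <;> cases v.testBit k <;> simp
  decide

theorem degree_np_lt {v n : ℕ} : (np v).degree < n ↔ v < 2 ^ n := by
  rw [degree_lt_iff_coeff_zero]
  constructor
  · intro h
    refine Nat.lt_pow_two_of_testBit _ fun i hi => ?_
    have := h i hi
    rw [coeff_np] at this
    simpa using this
  · intro h i hi
    rw [coeff_np, Nat.testBit_lt_two_pow (h.trans_le (Nat.pow_le_pow_right two_pos hi))]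
    simp

theorem np_surjective : Function.Surjective np := by
  intro p
  induction h : p.natDegree using Nat.strong_induction_on generalizing p with
  | _ d ih =>
    have hp := divX_mul_X_add p
    have hb : ∃ b < 2, ((b : ℕ) : ZMod 2) = p.coeff 0 :=
      ⟨(p.coeff 0).val, ZMod.val_lt _, ZMod.natCast_zmod_val _⟩
    obtain ⟨b, hb, hb'⟩ := hb
    rcases Nat.eq_zero_or_pos d with rfl | hd
    · refine ⟨2 * 0 + b, ?_⟩
      rw [np_two_mul_add _ _ hb, hb', np_zero, mul_zero, zero_add]
      exact (eq_C_of_natDegree_eq_zero h).symm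
    · obtain ⟨v, hv⟩ := ih (p.divX.natDegree) (by rw [natDegree_divX_eq_natDegree_tsub_one]; omega)
        p.divX rfl
      exact ⟨2 * v + b, by rw [np_two_mul_add _ _ hb, hb', hv, mul_comm, hp]⟩

theorem np_ne_zero {v : ℕ} (hv : v ≠ 0) : np v ≠ 0 := by
  rwa [← np_zero, np_injective.ne_iff]

theorem coeff_zero_np (v : ℕ) : (np v).coeff 0 = ((v % 2 : ℕ) : ZMod 2) := by
  rw [np_half]
  simp

theorem add_self_zmod (p : (ZMod 2)[X]) : p + p = 0 := CharTwo.add_self_eq_zero p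

/-- In characteristic 2 congruence modulo `f` may be written with a sum; remainders are identified
in this form throughout. -/
theorem mod_eq_of_dvd {f a r : (ZMod 2)[X]} (hr : r.degree < f.degree) (h : f ∣ a + r) :
    a % f = r := by
  have h0 : f ≠ 0 := by rintro rfl; simp at hr
  rw [mod_eq_of_dvd_sub (p₂ := r) (by rwa [CharTwo.sub_eq_add]), (mod_eq_self_iff h0).mpr hr]

theorem dvd_mod_add (a f : (ZMod 2)[X]) : f ∣ a % f + a := by
  rw [← CharTwo.sub_eq_add, EuclideanDomain.mod_eq_sub_mul_div]
  exact ⟨-(a / f), by ring⟩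

/-- `f` encodes a polynomial of degree `n`. -/
structure IsDeg (n f : ℕ) : Prop where
  lt : f < 2 ^ (n + 1)
  le : 2 ^ n ≤ f

theorem IsDeg.testBit {n f : ℕ} (h : IsDeg n f) : f.testBit n = true := by
  rw [Nat.testBit_eq_decide_div_mod_eq]
  have h1 := h.lt
  rw [pow_succ] at h1
  have : f / 2 ^ n = 1 := Nat.div_eq_of_lt_le (by simpa using h.le) (by omega)
  simp [this]

theorem IsDeg.degree {n f : ℕ} (h : IsDeg n f) : (np f).degree = n := by
  have h1 : (np f).degree < (n + 1 : ℕ) := degree_np_lt.mpr h.lt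
  have h2 : ¬ (np f).degree < (n : ℕ) := by rw [degree_np_lt]; exact not_lt.mpr h.le
  have h0 : np f ≠ 0 := np_ne_zero (by have := h.le; have := Nat.two_pow_pos n; omega)
  rw [degree_eq_natDegree h0, Nat.cast_lt] at *
  congr 1
  omega

theorem IsDeg.natDegree {n f : ℕ} (h : IsDeg n f) : (np f).natDegree = n :=
  natDegree_eq_of_degree_eq_some h.degree

theorem isDeg_of_natDegree {n f : ℕ} (h : (np f).natDegree = n) (h0 : f ≠ 0) : IsDeg n f := by
  have := degree_eq_natDegree (np_ne_zero h0)
  rw [h] at this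
  refine ⟨?_, ?_⟩
  · rw [← degree_np_lt, this, Nat.cast_lt]
    omega
  · rw [← not_lt, ← degree_np_lt, this]
    exact lt_irrefl _

theorem np_mulX {n f v : ℕ} (hf : IsDeg n f) (hv : v < 2 ^ n) :
    np (mulX n f v) = (X * np v) % np f := by
  refine (mod_eq_of_dvd ?_ ?_).symm
  · rw [hf.degree]
    exact degree_np_lt.mpr (mulX_lt hf.lt hf.testBit hv)
  · unfold mulX
    split_ifs
    · rw [np_xor, np_two_mul, ← add_assoc, add_self_zmod, zero_add]
    · rw [np_two_mul, add_self_zmod]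
      exact dvd_zero _

theorem mod_mul_mod (a b f : (ZMod 2)[X]) : (a * (b % f)) % f = (a * b) % f := by
  refine mod_eq_of_dvd_sub ?_
  rw [← mul_sub, CharTwo.sub_eq_add]
  exact (dvd_mod_add b f).mul_left a

/-! ### The greatest common divisor -/

/-- One step of the binary algorithm for `gcd(f, g)`, `f` odd. The two last components bound the
lengths of `f` and `g`. -/
def gcdStep (x : ℕ × ℕ × ℕ × ℕ) : ℕ × ℕ × ℕ × ℕ :=
  if x.2.2.2 = 0 then x
  else if x.2.1 % 2 = 0 then (x.1, x.2.1 / 2, x.2.2.1, x.2.2.2 - 1)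
  else if x.2.2.1 ≤ x.2.2.2 then (x.1, (x.2.1 ^^^ x.1) / 2, x.2.2.1, x.2.2.2 - 1)
  else (x.2.1, (x.2.1 ^^^ x.1) / 2, x.2.2.2, x.2.2.1 - 1)

/-- Only coprimality is tracked, not the gcd itself, so factors `X` may be dropped from the second
entry as long as the first one is odd. -/
structure GcdInv (F G : (ZMod 2)[X]) (x : ℕ × ℕ × ℕ × ℕ) : Prop where
  odd : x.1 % 2 = 1
  lt₁ : x.1 < 2 ^ x.2.2.1
  lt₂ : x.2.1 < 2 ^ x.2.2.2
  iff : IsCoprime (np x.1) (np x.2.1) ↔ IsCoprime F G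

/-- An odd `f` has constant term 1 and is coprime to `X`, so a factor `X` of `g` is irrelevant. -/
theorem isCoprime_half {f g : ℕ} (hf : f % 2 = 1) (hg : g % 2 = 0) :
    IsCoprime (np f) (np (g / 2)) ↔ IsCoprime (np f) (np g) := by
  have h1 : np g = X * np (g / 2) := by
    conv_lhs => rw [np_half]
    simp [hg]
  have h2 : IsCoprime (np f) X := by
    refine ⟨1, np (f / 2), ?_⟩
    conv_lhs => rw [np_half f]
    rw [hf, Nat.cast_one, C_1]
    linear_combination add_self_zmod (X * np (f / 2))
  rw [h1, IsCoprime.mul_right_iff]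
  exact ⟨fun h => ⟨h2, h⟩, fun h => h.2⟩

theorem isCoprime_xor (f g : ℕ) :
    IsCoprime (np f) (np (g ^^^ f)) ↔ IsCoprime (np f) (np g) := by
  rw [np_xor]
  simpa using IsCoprime.add_mul_left_right_iff (x := np f) (y := np g) (z := 1)

theorem xor_mod_two {f g : ℕ} (hf : f % 2 = 1) (hg : g % 2 = 1) : (g ^^^ f) % 2 = 0 := by
  have := Nat.xor_mod_two_pow (a := g) (b := f) (n := 1)
  rw [pow_one, hf, hg] at this
  simpa using this

theorem div_two_lt {u k : ℕ} (hu : u < 2 ^ k) (hk : k ≠ 0) : u / 2 < 2 ^ (k - 1) := by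
  obtain ⟨k, rfl⟩ := Nat.exists_eq_succ_of_ne_zero hk
  rw [pow_succ] at hu
  simp
  omega

theorem GcdInv.step {F G : (ZMod 2)[X]} {x : ℕ × ℕ × ℕ × ℕ} (h : GcdInv F G x) :
    GcdInv F G (gcdStep x) := by
  obtain ⟨f, g, A, B⟩ := x
  obtain ⟨odd, lt₁, lt₂, iff⟩ := h
  simp only at odd lt₁ lt₂ iff
  unfold gcdStep
  simp only
  split_ifs with h1 h2 h3
  · exact ⟨odd, lt₁, lt₂, iff⟩
  · exact ⟨odd, lt₁, div_two_lt lt₂ h1, by rw [isCoprime_half odd h2, iff]⟩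
  · have hx := xor_mod_two odd (Nat.mod_two_ne_zero.mp h2)
    refine ⟨odd, lt₁, div_two_lt (Nat.xor_lt_two_pow lt₂ ?_) h1, ?_⟩
    · exact lt₁.trans_le (Nat.pow_le_pow_right two_pos h3)
    · rw [isCoprime_half odd hx, isCoprime_xor, iff]
  · have h2 := Nat.mod_two_ne_zero.mp h2
    have hx := xor_mod_two odd h2
    refine ⟨h2, lt₂, div_two_lt (Nat.xor_lt_two_pow ?_ lt₁) (by omega), ?_⟩
    · exact lt₂.trans_le (Nat.pow_le_pow_right two_pos (by omega))
    · show IsCoprime (np g) (np ((g ^^^ f) / 2)) ↔ _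
      rw [isCoprime_half h2 hx, Nat.xor_comm, isCoprime_xor, isCoprime_comm, iff]

/-- While the second length bound is positive, each step lowers the sum of the two bounds by exactly
one. -/
theorem gcdStep_iterate_eq_zero (x : ℕ × ℕ × ℕ × ℕ) : ∀ k,
    (gcdStep^[k] x).2.2.2 = 0 ∨
      (gcdStep^[k] x).2.2.1 + (gcdStep^[k] x).2.2.2 + k = x.2.2.1 + x.2.2.2 := by
  intro k
  induction k with
  | zero => right; rfl
  | succ k ih =>
    rw [Function.iterate_succ_apply']
    generalize gcdStep^[k] x = y at *
    unfold gcdStep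
    split_ifs with h1 h2 h3
    · exact Or.inl h1
    all_goals right; simp only; omega

theorem GcdInv.iterate {F G : (ZMod 2)[X]} {x : ℕ × ℕ × ℕ × ℕ} (h : GcdInv F G x) (k : ℕ) :
    GcdInv F G (gcdStep^[k] x) := by
  induction k with
  | zero => exact h
  | succ k ih => rw [Function.iterate_succ_apply']; exact ih.step

/-- After that many steps the second length bound is 0, so the second entry is 0 and the first one
must be a unit. For an odd number this means that it equals 1, that is, that its half vanishes. -/
theorem gcd_eq_one_iff {F G : (ZMod 2)[X]} {x : ℕ × ℕ × ℕ × ℕ} (h : GcdInv F G x) {k : ℕ}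
    (hk : x.2.2.1 + x.2.2.2 ≤ k) : (gcdStep^[k] x).1 / 2 = 0 ↔ IsCoprime F G := by
  have h1 : (gcdStep^[k] x).2.2.2 = 0 := by
    rcases gcdStep_iterate_eq_zero x k with h | h <;> omega
  obtain ⟨odd, lt₁, lt₂, iff⟩ := h.iterate k
  rw [h1, pow_zero, Nat.lt_one_iff] at lt₂
  rw [lt₂, np_zero, isCoprime_zero_right] at iff
  rw [← iff]
  constructor
  · intro h
    have : (gcdStep^[k] x).1 = 1 := by omega
    simp [this]
  · intro h
    rw [isUnit_iff_degree_eq_zero] at h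
    have h1 : (np (gcdStep^[k] x).1).degree < (1 : ℕ) := by rw [h]; exact_mod_cast one_pos
    rw [degree_np_lt] at h1
    omega

/-! ### Irreducibility -/

/-- All irreducible factors have degree more than `i`. -/
def NoFactor (i : ℕ) (f : (ZMod 2)[X]) : Prop :=
  ∀ P : (ZMod 2)[X], Irreducible P → P ∣ f → i < P.natDegree

theorem noFactor_zero {f : (ZMod 2)[X]} : NoFactor 0 f := fun _ hP _ => hP.natDegree_pos

theorem irreducible_dvd_iff {P : (ZMod 2)[X]} (hP : Irreducible P) (i : ℕ) :
    P ∣ X ^ 2 ^ i + X ↔ P.natDegree ∣ i := by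
  rw [hP.natDegree_dvd_iff_dvd_X_pow_card_pow_sub_X, Nat.card_eq_fintype_card, ZMod.card,
    CharTwo.sub_eq_add]

/-- `X ^ 2 ^ (i + 1) + X` is divisible by exactly those irreducible polynomials whose degree divides
`i + 1`. If the degrees up to `i` are excluded already, a common irreducible factor must have degree
`i + 1`. -/
theorem noFactor_succ {f : (ZMod 2)[X]} (i : ℕ) :
    NoFactor (i + 1) f ↔ NoFactor i f ∧ IsCoprime f (X ^ 2 ^ (i + 1) + X) := by
  constructor
  · intro h
    refine ⟨fun P hP hd => (h P hP hd).trans_le' (Nat.le_succ i), ?_⟩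
    refine isCoprime_of_irreducible_dvd ?_ ?_
    -- The second polynomial is nonzero: its coefficient of `X` is 1 because `2 ^ (i + 1) > 1`.
    · rintro ⟨-, h0⟩
      have := congrArg (fun p => p.coeff 1) h0
      have h2 : 1 < 2 ^ (i + 1) := Nat.one_lt_two_pow (by omega)
      simp [coeff_X_pow, h2.ne] at this
    · intro P hP hd hd'
      rw [irreducible_dvd_iff hP] at hd'
      have := Nat.le_of_dvd (by omega) hd'
      have := h P hP hd
      omega
  · rintro ⟨h1, h2⟩ P hP hd
    rcases eq_or_lt_of_le (Nat.succ_le_of_lt (h1 P hP hd)) with h | h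
    · have : P ∣ X ^ 2 ^ (i + 1) + X := (irreducible_dvd_iff hP _).mpr ⟨1, by omega⟩
      exact absurd (h2.isUnit_of_dvd' hd this) hP.not_isUnit
    · exact h

theorem monic_zmod_two {f : (ZMod 2)[X]} (h : f ≠ 0) : f.Monic := by
  have : ∀ a : ZMod 2, a ≠ 0 → a = 1 := by decide
  exact this _ (leadingCoeff_ne_zero.mpr h)

/-- A proper factorisation has a factor of degree at most `n / 2`, and with it an irreducible one.
-/
theorem irreducible_iff_noFactor {f : (ZMod 2)[X]} {n : ℕ} (hf : f.natDegree = n) (hn : 1 ≤ n) :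
    Irreducible f ↔ NoFactor (n / 2) f := by
  have h0 : f ≠ 0 := by rintro rfl; simp at hf; omega
  have h1 : f ≠ 1 := by rintro rfl; simp at hf; omega
  constructor
  · intro h P hP hd
    have := natDegree_eq_of_degree_eq (degree_eq_degree_of_associated
      ((hP.dvd_irreducible_iff_associated h).mp hd))
    omega
  · intro h
    rw [(monic_zmod_two h0).irreducible_iff_lt_natDegree_lt h1]
    intro q hq hdeg hd
    rw [Finset.mem_Ioc, hf] at hdeg
    obtain ⟨P, hP, hPq⟩ := exists_irreducible_of_natDegree_pos hdeg.1
    have := natDegree_le_of_dvd hPq hq.ne_zero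
    have := h P hP (hPq.trans hd)
    omega

end MUB

/-! ### Counting irreducible polynomials and polynomials without small factors over `𝔽₂`. -/

namespace MUB

open Polynomial UniqueFactorizationMonoid

open scoped Classical in
/-- The polynomials of degree `n`. -/
noncomputable def polys (n : ℕ) : Finset (ZMod 2)[X] :=
  (Finset.Ico (2 ^ n) (2 ^ (n + 1))).image np

theorem mem_polys {n : ℕ} {f : (ZMod 2)[X]} : f ∈ polys n ↔ f ≠ 0 ∧ f.natDegree = n := by
  simp only [polys, Finset.mem_image, Finset.mem_Ico]
  constructor
  · rintro ⟨v, ⟨h1, h2⟩, rfl⟩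
    exact ⟨np_ne_zero (by have := Nat.two_pow_pos n; omega), IsDeg.natDegree ⟨h2, h1⟩⟩
  · rintro ⟨h0, h⟩
    obtain ⟨v, rfl⟩ := np_surjective f
    have := isDeg_of_natDegree h (by rintro rfl; simp at h0)
    exact ⟨v, ⟨this.le, this.lt⟩, rfl⟩

theorem card_polys (n : ℕ) : (polys n).card = 2 ^ n := by
  rw [polys, Finset.card_image_of_injective _ np_injective, Nat.card_Ico, pow_succ]
  omega

open scoped Classical in
/-- The polynomials of degree `n` without factors of degree at most `m`. -/
noncomputable def rough (m n : ℕ) : Finset (ZMod 2)[X] := (polys n).filter (NoFactor m)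

open scoped Classical in
/-- The irreducible polynomials of degree `n`. -/
noncomputable def irreds (n : ℕ) : Finset (ZMod 2)[X] := (polys n).filter Irreducible

theorem mem_rough {m n : ℕ} {f : (ZMod 2)[X]} :
    f ∈ rough m n ↔ (f ≠ 0 ∧ f.natDegree = n) ∧ NoFactor m f := by
  simp [rough, mem_polys]

theorem mem_irreds {n : ℕ} {f : (ZMod 2)[X]} :
    f ∈ irreds n ↔ Irreducible f ∧ f.natDegree = n := by
  simp only [irreds, Finset.mem_filter, mem_polys]
  exact ⟨fun h => ⟨h.2, h.1.2⟩, fun h => ⟨⟨h.1.ne_zero, h.2⟩, h.1⟩⟩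

theorem card_rough_zero (n : ℕ) : (rough 0 n).card = 2 ^ n := by
  rw [← card_polys]
  congr 1
  ext f
  simp [mem_rough, mem_polys, noFactor_zero]

theorem card_rough_deg_zero (m : ℕ) : (rough m 0).card ≤ 1 := by
  classical
  rw [rough]
  exact (Finset.card_filter_le _ _).trans (by simp [card_polys])

theorem normalize_zmod_two {P : (ZMod 2)[X]} (hP : P ≠ 0) : normalize P = P :=
  (monic_zmod_two hP).normalize_eq_self

theorem irreds_disjoint {d d' : ℕ} (h : d ≠ d') : Disjoint (irreds d) (irreds d') := by
  rw [Finset.disjoint_left]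
  intro f h1 h2
  exact h ((mem_irreds.mp h1).2.symm.trans (mem_irreds.mp h2).2)

-- The exponents `a` with `P ^ a ∣ f` are `1, …, k`, where `k` is the multiplicity of `P` in `f`.
-- Summing `deg P` over all such pairs `(P, a)` thus gives the degree of `f`; this form allows the
-- order of summation to be exchanged later.
open scoped Classical in
theorem degree_eq_sum {n : ℕ} {f : (ZMod 2)[X]} (h0 : f ≠ 0) (hf : f.natDegree = n) :
    n = ∑ d ∈ Finset.Icc 1 n, ∑ P ∈ irreds d, ∑ a ∈ Finset.Icc 1 n,
      if P ^ a ∣ f then d else 0 := by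
  have hcount : ∀ d, ∀ P ∈ irreds d, (∑ a ∈ Finset.Icc 1 n, if P ^ a ∣ f then d else 0) =
      (normalizedFactors f).count P * P.natDegree := by
    intro d P hP
    obtain ⟨hirr, hd⟩ := mem_irreds.mp hP
    have hmult := emultiplicity_eq_count_normalizedFactors hirr h0
    rw [normalize_zmod_two hirr.ne_zero] at hmult
    have hiff : ∀ a : ℕ, P ^ a ∣ f ↔ a ≤ (normalizedFactors f).count P := by
      intro a
      rw [pow_dvd_iff_le_emultiplicity, hmult, Nat.cast_le]
    have hle : (normalizedFactors f).count P ≤ n := by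
      have h1 := natDegree_le_of_dvd ((hiff _).mpr le_rfl) h0
      rw [natDegree_pow, hf] at h1
      have := hirr.natDegree_pos
      nlinarith
    simp only [hiff]
    rw [← Finset.sum_filter, Finset.sum_const, smul_eq_mul, hd]
    congr 1
    generalize (normalizedFactors f).count P = k at *
    have : (Finset.Icc 1 n).filter (· ≤ k) = Finset.Icc 1 k := by
      ext a
      simp only [Finset.mem_filter, Finset.mem_Icc]
      omega
    rw [this, Nat.card_Icc]
    omega
  have hdeg : (Multiset.map natDegree (normalizedFactors f)).sum = n := by
    have h1 := prod_normalizedFactors h0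
    have h2 := natDegree_eq_of_degree_eq (degree_eq_degree_of_associated h1)
    rw [← hf, ← h2, natDegree_multiset_prod _ (zero_notMem_normalizedFactors f)]
  rw [Finset.sum_congr rfl fun d _ => Finset.sum_congr rfl (hcount d), ← Finset.sum_biUnion]
  · rw [Finset.sum_multiset_map_count] at hdeg
    conv_lhs => rw [← hdeg]
    simp only [smul_eq_mul]
    refine Finset.sum_subset ?_ ?_
    · intro P hP
      rw [Multiset.mem_toFinset] at hP
      have hirr := irreducible_of_normalized_factor P hP
      have := natDegree_le_of_dvd (dvd_of_mem_normalizedFactors hP) h0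
      rw [Finset.mem_biUnion]
      exact ⟨P.natDegree, Finset.mem_Icc.mpr ⟨hirr.natDegree_pos, hf ▸ this⟩,
        mem_irreds.mpr ⟨hirr, rfl⟩⟩
    · intro P _ hP
      rw [Multiset.mem_toFinset] at hP
      rw [Multiset.count_eq_zero_of_notMem hP, zero_mul]
  · intro d _ d' _ h
    exact irreds_disjoint h

-- Multiplication by `P ^ a` is a bijection from the rough polynomials of degree `n - d * a` onto
-- the set counted, provided that `P` itself is a permitted factor.
open scoped Classical in
theorem card_rough_dvd {m n d a : ℕ} {P : (ZMod 2)[X]} (hP : P ∈ irreds d) (ha : 1 ≤ a) :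
    ((rough m n).filter (P ^ a ∣ ·)).card =
      if m < d ∧ d * a ≤ n then (rough m (n - d * a)).card else 0 := by
  obtain ⟨hirr, hd⟩ := mem_irreds.mp hP
  have hPa : P ^ a ≠ 0 := pow_ne_zero a hirr.ne_zero
  split_ifs with h
  · rw [← Finset.card_image_of_injective (rough m (n - d * a)) (mul_right_injective₀ hPa)]
    congr 1
    ext f
    simp only [Finset.mem_filter, Finset.mem_image, mem_rough]
    constructor
    · rintro ⟨⟨⟨h0, hf⟩, hn⟩, g, rfl⟩
      have hg : g ≠ 0 := right_ne_zero_of_mul h0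
      rw [natDegree_mul hPa hg, natDegree_pow, hd] at hf
      refine ⟨g, ⟨⟨hg, ?_⟩, fun R hR hd => hn R hR (hd.mul_left _)⟩, rfl⟩
      rw [mul_comm d]
      omega
    · rintro ⟨g, ⟨⟨hg, hdeg⟩, hn⟩, rfl⟩
      refine ⟨⟨⟨mul_ne_zero hPa hg, ?_⟩, ?_⟩, dvd_mul_right _ _⟩
      · rw [natDegree_mul hPa hg, natDegree_pow, hd, hdeg, mul_comm a]
        omega
      · intro R hR hdvd
        rcases hR.prime.dvd_or_dvd hdvd with h1 | h1
        · have h2 := (hR.dvd_irreducible_iff_associated hirr).mp (hR.prime.dvd_of_dvd_pow h1)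
          rw [natDegree_eq_of_degree_eq (degree_eq_degree_of_associated h2), hd]
          exact h.1
        · exact hn R hR h1
  · rw [Finset.card_eq_zero, Finset.filter_eq_empty_iff]
    intro f hf hdvd
    obtain ⟨⟨h0, hdeg⟩, hn⟩ := mem_rough.mp hf
    refine h ⟨?_, ?_⟩
    · rw [← hd]
      exact hn P hirr ((dvd_pow_self P (by omega)).trans hdvd)
    · have := natDegree_le_of_dvd hdvd h0
      rwa [natDegree_pow, hd, hdeg, mul_comm] at this

theorem sum_multiples {n d : ℕ} (hd : 1 ≤ d) (h : ℕ → ℕ) :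
    ∑ a ∈ Finset.Icc 1 n, (if d * a ≤ n then h (d * a) else 0) =
      ∑ k ∈ Finset.Icc 1 n, if d ∣ k then h k else 0 := by
  rw [← Finset.sum_filter, ← Finset.sum_filter]
  refine Finset.sum_bij (fun a _ => d * a) ?_ ?_ ?_ (fun _ _ => rfl)
  · intro a ha
    simp only [Finset.mem_filter, Finset.mem_Icc] at *
    exact ⟨⟨by nlinarith, ha.2⟩, dvd_mul_right _ _⟩
  · intro a _ b _ hab
    exact Nat.eq_of_mul_eq_mul_left hd hab
  · intro k hk
    simp only [Finset.mem_filter, Finset.mem_Icc] at hk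
    obtain ⟨⟨h1, h2⟩, a, rfl⟩ := hk
    have ha : a ≠ 0 := by rintro rfl; simp at h1
    refine ⟨a, ?_, rfl⟩
    simp only [Finset.mem_filter, Finset.mem_Icc]
    refine ⟨⟨?_, ?_⟩, h2⟩ <;> nlinarith [Nat.pos_of_ne_zero ha]

/-- Every rough polynomial is counted by the degrees of its factors. -/
theorem card_rough_identity (m n : ℕ) :
    n * (rough m n).card = ∑ k ∈ Finset.Icc 1 n, (rough m (n - k)).card *
      ∑ d ∈ k.divisors, if m < d then d * (irreds d).card else 0 := by
  classical
  have h1 : n * (rough m n).card = ∑ f ∈ rough m n, ∑ d ∈ Finset.Icc 1 n, ∑ P ∈ irreds d,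
      ∑ a ∈ Finset.Icc 1 n, if P ^ a ∣ f then d else 0 := by
    rw [mul_comm, ← smul_eq_mul, ← Finset.sum_const]
    refine Finset.sum_congr rfl fun f hf => ?_
    obtain ⟨⟨h0, hdeg⟩, -⟩ := mem_rough.mp hf
    exact degree_eq_sum h0 hdeg
  -- For fixed `d`, each pair `(P, a)` contributes `d` times the number of rough polynomials of
  -- degree `n - d * a`; these terms are collected by the multiple `k = d * a` of `d`.
  have h2 : ∀ d ∈ Finset.Icc 1 n, (∑ f ∈ rough m n, ∑ P ∈ irreds d,
      ∑ a ∈ Finset.Icc 1 n, if P ^ a ∣ f then d else 0) =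
      ∑ k ∈ Finset.Icc 1 n, if d ∣ k then
        (if m < d then d * (irreds d).card * (rough m (n - k)).card else 0) else 0 := by
    intro d hd
    rw [← sum_multiples (Finset.mem_Icc.mp hd).1, Finset.sum_comm]
    have : ∀ P ∈ irreds d, (∑ f ∈ rough m n, ∑ a ∈ Finset.Icc 1 n, if P ^ a ∣ f then d else 0) =
        ∑ a ∈ Finset.Icc 1 n, if d * a ≤ n then
          (if m < d then d * (rough m (n - d * a)).card else 0) else 0 := by
      intro P hP
      rw [Finset.sum_comm]
      refine Finset.sum_congr rfl fun a ha => ?_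
      rw [← Finset.sum_filter, Finset.sum_const, card_rough_dvd hP (Finset.mem_Icc.mp ha).1]
      split_ifs with h3 h4 h5 h6 h7 <;> simp_all [mul_comm]
    rw [Finset.sum_congr rfl this, Finset.sum_const, smul_eq_mul, Finset.mul_sum]
    refine Finset.sum_congr rfl fun a _ => ?_
    split_ifs <;> ring
  rw [h1, Finset.sum_comm, Finset.sum_congr rfl h2, Finset.sum_comm]
  refine Finset.sum_congr rfl fun k hk => ?_
  obtain ⟨hk1, hk2⟩ := Finset.mem_Icc.mp hk
  have : k.divisors = (Finset.Icc 1 n).filter (· ∣ k) := by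
    ext d
    simp only [Nat.mem_divisors, Finset.mem_filter, Finset.mem_Icc]
    constructor
    · rintro ⟨h, h'⟩
      exact ⟨⟨Nat.pos_of_dvd_of_pos h hk1, (Nat.le_of_dvd hk1 h).trans hk2⟩, h⟩
    · rintro ⟨-, h⟩
      exact ⟨h, by omega⟩
  rw [this, Finset.sum_filter, Finset.mul_sum]
  refine Finset.sum_congr rfl fun d _ => ?_
  split_ifs <;> ring

/-- For `m = 0` every polynomial is rough, and `card_rough_identity` reads `n 2^n = ∑ 2^(n-k) s_k`,
where `s_k` is the sum for `k`. By induction each of the `n - 1` terms with `k < n` equals `2^n`,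
which leaves `s_n = 2^n`. -/
theorem sum_divisors_irreds : ∀ n, 1 ≤ n →
    ∑ d ∈ n.divisors, d * (irreds d).card = 2 ^ n := by
  intro n
  induction n using Nat.strong_induction_on with
  | _ n ih =>
    intro hn
    have h := card_rough_identity 0 n
    have hpos : ∀ k : ℕ, (∑ d ∈ k.divisors, if 0 < d then d * (irreds d).card else 0) =
        ∑ d ∈ k.divisors, d * (irreds d).card := fun k =>
      Finset.sum_congr rfl fun d hd => if_pos (Nat.pos_of_mem_divisors hd)
    simp only [hpos, card_rough_zero] at h
    obtain ⟨m, rfl⟩ : ∃ m, n = m + 1 := ⟨n - 1, by omega⟩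
    rw [Finset.sum_Icc_succ_top (by omega), Nat.sub_self, pow_zero, one_mul] at h
    have h2 : ∑ k ∈ Finset.Icc 1 m, 2 ^ (m + 1 - k) * ∑ d ∈ k.divisors, d * (irreds d).card =
        m * 2 ^ (m + 1) := by
      have : ∀ k ∈ Finset.Icc 1 m, 2 ^ (m + 1 - k) * ∑ d ∈ k.divisors, d * (irreds d).card =
          2 ^ (m + 1) := by
        intro k hk
        obtain ⟨hk1, hk2⟩ := Finset.mem_Icc.mp hk
        rw [ih k (by omega) hk1, ← pow_add]
        congr 1
        omega
      rw [Finset.sum_congr rfl this, Finset.sum_const, Nat.card_Icc]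
      simp
    rw [h2, Nat.succ_mul] at h
    omega

/-- In `card_rough_identity` the inner sum is 0 for `k ≤ m` and at most `2^k` otherwise. After
multiplication by `m`, induction bounds each term with `m < k < n` by `2^n`, and the term `k = n` is
at most `m 2^n`. Together they make at most `(n - 1 - m) + m < n` copies of `2^n` when `m < n`. -/
theorem mul_card_rough_le (m : ℕ) : ∀ n, 1 ≤ n → m * (rough m n).card ≤ 2 ^ n := by
  intro n
  induction n using Nat.strong_induction_on with
  | _ n ih =>
    intro hn
    have h := card_rough_identity m n
    have hle : ∀ k ∈ Finset.Icc 1 n,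
        (∑ d ∈ k.divisors, if m < d then d * (irreds d).card else 0) ≤
          if m < k then 2 ^ k else 0 := by
      intro k hk
      obtain ⟨hk1, hk2⟩ := Finset.mem_Icc.mp hk
      split_ifs with hmk
      · rw [← sum_divisors_irreds k hk1]
        exact Finset.sum_le_sum fun d _ => by split_ifs <;> simp
      · refine (Finset.sum_eq_zero fun d hd => if_neg ?_).le
        have := Nat.divisor_le hd
        omega
    rcases Nat.lt_or_ge m n with hmn | hmn
    · obtain ⟨l, rfl⟩ : ∃ l, n = l + 1 := ⟨n - 1, by omega⟩
      rw [Finset.sum_Icc_succ_top (by omega), Nat.sub_self] at h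
      have h1 := hle (l + 1) (by simp)
      rw [if_pos hmn] at h1
      have h2 : m * ((rough m 0).card *
          ∑ d ∈ (l + 1).divisors, if m < d then d * (irreds d).card else 0) ≤ m * 2 ^ (l + 1) := by
        refine Nat.mul_le_mul_left m ?_
        simpa using Nat.mul_le_mul (card_rough_deg_zero m) h1
      have h3 : m * ∑ k ∈ Finset.Icc 1 l, (rough m (l + 1 - k)).card *
          ∑ d ∈ k.divisors, (if m < d then d * (irreds d).card else 0) ≤
          (l - m) * 2 ^ (l + 1) := by
        rw [Finset.mul_sum]
        have : ∀ k ∈ Finset.Icc 1 l, m * ((rough m (l + 1 - k)).card *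
            ∑ d ∈ k.divisors, (if m < d then d * (irreds d).card else 0)) ≤
            if m < k then 2 ^ (l + 1) else 0 := by
          intro k hk
          obtain ⟨hk1, hk2⟩ := Finset.mem_Icc.mp hk
          have a1 := hle k (Finset.mem_Icc.mpr ⟨hk1, by omega⟩)
          have a2 := ih (l + 1 - k) (by omega) (by omega)
          rw [← mul_assoc]
          refine (Nat.mul_le_mul a2 a1).trans ?_
          split_ifs
          · rw [← pow_add]
            exact Nat.pow_le_pow_right two_pos (by omega)
          · simp
        refine (Finset.sum_le_sum this).trans ?_
        rw [← Finset.sum_filter, Finset.sum_const, smul_eq_mul]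
        refine Nat.mul_le_mul_right _ ?_
        have : (Finset.Icc 1 l).filter (m < ·) = Finset.Ioc m l := by
          ext k
          simp only [Finset.mem_filter, Finset.mem_Icc, Finset.mem_Ioc]
          omega
        rw [this, Nat.card_Ioc]
      have h4 : (l + 1) * (m * (rough m (l + 1)).card) ≤ (l + 1) * 2 ^ (l + 1) := by
        calc (l + 1) * (m * (rough m (l + 1)).card) = m * ((l + 1) * (rough m (l + 1)).card) := by
              ring
          _ ≤ (l - m) * 2 ^ (l + 1) + m * 2 ^ (l + 1) := by
              rw [h, mul_add]; exact Nat.add_le_add h3 h2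
          _ = (l - m + m) * 2 ^ (l + 1) := by ring
          _ ≤ _ := Nat.mul_le_mul_right _ (by omega)
      exact Nat.le_of_mul_le_mul_left h4 (by omega)
    -- For `n ≤ m` every term vanishes: a polynomial of degree `n ≥ 1` always has a factor of degree
    -- at most `m`.
    · have : n * (rough m n).card = 0 := by
        rw [h]
        refine Finset.sum_eq_zero fun k hk => ?_
        have a1 := hle k hk
        rw [if_neg (by have := (Finset.mem_Icc.mp hk).2; omega)] at a1
        rw [Nat.le_zero.mp a1, mul_zero]
      have : (rough m n).card = 0 := by
        rcases Nat.mul_eq_zero.mp this with h | h <;> omega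
      simp [this]

/-- At least about one in `2 * n` polynomials of degree `n` is irreducible. -/
theorem two_pow_le_card_irreds {n : ℕ} (hn : 1 ≤ n) : 2 ^ n ≤ 2 * (n * (irreds n).card) := by
  have h := sum_divisors_irreds n hn
  rw [← Nat.insert_self_properDivisors (by omega), Finset.sum_insert (by simp)] at h
  -- Proper divisors are at most `n / 2`, and the terms for them are at most `2 ^ d`.
  have h1 : ∑ d ∈ n.properDivisors, d * (irreds d).card ≤ ∑ d ∈ Finset.Ico 1 (n / 2 + 1), 2 ^ d := by
    calc ∑ d ∈ n.properDivisors, d * (irreds d).card ≤ ∑ d ∈ n.properDivisors, 2 ^ d := by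
          refine Finset.sum_le_sum fun d hd => ?_
          have hd1 := Nat.pos_of_mem_properDivisors hd
          rw [← sum_divisors_irreds d hd1]
          exact Finset.single_le_sum (f := fun d => d * (irreds d).card)
            (fun _ _ => Nat.zero_le _) (by simp; omega)
      _ ≤ _ := by
          refine Finset.sum_le_sum_of_subset fun d hd => ?_
          have hd1 := Nat.pos_of_mem_properDivisors hd
          obtain ⟨⟨e, rfl⟩, hlt⟩ := Nat.mem_properDivisors.mp hd
          have he : 2 ≤ e := by
            by_contra hc
            have : e = 0 ∨ e = 1 := by omega
            rcases this with rfl | rfl <;> omega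
          rw [Finset.mem_Ico, Nat.lt_succ_iff, Nat.le_div_iff_mul_le two_pos]
          exact ⟨hd1, Nat.mul_le_mul_left d he⟩
  have h2 : ∑ d ∈ Finset.Ico 1 (n / 2 + 1), 2 ^ d + 2 ≤ 2 ^ (n / 2 + 1) := by
    have h3 := Finset.sum_range_add_sum_Ico (fun d => 2 ^ d) (show 1 ≤ n / 2 + 1 by omega)
    have h4 := Nat.geomSum_eq (le_refl 2) (n / 2 + 1)
    simp at h3 h4
    have := Nat.two_pow_pos (n / 2 + 1)
    omega
  -- For `n ≥ 3` the exponent `n / 2 + 1` is at most `n - 1`; for `n = 1, 2` the summand 2 in `h2`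
  -- is what makes the estimate sufficient.
  rcases (show n = 1 ∨ n = 2 ∨ 3 ≤ n by omega) with rfl | rfl | h3
  · have : 2 ^ (1 / 2 + 1) = 2 := rfl
    omega
  · have : 2 ^ (2 / 2 + 1) = 4 := rfl
    omega
  · have h4 : 2 ^ (n / 2 + 1) ≤ 2 ^ (n - 1) := Nat.pow_le_pow_right two_pos (by omega)
    have h5 : 2 ^ n = 2 * 2 ^ (n - 1) := by rw [← pow_succ']; congr 1; omega
    omega

end MUB

namespace MUB

open Polynomial

variable {c : Ctx} {ℓ : Layout} {s : NState} {Q : NState → Prop} {T : ℕ}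

theorem wd_parity {B : ℕ} (hB : 1 ≤ B) (v : ℕ) : wd B v 0 &&& 1 = v % 2 := by
  rw [Nat.and_one_is_mod, wd_zero_right]
  exact Nat.mod_mod_of_dvd _ (dvd_pow_self 2 (by omega))

/-- A step count `k * (a * W + b)`, `k ≤ r * n`, in terms of `n * W`. -/
theorem budget {k n W a b : ℕ} (r : ℕ) (hk : k ≤ r * n) (hW : 1 ≤ W) :
    k * (a * W + b) ≤ r * (a + b) * (n * W) := by
  calc k * (a * W + b) ≤ (r * n) * (a * W + b * W) := by gcongr; nlinarith
    _ = _ := by ring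

/-! ### Squaring modulo `F` -/

/-- `X ^ k` modulo `f`. -/
def powX (n f k : ℕ) : ℕ := (mulX n f)^[k] 1

theorem powX_lt {n f : ℕ} (hn : 1 ≤ n) (hf : IsDeg n f) (k : ℕ) : powX n f k < 2 ^ n := by
  induction k with
  | zero => exact Nat.one_lt_two_pow (by omega)
  | succ k ih =>
    rw [powX, Function.iterate_succ_apply']
    exact mulX_lt hf.lt hf.testBit ih

theorem np_powX {n f : ℕ} (hn : 1 ≤ n) (hf : IsDeg n f) (k : ℕ) :
    np (powX n f k) = X ^ k % np f := by
  induction k with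
  | zero =>
    refine (mod_eq_of_dvd ?_ ?_).symm
    · rw [hf.degree, degree_np_lt]
      exact powX_lt hn hf 0
    · simp [powX, add_self_zmod]
  | succ k ih =>
    have := np_mulX hf (powX_lt hn hf k)
    rw [powX, Function.iterate_succ_apply', ← powX, this, ih, mod_mul_mod, pow_succ']

/-- The table of the `X ^ (2 * k)` modulo `F` in the rows of the array `2`. -/
def tableProg : Stmt :=
  setRow 1 1 ;; .for 20 0 (copyRow 2 (.v 20) 1 ;; mulXRow ;; mulXRow)

theorem tableProg_spec {f : ℕ} (hc : c.Fits ℓ) (he : Env c s) (hg : Good c s)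
    (hf : s.arr 0 0 = wd c.B f) (hf' : IsDeg c.n f)
    (hQ : ∀ s', Pres c 20 [1, 2] s s' →
      (∀ k < c.n, s'.arr 2 k = wd c.B (powX c.n f (2 * k))) → Q s')
    (hT : 500 * (c.n * c.W) ≤ T) : HT ℓ tableProg s T Q := by
  have hn := hc.one_le
  have hW : 1 ≤ c.W := by simp [Ctx.W]
  have hb := budget (a := 250) (b := 98) 1 (one_mul c.n).ge hW
  have hX : c.W ≤ c.n * c.W := Nat.le_mul_of_pos_left _ hn
  refine HT.seq (B₁ := 50 * c.W + 10) (B₂ := c.n * (250 * c.W + 98) + 6)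
    (setRow_spec hc he (by decide) hg (by decide) ?_ le_rfl) (by omega)
  intro s₁ h₁ hV
  refine HT.for (m := c.n) (b := 250 * c.W + 90) (I := fun k s' => Pres c 20 [1, 2] s₁ s' ∧
      s'.arr 1 0 = wd c.B (powX c.n f (2 * k)) ∧
      ∀ i < k, s'.arr 2 i = wd c.B (powX c.n f (2 * i))) (by decide)
      ((h₁.env he (by decide)).n) ?_ ?_ ?_ le_rfl
  · exact ⟨(Pres.refl c 20 [1, 2] s₁).set le_rfl, hV, by simp⟩
  · rintro k hk s' ⟨hp, hV, hrows⟩ hx hy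
    have hp' := (h₁.mono (m := 20) (A := [1, 2]) (by decide) (by simp)).comp hp
    have e' := hp'.env he (by decide)
    have hF : s'.arr 0 0 = wd c.B f := by rw [hp'.arr (by decide), hf]
    have hlt : powX c.n f (2 * k) < 2 ^ (c.n + 1) :=
      (powX_lt hn hf' _).trans (Nat.pow_lt_pow_right one_lt_two (Nat.lt_succ_self _))
    refine HT.seq (B₁ := 50 * c.W + 10) (B₂ := 200 * c.W + 80)
      (copyRow_spec (i := k) hc e' (by decide) (by decide) (by decide) ?_ rfl ?_ (hp'.good hg)
        hV hlt ?_ le_rfl) (by omega)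
    · rw [hc.R]; omega
    · exact fun t ht => ⟨trivial, by rw [Expr.ev, ht 20 (by decide), hx]⟩
    intro s₂ h₂ hrow
    have hV₂ : s₂.arr 1 0 = wd c.B (powX c.n f (2 * k)) := by rw [h₂.arr (by decide), hV]
    refine HT.seq (B₁ := 100 * c.W + 40) (B₂ := 100 * c.W + 40) (mulXRow_spec hc
      (h₂.env e' (by decide)) (by rw [h₂.arr (by decide), hF]) hf'.lt hV₂ (powX_lt hn hf' _) ?_
      le_rfl) (by omega)
    intro s₃ h₃ hV₃
    refine mulXRow_spec (v := powX c.n f (2 * k + 1)) hc (h₃.env (h₂.env e' (by decide)) (by decide))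
      (by rw [h₃.arr (by decide), h₂.arr (by decide), hF]) hf'.lt ?_ (powX_lt hn hf' _) ?_ le_rfl
    · rw [hV₃, powX, powX, Function.iterate_succ_apply']
    intro s₄ h₄ hV₄
    refine ⟨⟨?_, ?_, ?_⟩, ?_, ?_⟩
    · exact (((hp.comp h₂).comp h₃).comp h₄).set le_rfl
    · rw [NState.set_arr, hV₄, powX, powX, ← Function.iterate_succ_apply' (mulX c.n f)]
      rfl
    · intro i hi
      rw [NState.set_arr, h₄.arr (by decide), h₃.arr (by decide), hrow]
      by_cases hik : i = k
      · subst hik; simp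
      · rw [Function.update_of_ne hik]
        exact hrows i (by omega)
    · rw [h₄.reg (by decide), h₃.reg (by decide), h₂.reg (by decide), hx]
    · rw [h₄.reg (by decide), h₃.reg (by decide), h₂.reg (by decide), hy]
  · rintro s' ⟨hp, -, hrows⟩ -
    exact hQ s' ((h₁.mono (by decide) (by simp)).comp hp) hrows

/-- The square of `h` modulo `f`, as far as it comes from the `k` lowest bits. -/
def sqAcc (n f h : ℕ) : ℕ → ℕ
  | 0 => 0
  | k + 1 => if h / 2 ^ k % 2 = 1 then sqAcc n f h k ^^^ powX n f (2 * k) else sqAcc n f h k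

theorem sqAcc_lt {n f : ℕ} (hn : 1 ≤ n) (hf : IsDeg n f) (h k : ℕ) : sqAcc n f h k < 2 ^ n := by
  induction k with
  | zero => exact Nat.two_pow_pos n
  | succ k ih =>
    unfold sqAcc
    split_ifs
    · exact Nat.xor_lt_two_pow ih (powX_lt hn hf _)
    · exact ih

/-- Squaring is additive in characteristic 2. Splitting the lowest bit off `r = h / 2^k` as `r = X
r' + b` turns `X^(2k) r²` into `X^(2k+2) r'² + b X^(2k)`, and the last term goes to the accumulator.
-/
theorem dvd_sqAcc {n f : ℕ} (hn : 1 ≤ n) (hf : IsDeg n f) (h k : ℕ) :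
    np f ∣ np h ^ 2 + (np (sqAcc n f h k) + X ^ (2 * k) * np (h / 2 ^ k) ^ 2) := by
  induction k with
  | zero => simp [sqAcc, add_self_zmod]
  | succ k ih =>
    have h1 : h / 2 ^ (k + 1) = h / 2 ^ k / 2 := by rw [pow_succ, Nat.div_div_eq_div_mul]
    rw [h1]
    rw [np_half (h / 2 ^ k)] at ih
    unfold sqAcc
    generalize np (h / 2 ^ k / 2) = r at *
    have hX := add_self_zmod (X ^ (2 * k + 1) * r)
    rcases Nat.mod_two_eq_zero_or_one (h / 2 ^ k) with hb | hb
    · rw [hb] at ih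
      rw [if_neg (by omega)]
      convert ih using 2
      simp
      ring
    · rw [hb] at ih
      rw [if_pos hb, np_xor, np_powX hn hf]
      have h2 := dvd_add ih (dvd_mod_add (X ^ (2 * k)) (np f))
      convert h2 using 1
      have := add_self_zmod (X ^ (2 * k) : (ZMod 2)[X])
      rw [Nat.cast_one, C_1]
      linear_combination - hX - this

theorem np_sqAcc {n f h : ℕ} (hn : 1 ≤ n) (hf : IsDeg n f) (hh : h < 2 ^ n) :
    np (sqAcc n f h n) = np h ^ 2 % np f := by
  refine (mod_eq_of_dvd ?_ ?_).symm
  · rw [hf.degree, degree_np_lt]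
    exact sqAcc_lt hn hf h n
  · have := dvd_sqAcc hn hf h n
    rwa [Nat.div_eq_of_lt hh, np_zero, zero_pow two_ne_zero, mul_zero, add_zero] at this

/-- `H := H ^ 2 mod F`; `H` is the array number `3`. -/
def sqProg : Stmt :=
  setRow 4 0 ;; .for 20 0
    (.ite (.op .and (.ld 3 (.c 0) (.c 0)) (.c 1)) (xorRow 4 2 (.v 20)) .skip ;; shrRow 3) ;;
  copyRow 3 (.c 0) 4

theorem sqProg_spec {f h : ℕ} (hc : c.Fits ℓ) (he : Env c s) (hg : Good c s)
    (hf' : IsDeg c.n f) (hrows : ∀ k < c.n, s.arr 2 k = wd c.B (powX c.n f (2 * k)))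
    (hh : s.arr 3 0 = wd c.B h) (hh' : h < 2 ^ c.n)
    (hQ : ∀ s', Pres c 20 [3, 4] s s' → s'.arr 3 0 = wd c.B (sqAcc c.n f h c.n) → Q s')
    (hT : 300 * (c.n * c.W) ≤ T) : HT ℓ sqProg s T Q := by
  have hn := hc.one_le
  have hB := hc.two_le
  have hW : 1 ≤ c.W := by simp [Ctx.W]
  have hb := budget (a := 100) (b := 42) 1 (one_mul c.n).ge hW
  have hX : c.W ≤ c.n * c.W := Nat.le_mul_of_pos_left _ hn
  have h1 := hc.n_lt
  have hacc : ∀ k, sqAcc c.n f h k < 2 ^ (c.n + 1) := fun k =>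
    (sqAcc_lt hn hf' h k).trans (Nat.pow_lt_pow_right one_lt_two (Nat.lt_succ_self _))
  refine HT.seq (B₁ := 50 * c.W + 10) (B₂ := c.n * (100 * c.W + 42) + 50 * c.W + 16)
    (setRow_spec hc he (by decide) hg (by decide) ?_ le_rfl) (by omega)
  intro s₁ h₁ hA
  have e₁ := h₁.env he (by decide)
  refine HT.seq (B₁ := c.n * (100 * c.W + 42) + 6) (B₂ := 50 * c.W + 10) ?_ (by omega)
  refine HT.for (m := c.n) (b := 100 * c.W + 34) (I := fun k s' => Pres c 20 [3, 4] s₁ s' ∧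
      s'.arr 3 0 = wd c.B (h / 2 ^ k) ∧ s'.arr 4 0 = wd c.B (sqAcc c.n f h k)) (by decide)
      e₁.n ?_ ?_ ?_ le_rfl
  · refine ⟨(Pres.refl c 20 [3, 4] s₁).set le_rfl, ?_, hA⟩
    simp [h₁.arr (a := 3) (by decide), hh]
  · rintro k hk s' ⟨hp, hH, hA⟩ hx hy
    have e' := hp.env e₁ (by decide)
    have hd : h / 2 ^ k < 2 ^ (c.n + 1) :=
      (Nat.div_le_self _ _).trans_lt (hh'.trans (Nat.pow_lt_pow_right one_lt_two (Nat.lt_succ_self _)))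
    have hrow : s'.arr 2 k = wd c.B (powX c.n f (2 * k)) := by
      rw [hp.arr (by decide), h₁.arr (by decide), hrows k hk]
    have hbit : (Expr.op .and (.ld 3 (.c 0) (.c 0)) (.c 1)).ev ℓ s' = h / 2 ^ k % 2 := by
      simp only [Expr.ev, BinOp.nat, hH]
      exact wd_parity (by omega) _
    -- Both branches continue with the same shift of `H`, so the rest of the round is treated once.
    have next : ∀ s₂, Pres c 30 [4] s' s₂ → s₂.arr 4 0 = wd c.B (sqAcc c.n f h (k + 1)) →
        HT ℓ (shrRow 3) s₂ (50 * c.W + 10) fun s'' => (Pres c 20 [3, 4] s₁ (s''.set 20 (k + 1)) ∧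
          (s''.set 20 (k + 1)).arr 3 0 = wd c.B (h / 2 ^ (k + 1)) ∧
          (s''.set 20 (k + 1)).arr 4 0 = wd c.B (sqAcc c.n f h (k + 1))) ∧
          s''.reg 20 = k ∧ s''.reg 0 = c.n := by
      intro s₂ h₂ hA₂
      refine shrRow_spec (u := h / 2 ^ k) hc (h₂.env e' (by decide)) (by decide)
        (by rw [h₂.arr (by decide), hH]) hd ?_ le_rfl
      intro s₃ h₃ hH₃
      refine ⟨⟨?_, ?_, ?_⟩, ?_, ?_⟩
      · exact ((hp.comp h₂).comp h₃).set le_rfl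
      · rw [NState.set_arr, hH₃, Nat.div_div_eq_div_mul, pow_succ]
      · rw [NState.set_arr, h₃.arr (by decide), hA₂]
      · rw [h₃.reg (by decide), h₂.reg (by decide), hx]
      · rw [h₃.reg (by decide), h₂.reg (by decide), hy]
    refine HT.seq (B₁ := 50 * c.W + 23) (B₂ := 50 * c.W + 10) (HT.ite (B₁ := 50 * c.W + 10) ?_ ?_ ?_
      (by simp; omega)) (by omega)
    · simp only [Expr.Ok, Expr.ev, BinOp.Ok, hc.R, hc.D, and_true]
      omega
    · rw [hbit]
      intro hb
      refine xorRow_spec (i := k) hc e' (by decide) (by decide) (by decide) (by rw [hc.R]; omega) rfl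
        (fun t ht => ⟨trivial, by rw [Expr.ev, ht 20 (by decide), hx]⟩) hA (hacc k) hrow
        ((powX_lt hn hf' _).trans (Nat.pow_lt_pow_right one_lt_two (Nat.lt_succ_self _)))
        (fun s₂ h₂ hA₂ => next s₂ h₂ ?_) le_rfl
      rw [hA₂, sqAcc, if_pos (by omega)]
    · rw [hbit]
      intro hb
      refine HT.skip (by omega) (next s' (Pres.refl c 30 [4] s') ?_)
      rw [hA, sqAcc, if_neg (by omega)]
  · rintro s' ⟨hp, -, hA⟩ -
    have hp' := (h₁.mono (m := 20) (A := [3, 4]) (by decide) (by simp)).comp hp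
    refine copyRow_spec (i := 0) hc (hp'.env he (by decide)) (by decide) (by decide) (by decide)
      (by rw [hc.R]; omega) rfl (fun t _ => ⟨by simp, rfl⟩) (hp'.good hg) hA (hacc _) ?_ le_rfl
    intro s₂ h₂ hH
    refine hQ s₂ (hp'.comp h₂) ?_
    rw [hH, Function.update_self]

end MUB

namespace MUB

open Polynomial

variable {c : Ctx} {ℓ : Layout} {s : NState} {Q : NState → Prop} {T : ℕ}

theorem wd_eq_zero_iff {B W v : ℕ} (hv : v < 2 ^ (B * W)) :
    (∀ q < W, wd B v q = 0) ↔ v = 0 := by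
  refine ⟨fun h => Nat.eq_of_testBit_eq fun i => ?_, by rintro rfl; simp⟩
  rw [Nat.zero_testBit]
  by_cases hi : i < B * W
  · have hB : 0 < B := Nat.pos_of_mul_pos_right (show 0 < B * W by omega)
    have h1 := wd_testBit (v := v) (q := i / B) (Nat.mod_lt i hB)
    rw [h _ ((Nat.div_lt_iff_lt_mul hB).mpr (by rwa [mul_comm])), mul_comm, Nat.div_add_mod] at h1
    cases h2 : v.testBit i <;> simp_all
  · exact Nat.testBit_lt_two_pow (hv.trans_le (Nat.pow_le_pow_right two_pos (not_lt.mp hi)))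

/-! ### The test of irreducibility -/

/-- One step of the gcd algorithm on the arrays `6`, `5` and the registers `21`, `22`. -/
def gcdBody : Stmt :=
  .ite (.v 22)
    (.ite (.op .and (.ld 5 (.c 0) (.c 0)) (.c 1))
      (xorRow 5 6 (.c 0) ;; .ite (.op .lt (.v 22) (.v 21))
        (xorRow 6 5 (.c 0) ;; .set 23 (.v 21) ;; .set 21 (.v 22) ;; .set 22 (.v 23)) .skip)
      .skip ;; shrRow 5 ;; .set 22 (.op .sub (.v 22) (.c 1)))
    .skip

/-- The arrays `6`, `5` and the registers `21`, `22` hold the quadruple `x`. -/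
structure HoldsGcd (c : Ctx) (x : ℕ × ℕ × ℕ × ℕ) (s : NState) : Prop where
  f : s.arr 6 0 = wd c.B x.1
  g : s.arr 5 0 = wd c.B x.2.1
  a : s.reg 21 = x.2.2.1
  b : s.reg 22 = x.2.2.2

theorem gcdBody_spec {x : ℕ × ℕ × ℕ × ℕ} (hc : c.Fits ℓ) (he : Env c s) (hx : HoldsGcd c x s)
    (h1 : x.1 < 2 ^ (c.n + 1)) (h2 : x.2.1 < 2 ^ (c.n + 1))
    (hQ : ∀ s', Pres c 21 [5, 6] s s' → s'.reg 20 = s.reg 20 → HoldsGcd c (gcdStep x) s' → Q s')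
    (hT : 150 * c.W + 70 ≤ T) : HT ℓ gcdBody s T Q := by
  obtain ⟨f, g, A, B⟩ := x
  obtain ⟨hf, hg, ha, hb⟩ := hx
  simp only at *
  have hB2 := hc.two_le
  have hlt := hc.n_lt
  refine HT.ite (B₁ := 150 * c.W + 60) (by simp) ?_ ?_ (by simp; omega)
  swap
  · intro h0
    have h0 : B = 0 := by rw [← hb]; exact h0
    refine HT.skip (by omega) (hQ s (Pres.refl ..) rfl ?_)
    rw [gcdStep, if_pos h0]
    exact ⟨hf, hg, ha, hb⟩
  intro h0
  have h0 : B ≠ 0 := by rw [← hb]; exact h0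
  -- The three active cases of `gcdStep` end alike, by halving the second number and lowering its
  -- length bound.
  have last : ∀ s₂ f' g' A' B', Pres c 21 [5, 6] s s₂ → HoldsGcd c (f', g', A', B') s₂ →
      g' < 2 ^ (c.n + 1) → B' ≠ 0 → gcdStep (f, g, A, B) = (f', g' / 2, A', B' - 1) →
      HT ℓ (shrRow 5 ;; .set 22 (.op .sub (.v 22) (.c 1))) s₂ (50 * c.W + 14) Q := by
    rintro s₂ f' g' A' B' hp ⟨hf', hg', ha', hb'⟩ hlt' hB' hstep
    simp only at hf' hg' ha' hb'
    refine HT.seq (B₁ := 50 * c.W + 10) (B₂ := 4) (shrRow_spec hc (hp.env he (by decide))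
      (by decide) hg' hlt' ?_ le_rfl) le_rfl
    intro s₃ h₃ hg₃
    have hb₃ : s₃.reg 22 = B' := by rw [h₃.reg (by decide), hb']
    refine HT.set ?_ (hQ _ ((hp.comp h₃).set (by decide)) ?_ ?_)
      (by simp)
    · simp only [Expr.Ok, Expr.ev, BinOp.Ok, hb₃, true_and]
      omega
    · simp [h₃.reg (r := 20) (by decide), hp.reg (r := 20) (by decide)]
    · rw [hstep]
      refine ⟨?_, ?_, ?_, ?_⟩
      · simpa [h₃.arr (a := 6) (by decide)] using hf'
      · simpa using hg₃
      · simpa [h₃.reg (r := 21) (by decide)] using ha'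
      · simp [BinOp.nat, hb₃]
  have hbit : (Expr.op .and (.ld 5 (.c 0) (.c 0)) (.c 1)).ev ℓ s = g % 2 := by
    simp only [Expr.ev, BinOp.nat, hg]
    exact wd_parity (by omega) _
  refine HT.seq (B₁ := 100 * c.W + 46) (B₂ := 50 * c.W + 14)
    (HT.ite (B₁ := 100 * c.W + 30) ?_ ?_ ?_ (by simp; omega)) (by omega)
  · simp only [Expr.Ok, Expr.ev, BinOp.Ok, hc.R, hc.D, and_true]
    omega
  · rw [hbit]
    intro hodd
    refine HT.seq (B₁ := 50 * c.W + 10) (B₂ := 50 * c.W + 20) (xorRow_spec (i := 0) hc he (by decide)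
      (by decide) (by decide) (by rw [hc.R]; omega) rfl (fun t _ => ⟨by simp, rfl⟩) hg h2 hf h1 ?_
      le_rfl) (by omega)
    intro s₁ k₁ hg₁
    have hx1 : g ^^^ f < 2 ^ (c.n + 1) := Nat.xor_lt_two_pow h2 h1
    have hf₁ : s₁.arr 6 0 = wd c.B f := by rw [k₁.arr (by decide), hf]
    have ha₁ : s₁.reg 21 = A := by rw [k₁.reg (by decide), ha]
    have hb₁ : s₁.reg 22 = B := by rw [k₁.reg (by decide), hb]
    refine HT.ite (B₁ := 50 * c.W + 16) (by simp [BinOp.Ok]) ?_ ?_ (by simp; omega)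
    · intro hlt
      have hlt : B < A := by simpa [BinOp.nat, ha₁, hb₁] using hlt
      refine HT.seq (B₁ := 50 * c.W + 10) (B₂ := 6) (xorRow_spec (i := 0) hc
        (k₁.env he (by decide)) (by decide)
        (by decide) (by decide) (by rw [hc.R]; omega) rfl (fun t _ => ⟨by simp, rfl⟩) hf₁ h1
        hg₁ hx1 ?_ le_rfl) (by omega)
      intro s₂ k₂ hf₂
      refine HT.seq (B₁ := 2) (B₂ := 4) (HT.set (by simp) ?_ le_rfl) (by omega)
      refine HT.seq (B₁ := 2) (B₂ := 2) (HT.set (by simp) ?_ le_rfl) (by omega)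
      refine HT.set (by simp) ?_ le_rfl
      refine last _ g (g ^^^ f) B A ?_ ?_ hx1 (by omega) ?_
      · exact ((((k₁.mono (by decide) (by simp)).comp k₂).set (by decide)).set (by decide)).set
          (by decide)
      · refine ⟨?_, ?_, ?_, ?_⟩
        · simp only [NState.set_arr, hf₂]
          -- The exchange needs no spare row: after `g := g + f`, the assignment `f := f + g`
          -- restores the old `g`.
          rw [Nat.xor_comm g f, ← Nat.xor_assoc, Nat.xor_self, Nat.zero_xor]
        · simp only [NState.set_arr]
          rw [k₂.arr (by decide), hg₁]
        · simp [k₂.reg (r := 22) (by decide), hb₁]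
        · simp [k₂.reg (r := 21) (by decide), ha₁]
      · rw [gcdStep, if_neg h0, if_neg hodd, if_neg (by simpa using hlt)]
    · intro hlt
      have hlt : A ≤ B := by simpa [BinOp.nat, ha₁, hb₁] using hlt
      refine HT.skip (by omega) (last s₁ f (g ^^^ f) A B (k₁.mono (by decide) (by simp))
        ⟨hf₁, hg₁, ha₁, hb₁⟩ hx1 h0 ?_)
      rw [gcdStep, if_neg h0, if_neg hodd, if_pos hlt]
  · rw [hbit]
    intro heven
    refine HT.skip (by omega) (last s f g A B (Pres.refl ..) ⟨hf, hg, ha, hb⟩ h2 h0 ?_)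
    rw [gcdStep, if_neg h0, if_pos heven]

/-- Register `11` becomes `1` if `F` and `H + X` are coprime, and `0` otherwise. -/
def gcdProg : Stmt :=
  copyRow 6 (.c 0) 0 ;; copyRow 5 (.c 0) 3 ;; setRow 4 2 ;; xorRow 5 4 (.c 0) ;;
  .set 21 (.op .add (.v 0) (.c 1)) ;; .set 22 (.op .add (.v 0) (.c 1)) ;; .for 20 9 gcdBody ;;
  shrRow 6 ;; .set 23 (.c 0) ;; .for 20 5 (.set 23 (.op .or (.v 23) (.ld 6 (.c 0) (.v 20)))) ;;
  .set 11 (.op .eq (.v 23) (.c 0))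

open scoped Classical in
theorem gcdProg_spec {f h : ℕ} (hc : c.Fits ℓ) (he : Env c s) (hg : Good c s)
    (hf : s.arr 0 0 = wd c.B f) (hf' : IsDeg c.n f) (hodd : f % 2 = 1)
    (hh : s.arr 3 0 = wd c.B h) (hh' : h < 2 ^ c.n)
    (hQ : ∀ s', Pres c 11 [4, 5, 6] s s' →
      s'.reg 11 = (if IsCoprime (np f) (np h + X) then 1 else 0) →
      (∀ r, 12 ≤ r → r < 20 → s'.reg r = s.reg r) → Q s')
    (hT : 1500 * (c.n * c.W) ≤ T) : HT ℓ gcdProg s T Q := by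
  have hn := hc.one_le
  have hB := hc.two_le
  have hW : 1 ≤ c.W := by simp [Ctx.W]
  have hb := budget (n := c.n) (a := 150) (b := 78) (k := 2 * c.n + 2) 4 (by omega) hW
  have hX : c.W ≤ c.n * c.W := Nat.le_mul_of_pos_left _ hn
  have h1 := hc.n_lt
  have hlt : h < 2 ^ (c.n + 1) := hh'.trans (Nat.pow_lt_pow_right one_lt_two (Nat.lt_succ_self _))
  have h2lt : 2 < 2 ^ (c.n + 1) := by
    have := Nat.pow_le_pow_right two_pos (Nat.succ_le_succ hn)
    omega
  refine HT.seq (B₁ := 50 * c.W + 10) (B₂ := 1380 * (c.n * c.W))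
    (copyRow_spec (i := 0) hc he (by decide) (by decide) (by decide) (by rw [hc.R]; omega) rfl
      (fun t _ => ⟨by simp, rfl⟩) hg hf hf'.lt ?_ le_rfl) (by omega)
  intro s₁ k₁ r₁
  have e₁ := k₁.env he (by decide)
  refine HT.seq (B₁ := 50 * c.W + 10) (B₂ := 1320 * (c.n * c.W))
    (copyRow_spec (i := 0) hc e₁ (by decide) (by decide) (by decide) (by rw [hc.R]; omega) rfl
      (fun t _ => ⟨by simp, rfl⟩) (k₁.good hg) (by rw [k₁.arr (by decide), hh]) hlt ?_ le_rfl)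
    (by omega)
  intro s₂ k₂ r₂
  have e₂ := k₂.env e₁ (by decide)
  refine HT.seq (B₁ := 50 * c.W + 10) (B₂ := 1260 * (c.n * c.W))
    (setRow_spec hc e₂ (by decide) (k₂.good (k₁.good hg)) (by decide) ?_ le_rfl) (by omega)
  intro s₃ k₃ r₃
  have e₃ := k₃.env e₂ (by decide)
  refine HT.seq (B₁ := 50 * c.W + 10) (B₂ := 1200 * (c.n * c.W))
    (xorRow_spec (i := 0) (u := h) (v := 2) hc e₃ (by decide) (by decide) (by decide)
      (by rw [hc.R]; omega) rfl (fun t _ => ⟨by simp, rfl⟩)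
      (by rw [k₃.arr (by decide), r₂, Function.update_self]) hlt r₃ h2lt ?_ le_rfl) (by omega)
  intro s₄ k₄ r₄
  have e₄ := k₄.env e₃ (by decide)
  have k04 : Pres c 21 [4, 5, 6] s s₄ :=
    (((k₁.mono (by decide) (by simp)).comp k₂).comp k₃).comp k₄
  have f₄ : s₄.arr 6 0 = wd c.B f := by
    rw [k₄.arr (by decide), k₃.arr (by decide), k₂.arr (by decide), r₁, Function.update_self]
  refine HT.seq (B₁ := 4) (B₂ := 1190 * (c.n * c.W)) (HT.set ?_ ?_ le_rfl) (by omega)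
  · simp only [Expr.Ok, Expr.ev, BinOp.Ok, e₄.n, true_and]; omega
  refine HT.seq (B₁ := 4) (B₂ := 1180 * (c.n * c.W)) (HT.set ?_ ?_ le_rfl) (by omega)
  · simp only [Expr.Ok, Expr.ev, BinOp.Ok, NState.set_reg, e₄.n, true_and,
      show (0 : ℕ) ≠ 21 by decide, if_false]; omega
  -- Both numbers have at most `n + 1` bits, so `2 * n + 2` steps, the sum of the lengths, always
  -- suffice.
  set x : ℕ × ℕ × ℕ × ℕ := (f, h ^^^ 2, c.n + 1, c.n + 1) with hx
  have inv : GcdInv (np f) (np h + X) x :=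
    ⟨hodd, hf'.lt, Nat.xor_lt_two_pow hlt h2lt, by rw [np_xor, np_two]⟩
  -- The length bounds are only exchanged or lowered, so all intermediate numbers still fit into a
  -- row.
  have hbd : ∀ k, (gcdStep^[k] x).2.2.1 ≤ c.n + 1 ∧ (gcdStep^[k] x).2.2.2 ≤ c.n + 1 := by
    intro k
    induction k with
    | zero => simp [hx]
    | succ k ih =>
      rw [Function.iterate_succ_apply']
      generalize gcdStep^[k] x = y at *
      unfold gcdStep
      split_ifs <;> constructor <;> first | omega | (dsimp only; omega)
  have hle : ∀ k, (gcdStep^[k] x).1 < 2 ^ (c.n + 1) ∧ (gcdStep^[k] x).2.1 < 2 ^ (c.n + 1) :=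
    fun k => ⟨(inv.iterate k).lt₁.trans_le (Nat.pow_le_pow_right two_pos (hbd k).1),
      (inv.iterate k).lt₂.trans_le (Nat.pow_le_pow_right two_pos (hbd k).2)⟩
  generalize hs₅ : (s₄.set 21 _).set 22 _ = s₅
  have k05 : Pres c 20 [4, 5, 6] s s₅ := by
    rw [← hs₅]
    exact ((k04.mono (by decide) (by simp)).set (by decide)).set (by decide)
  have e₅ := k05.env he (by decide)
  have g₅ : HoldsGcd c x s₅ := by
    rw [← hs₅]
    exact ⟨by simpa using f₄, by simpa using r₄, by simp [e₄.n, BinOp.nat, hx],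
      by simp [e₄.n, BinOp.nat, hx]⟩
  refine HT.seq (B₁ := (2 * c.n + 2) * (150 * c.W + 78) + 6) (B₂ := 260 * (c.n * c.W))
    (HT.for (m := 2 * c.n + 2) (b := 150 * c.W + 70) (I := fun k s' => Pres c 20 [4, 5, 6] s s' ∧
      HoldsGcd c (gcdStep^[k] x) s') (by decide) e₅.gcdSteps ?_ ?_ ?_ le_rfl) (by omega)
  · exact ⟨k05.set le_rfl, ⟨by simpa using g₅.f, by simpa using g₅.g, by simpa using g₅.a,
      by simpa using g₅.b⟩⟩
  · rintro k hk s' ⟨hp, hgcd⟩ hx' hy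
    refine gcdBody_spec hc (hp.env he (by decide)) hgcd (hle k).1 (hle k).2 ?_ le_rfl
    intro s'' hp' h20 hgcd'
    refine ⟨⟨(hp.comp hp').set le_rfl, ?_⟩, by rw [h20, hx'], by rw [hp'.reg (by decide), hy]⟩
    rw [Function.iterate_succ_apply']
    exact ⟨by simpa using hgcd'.f, by simpa using hgcd'.g, by simpa using hgcd'.a,
      by simpa using hgcd'.b⟩
  rintro s₆ ⟨k06, g₆⟩ -
  have iff := gcd_eq_one_iff inv (k := 2 * c.n + 2) (by simp only [hx]; omega)
  have hv : (gcdStep^[2 * c.n + 2] x).1 < 2 ^ (c.n + 1) := (hle _).1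
  have hf₆ := g₆.f
  generalize (gcdStep^[2 * c.n + 2] x).1 = v at iff hv hf₆
  refine HT.seq (B₁ := 50 * c.W + 10) (B₂ := 200 * (c.n * c.W)) (shrRow_spec hc
    (k06.env he (by decide)) (by decide) hf₆ hv ?_ le_rfl) (by omega)
  intro s₇ k₇ r₇
  have k07 := k06.comp k₇
  have e₇ := k07.env he (by decide)
  refine HT.seq (B₁ := 2) (B₂ := 198 * (c.n * c.W)) (HT.set (by simp) ?_ le_rfl) (by omega)
  -- The bitwise or of all words of the halved first number is zero exactly if that number is zero.
  refine HT.seq (B₁ := c.W * (13 + 8) + 6) (B₂ := 4) (HT.for (m := c.W) (b := 13)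
    (I := fun k s' => Pres c 20 [4, 5, 6] s s' ∧ s'.arr 6 0 = wd c.B (v / 2) ∧
      (s'.reg 23 = 0 ↔ ∀ q < k, wd c.B (v / 2) q = 0)) (by decide) (by simpa using e₇.W)
      ?_ ?_ ?_ le_rfl) (by omega)
  · exact ⟨(k07.set (by decide)).set le_rfl, by simpa using r₇, by simp⟩
  · rintro k hk s' ⟨hp, hrow, hz⟩ hx' hy
    have hWD := hc.W_lt
    refine HT.set ?_ ⟨⟨(hp.set (by decide)).set le_rfl, by simpa using hrow, ?_⟩, by simp [hx'],
      by simp [hy]⟩ (by simp)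
    · simp only [Expr.Ok, Expr.ev, BinOp.Ok, hx', hc.R, hc.D, and_true, true_and]
      rw [hc.D] at hWD
      omega
    · simp only [Expr.ev, BinOp.nat, NState.set_reg, hrow, hx']
      simp only [if_true, show (23 : ℕ) ≠ 20 by decide, if_false, Nat.or_eq_zero_iff, hz,
        Nat.lt_succ_iff_lt_or_eq]
      constructor
      · rintro ⟨h1, h2⟩ q (h | rfl)
        · exact h1 q h
        · exact h2
      · exact fun h => ⟨fun q hq => h q (Or.inl hq), h k (Or.inr rfl)⟩
  rintro s₈ ⟨k08, r₈, hz⟩ -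
  refine HT.set (by simp [BinOp.Ok]) (hQ _ ((k08.mono (by decide) (List.Subset.refl _)).set le_rfl)
    ?_ ?_) (by simp)
  · simp only [Expr.ev, BinOp.nat, NState.set_reg, if_true, hz,
      wd_eq_zero_iff (hc.lt_pow (v := v / 2) (by omega)), iff]
  · intro r h1 h2
    rw [NState.set_reg, if_neg (by omega), k08.reg h2]

end MUB

namespace MUB

open Polynomial

variable {c : Ctx} {ℓ : Layout} {s : NState} {Q : NState → Prop} {T : ℕ}

/-- Register `11` becomes `1` if `F` is irreducible, and `0` otherwise. -/
def testProg : Stmt :=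
  .set 11 (.c 1) ;; tableProg ;; setRow 3 2 ;;
    .for 12 8 (.ite (.v 11) (sqProg ;; gcdProg) .skip)

open scoped Classical in
/-- The number of rounds of the test in which `f` has not yet been rejected. -/
noncomputable def rounds (n : ℕ) (f : (ZMod 2)[X]) : ℕ :=
  ((Finset.range (n / 2)).filter (NoFactor · f)).card

theorem isCoprime_mod_add (f a b : (ZMod 2)[X]) :
    IsCoprime f (a % f + b) ↔ IsCoprime f (a + b) := by
  obtain ⟨d, hd⟩ := dvd_mod_add a f
  have : a % f + b = a + b + f * d := by
    rw [← hd]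
    linear_combination (-1) * add_self_zmod a
  rw [this]
  exact IsCoprime.add_mul_left_right_iff

-- Before round `k` the flag tells whether all factors of degree at most `k` are excluded, and while
-- it is set, array `3` holds `X ^ 2 ^ k` modulo `f`. Only rounds entered with the flag set pay for
-- a squaring and a gcd, and `rounds` counts them; the other rounds cost a constant.
open scoped Classical in
theorem testProg_spec {f : ℕ} (hc : c.Fits ℓ) (he : Env c s) (hg : Good c s)
    (hf : s.arr 0 0 = wd c.B f) (hf' : IsDeg c.n f) (hodd : f % 2 = 1)
    (hQ : ∀ s', Pres c 11 [1, 2, 3, 4, 5, 6] s s' →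
      s'.reg 11 = (if Irreducible (np f) then 1 else 0) → Q s')
    (hT : 700 * (c.n * c.W) + 1900 * (c.n * c.W) * rounds c.n (np f) ≤ T) :
    HT ℓ testProg s T Q := by
  have hn := hc.one_le
  have hW : 1 ≤ c.W := by simp [Ctx.W]
  have hX : c.W ≤ c.n * c.W := Nat.le_mul_of_pos_left _ hn
  have hX' : c.n ≤ c.n * c.W := Nat.le_mul_of_pos_right _ hW
  have h1 := hc.n_lt
  refine HT.seq (B₁ := 2) (HT.set (by simp only [Expr.Ok]; omega) ?_ le_rfl)
    (B₂ := 690 * (c.n * c.W) + 1900 * (c.n * c.W) * rounds c.n (np f)) (by omega)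
  refine HT.seq (B₁ := 500 * (c.n * c.W))
    (B₂ := 190 * (c.n * c.W) + 1900 * (c.n * c.W) * rounds c.n (np f))
    (tableProg_spec hc (he.of_eq ?_) hg hf hf' ?_ le_rfl) (by omega)
  · intro r hr
    rw [NState.set_reg, if_neg (by omega)]
  intro s₁ k₁ hrows
  have k₁ : Pres c 11 [1, 2, 3, 4, 5, 6] s s₁ :=
    ((Pres.refl c 11 [1, 2, 3, 4, 5, 6] s).set le_rfl).comp k₁
  have h11 : s₁.reg 11 = 1 := by
    rename_i k
    rw [k.reg (by decide)]
    simp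
  have e₁ := k₁.env he (by decide)
  refine HT.seq (B₁ := 50 * c.W + 10)
    (B₂ := 100 * (c.n * c.W) + 1900 * (c.n * c.W) * rounds c.n (np f))
    (setRow_spec hc e₁ (by decide) (k₁.good hg) (by decide) ?_ le_rfl) (by omega)
  intro s₂ k₂ r₂
  refine HT.for_sum (m := c.n / 2)
    (b := fun k => if NoFactor k (np f) then 1900 * (c.n * c.W) + 5 else 5)
    (I := fun k s' => Pres c 11 [1, 2, 3, 4, 5, 6] s s' ∧
      (∀ k < c.n, s'.arr 2 k = wd c.B (powX c.n f (2 * k))) ∧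
      s'.reg 11 = (if NoFactor k (np f) then 1 else 0) ∧
      (NoFactor k (np f) → ∃ h, s'.arr 3 0 = wd c.B h ∧
        -- The initial value `X` is reduced modulo `f` only if `n ≥ 2`; for `n = 1` the loop is
        -- empty.
        (2 ≤ c.n → h < 2 ^ c.n ∧ np h = X ^ 2 ^ k % np f)))
    (by decide) ((k₁.comp k₂).env he (by decide)).steps ?_ ?_ ?_ ?_
  · refine ⟨(k₁.comp k₂).set (by decide), ?_, ?_, fun _ => ⟨2, by simpa using r₂, fun h2 => ?_⟩⟩
    · intro k hk
      rw [NState.set_arr, k₂.arr (by decide), hrows k hk]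
    · rw [if_pos noFactor_zero]
      simp [k₂.reg (r := 11) (by decide), h11]
    · have : 2 < 2 ^ c.n := (Nat.pow_le_pow_right two_pos h2).trans_lt' (by norm_num)
      refine ⟨this, ?_⟩
      rw [np_two, pow_zero, pow_one]
      refine (mod_eq_of_dvd ?_ (by rw [add_self_zmod]; exact dvd_zero _)).symm
      rw [hf'.degree, ← np_two, degree_np_lt]
      exact this
  · rintro k hk s' ⟨hp, hrows, hal, hH⟩ hx hy
    have hn2 : 2 ≤ c.n := by omega
    by_cases hk' : NoFactor k (np f)
    · rw [if_pos hk'] at hal ⊢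
      obtain ⟨h, hH, hh⟩ := hH hk'
      obtain ⟨hlt, hnp⟩ := hh hn2
      refine HT.ite (B₁ := 1900 * (c.n * c.W)) (by simp) ?_ (by simp [hal]) (by simp; omega)
      intro _
      refine HT.seq (B₁ := 300 * (c.n * c.W)) (B₂ := 1500 * (c.n * c.W)) (sqProg_spec hc
        (hp.env he (by decide)) (hp.good hg) hf' hrows hH hlt ?_ le_rfl) (by omega)
      intro s₃ k₃ r₃
      have hsq : np (sqAcc c.n f h c.n) = X ^ 2 ^ (k + 1) % np f := by
        rw [np_sqAcc hn hf' hlt, hnp, pow_two, mod_mul_mod, mul_comm, mod_mul_mod, ← pow_add]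
        congr 2
        ring
      refine gcdProg_spec hc ((hp.comp k₃).env he (by decide)) ((hp.comp k₃).good hg) ?_ hf' hodd
        r₃ (sqAcc_lt hn hf' _ _) ?_ le_rfl
      · rw [k₃.arr (by decide), hp.arr (by decide), hf]
      intro s₄ k₄ h11 hreg
      refine ⟨⟨((hp.comp k₃).comp k₄).set (by decide), ?_, ?_, fun _ => ⟨_, ?_, fun _ =>
        ⟨sqAcc_lt hn hf' h c.n, hsq⟩⟩⟩, ?_, ?_⟩
      · intro i hi
        rw [NState.set_arr, k₄.arr (by decide), k₃.arr (by decide), hrows i hi]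
      · rw [NState.set_reg, if_neg (by decide), h11, hsq, isCoprime_mod_add]
        simp only [noFactor_succ, hk', true_and]
      · rw [NState.set_arr, k₄.arr (by decide), r₃]
      · rw [hreg 12 le_rfl (by decide), k₃.reg (by decide), hx]
      · rw [k₄.reg (by decide), k₃.reg (by decide), hy]
    · rw [if_neg hk'] at hal ⊢
      have hk'' : ¬ NoFactor (k + 1) (np f) := fun h => hk' ((noFactor_succ k).mp h).1
      refine HT.ite (B₁ := 1) (by simp) (by simp [hal]) ?_ (by simp)
      intro _
      refine HT.skip le_rfl ⟨⟨hp.set (by decide), hrows, ?_, fun h => absurd h hk''⟩, hx, hy⟩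
      rw [NState.set_reg, if_neg (by decide), hal, if_neg hk'']
  · rintro s' ⟨hp, -, h11, -⟩ -
    refine hQ s' hp ?_
    rw [h11]
    simp only [irreducible_iff_noFactor hf'.natDegree hn]
  · have h2 : ∑ k ∈ Finset.range (c.n / 2),
        ((if NoFactor k (np f) then 1900 * (c.n * c.W) + 5 else 5) + 8) =
        1900 * (c.n * c.W) * rounds c.n (np f) + 13 * (c.n / 2) := by
      have : ∀ k, ((if NoFactor k (np f) then 1900 * (c.n * c.W) + 5 else 5) + 8) =
          (if NoFactor k (np f) then 1900 * (c.n * c.W) else 0) + 13 := by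
        intro k
        split_ifs <;> rfl
      simp only [this]
      rw [Finset.sum_add_distrib, ← Finset.sum_filter, Finset.sum_const, Finset.sum_const,
        Finset.card_range, rounds]
      simp only [smul_eq_mul]
      ring
    rw [h2]
    omega

/-! ### Random polynomials -/

/-- The number whose binary digits are those of `u`, followed by `b 0, …, b (k - 1)`. -/
def horner (u : ℕ) (b : ℕ → ℕ) : ℕ → ℕ
  | 0 => u
  | k + 1 => 2 * horner u b k + b k

theorem horner_lt {u : ℕ} {b : ℕ → ℕ} (hb : ∀ k, b k < 2) (k : ℕ) :
    horner u b k < (u + 1) * 2 ^ k := by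
  induction k with
  | zero => simp [horner]
  | succ k ih =>
    have := hb k
    rw [horner, pow_succ]
    nlinarith

theorem le_horner (u : ℕ) (b : ℕ → ℕ) (k : ℕ) : u * 2 ^ k ≤ horner u b k := by
  induction k with
  | zero => simp [horner]
  | succ k ih => rw [horner, pow_succ]; nlinarith

/-- The polynomial `1 + ⋯ + X ^ n` whose other coefficients are the coin tosses `ω`. -/
def trialPoly (n : ℕ) (ω : ℕ → Bool) : ℕ := 2 * horner 1 (fun k => (ω k).toNat) (n - 1) + 1

theorem isDeg_trialPoly {n : ℕ} (hn : 1 ≤ n) (ω : ℕ → Bool) : IsDeg n (trialPoly n ω) := by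
  obtain ⟨m, rfl⟩ : ∃ m, n = m + 1 := ⟨n - 1, by omega⟩
  have h1 := horner_lt (u := 1) (b := fun k => (ω k).toNat) (fun k => Bool.toNat_lt _) m
  have h2 := le_horner 1 (fun k => (ω k).toNat) m
  rw [trialPoly, Nat.add_sub_cancel]
  constructor
  · rw [pow_succ, pow_succ]; omega
  · rw [pow_succ]; omega

theorem trialPoly_odd (n : ℕ) (ω : ℕ → Bool) : trialPoly n ω % 2 = 1 := by
  rw [trialPoly]; omega

/-- `F :=` a random polynomial. -/
def randomProg : Stmt :=
  .set 10 (.op .sub (.v 0) (.c 1)) ;; setRow 0 1 ;; .for 20 10 (.coin 21 ;; shlRow 0 (.v 21)) ;;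
    shlRow 0 (.c 1)

theorem randomProg_spec (hc : c.Fits ℓ) (he : Env c s) (hg : Good c s)
    (hQ : ∀ s', (∀ r < 10, s'.reg r = s.reg r) → s'.out = s.out →
      (∀ i, s'.tape i = s.tape (i + (c.n - 1))) → Good c s' →
      s'.arr 0 0 = wd c.B (trialPoly c.n s.tape) → Q s')
    (hT : 250 * (c.n * c.W) ≤ T) : HT ℓ randomProg s T Q := by
  have hn := hc.one_le
  have hW : 1 ≤ c.W := by simp [Ctx.W]
  have hX : c.W ≤ c.n * c.W := Nat.le_mul_of_pos_left _ hn
  have hb := budget (n := c.n) (a := 50) (b := 20) (k := c.n - 1) 1 (by omega) hW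
  have h1 := hc.n_lt
  refine HT.seq (B₁ := 4) (B₂ := 240 * (c.n * c.W)) (HT.set ?_ ?_ le_rfl) (by omega)
  · simp only [Expr.Ok, Expr.ev, BinOp.Ok, he.n, true_and]; omega
  generalize hs₁ : s.set 10 _ = s₁
  have k₁ : Pres c 10 [0] s s₁ := by rw [← hs₁]; exact (Pres.refl c 10 [0] s).set le_rfl
  have r₁ : s₁.reg 10 = c.n - 1 := by rw [← hs₁]; simp [BinOp.nat, he.n]
  refine HT.seq (B₁ := 50 * c.W + 10) (B₂ := 180 * (c.n * c.W))
    (setRow_spec hc (k₁.env he le_rfl) (by decide) (k₁.good hg) (by decide) ?_ le_rfl) (by omega)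
  intro s₂ k₂ row₂
  set b : ℕ → ℕ := fun k => (s.tape k).toNat with hbdef
  have hb2 : ∀ k, b k < 2 := fun k => Bool.toNat_lt _
  refine HT.seq (B₁ := (c.n - 1) * (50 * c.W + 20) + 6) (B₂ := 100 * (c.n * c.W))
    (HT.for (m := c.n - 1) (b := 50 * c.W + 12) (I := fun k s' => (∀ r < 20, s'.reg r = s₂.reg r) ∧
      s'.out = s₂.out ∧ (∀ i, s'.tape i = s.tape (i + k)) ∧ Good c s' ∧
      s'.arr 0 0 = wd c.B (horner 1 b k))
      (by decide) (by rw [k₂.reg (by decide), r₁]) ?_ ?_ ?_ le_rfl) (by omega)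
  · refine ⟨fun r hr => by rw [NState.set_reg, if_neg (by omega)], rfl, fun i => ?_,
      k₂.good (k₁.good hg), row₂⟩
    rw [NState.set_tape, k₂.keep.2.2.1, k₁.keep.2.2.1]
    rfl
  · rintro k hk s' ⟨hreg, hout, htape, hgood, hrow⟩ hx hy
    have e' : Env c s' := by
      refine (k₂.env (k₁.env he le_rfl) (by decide)).of_eq fun r hr => hreg r (by omega)
    have hlt := horner_lt (u := 1) hb2 k
    have h2 : 2 ^ (k + 1) ≤ 2 ^ c.n := Nat.pow_le_pow_right two_pos (by omega)
    rw [pow_succ] at h2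
    refine HT.seq (B₁ := 1) (B₂ := 50 * c.W + 11) (HT.coin ?_ le_rfl) (by omega)
    have hev : (Expr.v 21).ev ℓ (s'.flip 21) = b k := by
      simp [htape, hbdef]
    refine shlRow_spec (u := horner 1 b k) hc (e'.of_eq fun r hr => ?_) (by decide) hrow (by omega)
      trivial (by rw [hev]; exact hb2 k) ?_ le_rfl
    · rw [NState.flip_reg, if_neg (by omega)]
    intro s₃ k₃ r₃
    have hr : ∀ r < 21, s₃.reg r = s'.reg r := fun r hr => by
      rw [k₃.reg (by omega), NState.flip_reg, if_neg (by omega)]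
    refine ⟨⟨fun r hr' => ?_, ?_, fun i => ?_, ?_, ?_⟩, ?_, ?_⟩
    · rw [NState.set_reg, if_neg (by omega), hr r (by omega), hreg r hr']
    · rw [NState.set_out, k₃.keep.2.1, NState.flip_out, hout]
    · rw [NState.set_tape, k₃.keep.2.2.1, NState.flip_tape, htape]
      congr 1
      ring
    · exact k₃.good hgood
    · rw [NState.set_arr, r₃, hev]
      rfl
    · rw [hr 20 (by decide), hx]
    · rw [hr 10 (by decide), hy]
  rintro s₃ ⟨hreg, hout, htape, hgood, hrow⟩ -
  have e₃ : Env c s₃ := by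
    refine (k₂.env (k₁.env he le_rfl) (by decide)).of_eq fun r hr => hreg r (by omega)
  have hlt := horner_lt (u := 1) hb2 (c.n - 1)
  have h2 : 2 ^ c.n = 2 * 2 ^ (c.n - 1) := by rw [← pow_succ']; congr 1; omega
  refine shlRow_spec (u := horner 1 b (c.n - 1)) hc e₃ (by decide) hrow (by omega)
    (by simp only [Expr.Ok]; omega) (by simp) ?_ (by simp; omega)
  intro s₄ k₄ r₄
  refine hQ s₄ (fun r hr => ?_) ?_ (fun i => ?_) (k₄.good hgood) r₄
  · rw [k₄.reg (by omega), hreg r (by omega), k₂.reg (by omega), k₁.reg hr]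
  · rw [k₄.keep.2.1, hout, k₂.keep.2.1, k₁.keep.2.1]
  · rw [k₄.keep.2.2.1, htape]

/-- Draw random polynomials until an irreducible one is found. -/
def searchProg : Stmt :=
  .set 11 (.c 0) ;; .loop (.op .eq (.v 11) (.c 0)) (randomProg ;; testProg)

/-- The `k`-th polynomial that is drawn with the coin tosses `ω`. -/
def drawn (n : ℕ) (ω : ℕ → Bool) (k : ℕ) : ℕ := trialPoly n fun i => ω (k * (n - 1) + i)

open scoped Classical in
/-- The state after `k` draws. -/
structure Drawn (c : Ctx) (s : NState) (ω : ℕ → Bool) (k : ℕ) (s' : NState) : Prop where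
  reg : ∀ r < 10, s'.reg r = s.reg r
  good : Good c s'
  tape : ∀ i, s'.tape i = ω (k * (c.n - 1) + i)
  flag : s'.reg 11 = if ∃ l, k = l + 1 ∧ Irreducible (np (drawn c.n ω l)) then 1 else 0
  row : ∀ l, k = l + 1 → s'.arr 0 0 = wd c.B (drawn c.n ω l)

/-- A single draw halts whatever the coins are and whether or not it succeeds, so this step serves
the successful search and the divergent one alike. -/
theorem Drawn.step {ω : ℕ → Bool} {k : ℕ} {s' : NState} (hc : c.Fits ℓ) (he : Env c s)
    (h : Drawn c s ω k s') :
    HT ℓ (randomProg ;; testProg) s' (950 * (c.n * c.W) +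
      1900 * (c.n * c.W) * rounds c.n (np (drawn c.n ω k))) (Drawn c s ω (k + 1)) := by
  have e' := he.of_eq h.reg
  have ht : trialPoly c.n s'.tape = drawn c.n ω k := by
    rw [drawn]
    congr 1
    exact funext h.tape
  refine HT.seq (B₁ := 250 * (c.n * c.W)) (B₂ := 700 * (c.n * c.W) +
      1900 * (c.n * c.W) * rounds c.n (np (drawn c.n ω k)))
    (randomProg_spec hc e' h.good ?_ le_rfl) (by omega)
  intro s₁ hreg hout htape hgood hrow
  rw [ht] at hrow
  refine testProg_spec hc (e'.of_eq hreg) hgood hrow (ht ▸ isDeg_trialPoly hc.one_le _)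
    (ht ▸ trialPoly_odd _ _) ?_ le_rfl
  intro s₂ k₂ h11
  refine ⟨fun r hr => ?_, k₂.good hgood, fun i => ?_, ?_, ?_⟩
  · rw [k₂.reg (by omega), hreg r hr, h.reg r hr]
  · rw [k₂.keep.2.2.1, htape, h.tape]
    congr 1
    ring
  · rw [h11]
    congr 1
    simp
  · intro l hl
    obtain rfl : k = l := by omega
    rw [k₂.arr (by decide), hrow]

theorem Drawn.zero (hg : Good c s) : Drawn c s s.tape 0 (s.set 11 0) :=
  ⟨fun r hr => by rw [NState.set_reg, if_neg (by omega)], hg, fun i => by simp, by simp, by simp⟩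

/-- The search ends with the first irreducible polynomial. -/
theorem searchProg_spec {K : ℕ} (hc : c.Fits ℓ) (he : Env c s) (hg : Good c s)
    (hK : Irreducible (np (drawn c.n s.tape K)))
    (hK' : ∀ k < K, ¬ Irreducible (np (drawn c.n s.tape k)))
    (hQ : ∀ s', (∀ r < 10, s'.reg r = s.reg r) → Good c s' →
      s'.arr 0 0 = wd c.B (drawn c.n s.tape K) → Q s')
    (hT : ∑ k ∈ Finset.range (K + 1), (1000 * (c.n * c.W) +
      1900 * (c.n * c.W) * rounds c.n (np (drawn c.n s.tape k))) + 6 ≤ T) :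
    HT ℓ searchProg s T Q := by
  have hX : 1 ≤ c.n * c.W := Nat.mul_pos hc.one_le (by simp [Ctx.W])
  refine HT.seq (B₁ := 2) (HT.set (by simp) ?_ le_rfl) (B₂ := ∑ k ∈ Finset.range (K + 1),
    (1000 * (c.n * c.W) + 1900 * (c.n * c.W) * rounds c.n (np (drawn c.n s.tape k))) + 4) (by omega)
  refine HT.loop (m := K + 1) (I := Drawn c s s.tape) (b := fun k => 950 * (c.n * c.W) +
      1900 * (c.n * c.W) * rounds c.n (np (drawn c.n s.tape k))) ?_ ?_ (Drawn.zero hg) ?_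
  · intro k hk s' h
    refine ⟨by simp [BinOp.Ok], ?_, h.step hc he⟩
    have : ¬ ∃ l, k = l + 1 ∧ Irreducible (np (drawn c.n s.tape l)) := by
      rintro ⟨l, rfl, hl⟩
      exact hK' l (by omega) hl
    simp [BinOp.nat, h.flag, this]
  · intro s' h
    refine ⟨by simp [BinOp.Ok], ?_, hQ s' h.reg h.good (h.row K rfl)⟩
    have : ∃ l, K + 1 = l + 1 ∧ Irreducible (np (drawn c.n s.tape l)) := ⟨K, rfl, hK⟩
    have hfl := h.flag
    rw [if_pos this] at hfl
    simp [BinOp.nat, hfl]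
  · refine (Nat.add_le_add_right (Nat.add_le_add_right (Finset.sum_le_sum fun k _ => ?_) _) _).trans
      (le_of_eq rfl)
    simp only [Expr.cost]
    omega

/-- Without an irreducible polynomial among those drawn, the search does not halt. -/
theorem searchProg_diverges (hc : c.Fits ℓ) (he : Env c s) (hg : Good c s)
    (hK : ∀ k, ¬ Irreducible (np (drawn c.n s.tape k))) {σ τ : State ℓ.w} (r : Rep ℓ σ s) {t : ℕ} :
    ¬ Exec searchProg.compile σ t τ := by
  intro h
  cases h with
  | seq h1 h2 =>
    obtain ⟨t', τ', s', e, -, r', hs'⟩ := HT.set (ℓ := ℓ) (s := s) (x := 11) (e := .c 0)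
      (Q := (· = s.set 11 0)) (by simp) (by simp) le_rfl σ r
    obtain ⟨rfl, rfl⟩ := e.det h1
    subst hs'
    refine HT.loop_diverges (I := Drawn c s s.tape) (b := fun k => 950 * (c.n * c.W) +
      1900 * (c.n * c.W) * rounds c.n (np (drawn c.n s.tape k))) ?_ (Drawn.zero hg) r' h2
    intro k s' h
    refine ⟨by simp [BinOp.Ok], ?_, h.step hc he⟩
    have : ¬ ∃ l, k = l + 1 ∧ Irreducible (np (drawn c.n s.tape l)) := by
      rintro ⟨l, rfl, hl⟩
      exact hK l hl
    simp [BinOp.nat, h.flag, this]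

end MUB

namespace MUB

variable {c : Ctx} {ℓ : Layout} {s : NState} {Q : NState → Prop} {T : ℕ}

/-! ### Input and output -/

/-- Append the `n` input bits before the cell in register `17`, the last one first, to `u`. -/
def readProg (a u : ℕ) : Stmt :=
  setRow a u ;; .for 20 0
    (.set 17 (.op .sub (.v 17) (.c 1)) ;; .set 21 (.inp (.v 17)) ;; shlRow a (.v 21))

/-- Repeated doubling puts the first bit read on top, so reading backwards gives cell `p + r` the
weight `2 ^ r`. With `u = 1` the leading term `X ^ n` is added, which the encoding of a modulus
omits. -/
theorem readProg_spec {a u p : ℕ} (hc : c.Fits ℓ) (he : Env c s) (hg : Good c s) (ha : a < 16)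
    (hu : u < 2) (hp : s.reg 17 = p + c.n) (hL : p + c.n ≤ ℓ.L) (hinp : ∀ i, ℓ.inp i < 2)
    (hQ : ∀ s', Pres c 17 [a] s s' →
      s'.arr a 0 = wd c.B (horner u (fun k => ℓ.inp (p + c.n - 1 - k)) c.n) → Q s')
    (hT : 250 * (c.n * c.W) ≤ T) : HT ℓ (readProg a u) s T Q := by
  have hn := hc.one_le
  have hW : 1 ≤ c.W := by simp [Ctx.W]
  have hX : c.W ≤ c.n * c.W := Nat.le_mul_of_pos_left _ hn
  have hb := budget (n := c.n) (a := 50) (b := 26) (k := c.n) 1 (by omega) hW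
  have h1 := hc.n_lt
  set b : ℕ → ℕ := fun k => ℓ.inp (p + c.n - 1 - k) with hbdef
  have hb2 : ∀ k, b k < 2 := fun k => hinp _
  refine HT.seq (B₁ := 50 * c.W + 10) (B₂ := c.n * (50 * c.W + 26) + 6)
    (setRow_spec hc he ha hg (by omega) ?_ le_rfl) (by omega)
  intro s₁ k₁ r₁
  refine HT.for (m := c.n) (b := 50 * c.W + 18) (I := fun k s' => Pres c 17 [a] s s' ∧
    s'.reg 17 = p + c.n - k ∧ s'.arr a 0 = wd c.B (horner u b k)) (by decide)
    (by rw [k₁.reg (by decide), he.n]) ?_ ?_ ?_ le_rfl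
  · exact ⟨(k₁.mono (by decide) (List.Subset.refl _)).set (by decide),
      by simp [k₁.reg (r := 17) (by decide), hp], r₁⟩
  · rintro k hk s' ⟨hpr, h17, hrow⟩ hx hy
    have hlt := horner_lt (u := u) hb2 k
    have h2 : 2 ^ (k + 1) ≤ 2 ^ c.n := Nat.pow_le_pow_right two_pos (by omega)
    rw [pow_succ] at h2
    have h3 : (u + 1) * 2 ^ k ≤ 2 * 2 ^ k := Nat.mul_le_mul_right _ hu
    refine HT.seq (B₁ := 4) (B₂ := 50 * c.W + 14) (HT.set ?_ ?_ le_rfl) (by omega)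
    · simp only [Expr.Ok, Expr.ev, BinOp.Ok, h17, true_and]; omega
    refine HT.seq (B₁ := 3) (B₂ := 50 * c.W + 11) (HT.set ?_ ?_ le_rfl) (by omega)
    · simp only [Expr.Ok, Expr.ev, BinOp.nat, h17, NState.set_reg, if_true, true_and]; omega
    generalize hs₂ : (s'.set 17 _).set 21 _ = s₂
    have k₂ : Pres c 17 [a] s s₂ := by
      rw [← hs₂]; exact (hpr.set le_rfl).set (by decide)
    have h21 : s₂.reg 21 = b k := by
      rw [← hs₂]
      simp [BinOp.nat, h17, hbdef, Nat.sub_right_comm]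
    refine shlRow_spec (u := horner u b k) (e := .v 21) hc (k₂.env he (by decide)) ha
      (by rw [← hs₂]; exact hrow) (by omega) trivial (by rw [Expr.ev, h21]; exact hb2 k) ?_ le_rfl
    intro s₃ k₃ r₃
    refine ⟨⟨(k₂.comp k₃).set (by decide), ?_, ?_⟩, ?_, ?_⟩
    · rw [NState.set_reg, if_neg (by decide), k₃.reg (by decide), ← hs₂]
      simp [BinOp.nat, h17]
      omega
    · rw [NState.set_arr, r₃, Expr.ev, h21]
      rfl
    · rw [k₃.reg (by decide), ← hs₂]
      simpa using hx
    · rw [k₃.reg (by decide), ← hs₂]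
      simpa using hy
  · rintro s' ⟨hpr, -, hrow⟩ -
    exact hQ s' hpr hrow

/-- The successive values of the array `1`. -/
def mulN (n f v k : ℕ) : ℕ := (mulX n f)^[k] v

theorem mulN_succ (n f v k : ℕ) : mulN n f v (k + 1) = mulX n f (mulN n f v k) :=
  Function.iterate_succ_apply' _ _ _

theorem mulN_lt {n f v : ℕ} (hf : IsDeg n f) (hv : v < 2 ^ n) (k : ℕ) : mulN n f v k < 2 ^ n := by
  induction k with
  | zero => exact hv
  | succ k ih =>
    rw [mulN_succ]
    exact mulX_lt hf.lt hf.testBit ih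

/-- The output cells from number `o` on hold the coefficients that belong to `v`. -/
def Block (n f v o : ℕ) (out : ℕ → ℕ) (r : ℕ) : Prop :=
  -- The residue of minus the exponent modulo 4; the sign comes from the complex conjugation in
  -- `alpha`.
  (∀ i < r, out (o + i) = (4 - mulN n f v (2 * i) % 4) % 4) ∧
    ∀ m < 2 * r, out (o + n + m) = mulN n f v m % 2

theorem Block.congr {n f v o r : ℕ} {out out' : ℕ → ℕ} (h : Block n f v o out r) (hr : r ≤ n)
    (h' : ∀ i, i < o + 3 * n → out' i = out i) : Block n f v o out' r :=
  ⟨fun i hi => (h' _ (by omega)).trans (h.1 i hi), fun m hm => (h' _ (by omega)).trans (h.2 m hm)⟩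

/-- One pass through `j X^m`, `m < 2n`, yields both families of coefficients: round `r` reads `a_r`
and `b_{2r}` off `j X^(2r)`, then `b_{2r+1}` off the next multiple. -/
def emitBody : Stmt :=
  .out (.op .add (.v 15) (.v 20))
    (.op .and (.op .sub (.c 4) (.op .and (.ld 1 (.c 0) (.c 0)) (.c 3))) (.c 3)) ;;
  .set 18 (.op .add (.op .add (.v 15) (.v 0)) (.op .add (.v 20) (.v 20))) ;;
  .out (.v 18) (.op .and (.ld 1 (.c 0) (.c 0)) (.c 1)) ;; mulXRow ;;
  .out (.op .add (.v 18) (.c 1)) (.op .and (.ld 1 (.c 0) (.c 0)) (.c 1)) ;; mulXRow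

theorem emitBody_spec {f v o r : ℕ} (hc : c.Fits ℓ) (he : Env c s) (hf : s.arr 0 0 = wd c.B f)
    (hf' : IsDeg c.n f) (hv' : v < 2 ^ c.n) (ho : s.reg 15 = o)
    (hr : s.reg 20 = r) (hrn : r < c.n) (hM : o + 3 * c.n ≤ ℓ.M)
    (hv : s.arr 1 0 = wd c.B (mulN c.n f v (2 * r))) (hbl : Block c.n f v o s.out r)
    (hQ : ∀ s', (∀ x < 18, s'.reg x = s.reg x) → s'.reg 20 = r → (Good c s → Good c s') →
      s'.arr 0 = s.arr 0 → s'.arr 1 0 = wd c.B (mulN c.n f v (2 * (r + 1))) →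
      Block c.n f v o s'.out (r + 1) → (∀ i < o, s'.out i = s.out i) → Q s')
    (hT : 200 * c.W + 200 ≤ T) : HT ℓ emitBody s T Q := by
  refine HT.of_pos fun hpos hfit => ?_
  have hB := hc.two_le
  have h1 := hc.n_lt
  have hRD : 0 < ℓ.R * ℓ.D := by rw [hc.R, hc.D]; positivity
  -- The residue modulo 4 lies in the lowest word because a word holds at least two bits of the row.
  have hlow : ∀ v, wd c.B v 0 &&& 3 = v % 4 := fun v => by
    rw [wd_zero_right, show 3 = 2 ^ 2 - 1 by rfl, Nat.and_two_pow_sub_one_eq_mod]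
    exact Nat.mod_mod_of_dvd _ (pow_dvd_pow 2 hB)
  have hand : ∀ v, v &&& 3 = v % 4 := fun v => Nat.and_two_pow_sub_one_eq_mod v 2
  have hlt := fun k => mulN_lt hf' hv' k
  refine HT.seq (B₁ := 23) (B₂ := 200 * c.W + 177) (HT.out ?_ ?_ ?_ ?_ (by decide)) (by omega)
  · simp only [Expr.Ok, Expr.ev, BinOp.Ok, ho, hr, true_and]; omega
  · simp only [Expr.Ok, Expr.ev, BinOp.Ok, BinOp.nat, hc.R, hc.D, hv, hlow, and_true]
    refine ⟨⟨?_, ⟨⟨?_, ?_, ?_, ?_, ?_⟩, ?_⟩, ?_⟩, ?_⟩ <;> omega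
  · simp only [Expr.ev, BinOp.nat, ho, hr]; omega
  simp only [Expr.ev, BinOp.nat, ho, hr, hv, hlow, hand]
  refine HT.seq (B₁ := 8) (B₂ := 200 * c.W + 169) (HT.set ?_ ?_ le_rfl) (by omega)
  · simp only [Expr.Ok, Expr.ev, BinOp.Ok, BinOp.nat, NState.setOut_reg, ho, hr, he.n, true_and]
    omega
  simp only [Expr.ev, BinOp.nat, NState.setOut_reg, ho, hr, he.n]
  refine HT.seq (B₁ := 15) (B₂ := 200 * c.W + 154) (HT.out trivial ?_ ?_ ?_ le_rfl) (by omega)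
  · simp only [Expr.Ok, Expr.ev, BinOp.Ok, hc.R, hc.D, and_true]; omega
  · simp only [Expr.ev, NState.set_reg, if_true]; omega
  simp only [Expr.ev, BinOp.nat, NState.set_reg, if_true, NState.set_arr, NState.setOut_arr, hv,
    wd_parity (show 1 ≤ c.B by omega)]
  generalize hs₁ : (((s.setOut _ _).set 18 _).setOut _ _) = s₁
  have reg₁ : ∀ x, s₁.reg x = if x = 18 then o + c.n + (r + r) else s.reg x := by
    intro x; rw [← hs₁]; simp
  have arr₁ : s₁.arr = s.arr := by rw [← hs₁]; rfl
  have g₁ : Good c s → Good c s₁ := fun g a i => by rw [arr₁]; exact g a i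
  have e₁ : Env c s₁ := he.of_eq fun x hx => by rw [reg₁, if_neg (by omega)]
  refine HT.seq (B₁ := 100 * c.W + 40) (B₂ := 100 * c.W + 114) (mulXRow_spec hc e₁
    (by rw [arr₁, hf]) hf'.lt (by rw [arr₁, hv]) (hlt _) ?_ le_rfl) (by omega)
  intro s₂ k₂ r₂
  rw [← mulN_succ] at r₂
  have h18 : s₂.reg 18 = o + c.n + (r + r) := by rw [k₂.reg (by decide), reg₁, if_pos rfl]
  refine HT.seq (B₁ := 17) (B₂ := 100 * c.W + 97) (HT.out ?_ ?_ ?_ ?_ le_rfl) (by omega)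
  · simp only [Expr.Ok, Expr.ev, BinOp.Ok, h18, true_and]; omega
  · simp only [Expr.Ok, Expr.ev, BinOp.Ok, hc.R, hc.D, and_true]; omega
  · simp only [Expr.ev, BinOp.nat, h18]; omega
  simp only [Expr.ev, BinOp.nat, h18, r₂, wd_parity (show 1 ≤ c.B by omega)]
  refine mulXRow_spec (v := mulN c.n f v (2 * r + 1)) hc
    ((k₂.env e₁ (by decide)).of_eq fun _ _ => rfl) ?_ hf'.lt r₂
    (hlt _) ?_ (by omega)
  · rw [NState.setOut_arr, k₂.arr (by decide), arr₁, hf]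
  intro s₃ k₃ r₃
  rw [← mulN_succ] at r₃
  have hout : ∀ i, s₃.out i = if i = o + c.n + (r + r) + 1 then mulN c.n f v (2 * r + 1) % 2 else
      if i = o + c.n + (r + r) then mulN c.n f v (2 * r) % 2 else
      if i = o + r then (4 - mulN c.n f v (2 * r) % 4) % 4 else s.out i := by
    intro i
    rw [k₃.keep.2.1, NState.setOut_out, k₂.keep.2.1, ← hs₁, NState.setOut_out, NState.set_out,
      NState.setOut_out]
  refine hQ s₃ (fun x hx => ?_) ?_ (fun g => k₃.good (k₂.good (g₁ g))) ?_ r₃ ⟨?_, ?_⟩ ?_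
  · rw [k₃.reg (by omega), NState.setOut_reg, k₂.reg (by omega), reg₁, if_neg (by omega)]
  · rw [k₃.reg (by decide), NState.setOut_reg, k₂.reg (by decide), reg₁, if_neg (by decide), hr]
  · rw [k₃.arr (by decide), NState.setOut_arr, k₂.arr (by decide), arr₁]
  · intro i hi
    rw [hout, if_neg (by omega), if_neg (by omega)]
    split_ifs with h
    · obtain rfl : i = r := by omega
      rfl
    · exact hbl.1 i (by omega)
  · intro m hm
    rw [hout]
    split_ifs with h h' h''
    · obtain rfl : m = 2 * r + 1 := by omega
      rfl
    · obtain rfl : m = 2 * r := by omega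
      rfl
    · omega
    · exact hbl.2 m (by omega)
  · intro i hi
    rw [hout, if_neg (by omega), if_neg (by omega), if_neg (by omega)]

/-- The circuits of all input vectors; register `14` points to the input, `15` to the output. -/
def circuitsProg : Stmt :=
  .set 15 (.c 0) ;; .for 16 1
    (.set 17 (.op .add (.v 14) (.v 0)) ;; readProg 1 0 ;; .for 20 0 emitBody ;;
      .set 14 (.op .add (.v 14) (.v 0)) ;;
      .set 15 (.op .add (.v 15) (.op .add (.v 0) (.op .add (.v 0) (.v 0)))))

/-- The number whose binary digits are the `n` input cells from number `p` on. -/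
def inputNat (ℓ : Layout) (n p : ℕ) : ℕ := horner 0 (fun k => ℓ.inp (p + n - 1 - k)) n

theorem circuitsProg_spec {f p m : ℕ} (hc : c.Fits ℓ) (he : Env c s) (hg : Good c s)
    (hf : s.arr 0 0 = wd c.B f) (hf' : IsDeg c.n f) (hm : s.reg 1 = m) (hp : s.reg 14 = p)
    (hL : p + m * c.n ≤ ℓ.L) (hM : 3 * c.n * m ≤ ℓ.M) (hinp : ∀ i, ℓ.inp i < 2)
    (hQ : ∀ s', (∀ i < m, Block c.n f (inputNat ℓ c.n (p + i * c.n)) (3 * c.n * i) s'.out c.n) →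
      Q s')
    (hT : m * (900 * (c.n * c.W)) + 8 ≤ T) : HT ℓ circuitsProg s T Q := by
  refine HT.of_pos fun hpos hfit => ?_
  have hn := hc.one_le
  have hW : 1 ≤ c.W := by simp [Ctx.W]
  have hX : c.W ≤ c.n * c.W := Nat.le_mul_of_pos_left _ hn
  have hb := budget (n := c.n) (a := 200) (b := 208) (k := c.n) 1 (by omega) hW
  have h1 := hc.n_lt
  have hRD : 0 < ℓ.R * ℓ.D := by rw [hc.R, hc.D]; positivity
  have hv0 : ∀ p, inputNat ℓ c.n p < 2 ^ c.n := fun p => by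
    have := horner_lt (u := 0) (b := fun k => ℓ.inp (p + c.n - 1 - k)) (fun k => hinp _) c.n
    rwa [zero_add, one_mul] at this
  refine HT.seq (B₁ := 2) (B₂ := m * (900 * (c.n * c.W)) + 6)
    (HT.set (by simp) ?_ le_rfl) (by omega)
  -- The subtracted 8 is the overhead of a round of the loop, so a round costs `900 * (n * W)` in
  -- total.
  refine HT.for (m := m) (b := 900 * (c.n * c.W) - 8) (I := fun i s' => (∀ x < 14, s'.reg x = s.reg x)
    ∧ s'.reg 14 = p + i * c.n ∧ s'.reg 15 = 3 * c.n * i ∧ Good c s' ∧ s'.arr 0 0 = wd c.B f ∧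
    ∀ i' < i, Block c.n f (inputNat ℓ c.n (p + i' * c.n)) (3 * c.n * i') s'.out c.n) (by decide)
    (by simpa using hm) ?_ ?_ ?_ ?_
  · refine ⟨fun x hx => ?_, by simpa using hp, by simp, hg, hf, by simp⟩
    rw [NState.set_reg, if_neg (by omega), NState.set_reg, if_neg (by omega)]
  · rintro i hi s' ⟨hreg, h14, h15, hgood, hrow, hbl⟩ hx hy
    have e' := he.of_eq fun x (hx : x < 10) => hreg x (by omega)
    have hi1 : (i + 1) * c.n ≤ m * c.n := Nat.mul_le_mul_right _ hi
    have hi2 : 3 * c.n * (i + 1) ≤ 3 * c.n * m := Nat.mul_le_mul_left _ hi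
    rw [Nat.succ_mul] at hi1
    rw [Nat.mul_succ] at hi2
    generalize hpi : p + i * c.n = pi at *
    generalize hoi : 3 * c.n * i = oi at *
    refine HT.seq (B₁ := 4) (B₂ := 900 * (c.n * c.W) - 12) (HT.set ?_ ?_ le_rfl) (by omega)
    · simp only [Expr.Ok, Expr.ev, BinOp.Ok, h14, e'.n, true_and]; omega
    simp only [Expr.ev, BinOp.nat, h14, e'.n]
    refine HT.seq (B₁ := 250 * (c.n * c.W)) (B₂ := 650 * (c.n * c.W) - 12)
      (readProg_spec (p := pi) hc (e'.of_eq fun x hx => ?_) hgood (by decide) two_pos (by simp)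
        (by omega) hinp ?_ le_rfl) (by omega)
    · rw [NState.set_reg, if_neg (by omega)]
    intro s₂ k₂ r₂
    have k₂ : Pres c 17 [1] s' s₂ := ((Pres.refl c 17 [1] s').set le_rfl).comp k₂
    have e₂ := k₂.env e' (by decide)
    refine HT.seq (B₁ := c.n * (200 * c.W + 200 + 8) + 6) (B₂ := 12)
      (HT.for (m := c.n) (b := 200 * c.W + 200) (I := fun r t => (∀ x < 17, t.reg x = s'.reg x) ∧
        Good c t ∧ t.arr 0 0 = wd c.B f ∧
        t.arr 1 0 = wd c.B (mulN c.n f (inputNat ℓ c.n pi) (2 * r)) ∧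
        Block c.n f (inputNat ℓ c.n pi) oi t.out r ∧ ∀ j < oi, t.out j = s'.out j)
        (by decide) e₂.n ?_ ?_ ?_ le_rfl) ?_
    · refine ⟨fun x hx => ?_, k₂.good hgood, ?_, r₂, ⟨by simp, by simp⟩, fun j _ => ?_⟩
      · rw [NState.set_reg, if_neg (by omega), k₂.reg hx]
      · rw [NState.set_arr, k₂.arr (by decide), hrow]
      · rw [NState.set_out, k₂.keep.2.1]
    · rintro r hr t ⟨treg, tgood, trow, tv, tbl, tout⟩ tx ty
      refine emitBody_spec hc (e'.of_eq fun x hx => treg x (by omega)) trow hf' (hv0 _)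
        (by rw [treg 15 (by decide), h15]) tx hr (by omega) tv tbl ?_ le_rfl
      intro t' t'reg t'20 t'good t'arr t'v t'bl t'out
      refine ⟨⟨fun x hx => ?_, t'good tgood, ?_, t'v, t'bl, fun j hj => ?_⟩, t'20, ?_⟩
      · rw [NState.set_reg, if_neg (by omega), t'reg x (by omega), treg x hx]
      · rw [NState.set_arr, t'arr, trow]
      · rw [NState.set_out, t'out j hj, tout j hj]
      · rw [t'reg 0 (by decide), ty]
    · rintro t ⟨treg, tgood, trow, -, tbl, tout⟩ -
      have t0 : t.reg 0 = c.n := by rw [treg 0 (by decide), e'.n]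
      have t14 : t.reg 14 = pi := by rw [treg 14 (by decide), h14]
      have t15 : t.reg 15 = oi := by rw [treg 15 (by decide), h15]
      refine HT.seq (B₁ := 4) (B₂ := 8) (HT.set ?_ ?_ le_rfl) le_rfl
      · simp only [Expr.Ok, Expr.ev, BinOp.Ok, t14, t0, true_and]; omega
      simp only [Expr.ev, BinOp.nat, t14, t0]
      refine HT.set ?_ ?_ le_rfl
      · simp [BinOp.Ok, BinOp.nat, t15, t0]; omega
      refine ⟨⟨fun x hx => ?_, ?_, ?_, tgood, trow, fun i' hi' => ?_⟩, ?_, ?_⟩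
      · rw [NState.set_reg, if_neg (by omega), NState.set_reg, if_neg (by omega),
          NState.set_reg, if_neg (by omega), treg x (by omega), hreg x hx]
      · simp
        rw [← hpi]; ring
      · simp [BinOp.nat, t15, t0]
        rw [← hoi]; ring
      · rcases Nat.lt_succ_iff_lt_or_eq.mp hi' with h | rfl
        · have hi3 : 3 * c.n * (i' + 1) ≤ oi := hoi ▸ Nat.mul_le_mul_left _ h
          rw [Nat.mul_succ] at hi3
          exact (hbl i' h).congr le_rfl fun j hj => tout j (by omega)
        · rw [hpi, hoi]
          exact tbl
      · simp [treg 16 (by decide), hx]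
      · simp [treg 1 (by decide), hy]
    · have : c.n * (200 * c.W + 200 + 8) = c.n * (200 * c.W + 208) := rfl
      omega
  · rintro s' ⟨-, -, -, -, -, hbl⟩ -
    exact hQ s' hbl
  · have : 900 * (c.n * c.W) - 8 + 8 = 900 * (c.n * c.W) := by omega
    rw [this]

end MUB

namespace MUB

variable {c : Ctx} {ℓ : Layout} {s : NState} {Q : NState → Prop} {T : ℕ}

/-! ### Computing the parameters -/

/-- The parameters for the degree `n`. -/
def Ctx.of (n : ℕ) : Ctx := ⟨n, n.size + 1, n / (n.size + 1), n % (n.size + 1)⟩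

/-- The counter starts at 1, so halving `n` down to zero leaves the packing width `n.size + 1` in
register `2`. -/
def sizeProg : Stmt :=
  .set 2 (.c 1) ;; .set 20 (.v 0) ;;
    .loop (.v 20) (.set 20 (.op .shr (.v 20) (.c 1)) ;; .set 2 (.op .add (.v 2) (.c 1)))

/-- Division is not a word operation; repeated subtraction takes O(n) steps, which the budget
allows. -/
def divProg : Stmt :=
  .set 3 (.c 0) ;; .set 4 (.v 0) ;;
    .loop (.op .eq (.op .lt (.v 4) (.v 2)) (.c 0))
      (.set 4 (.op .sub (.v 4) (.v 2)) ;; .set 3 (.op .add (.v 3) (.c 1)))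

def setupProg : Stmt :=
  sizeProg ;; .set 7 (.op .shl (.c 1) (.op .sub (.v 2) (.c 1))) ;;
    .set 6 (.op .sub (.op .add (.v 7) (.v 7)) (.c 1)) ;; divProg ;;
    .set 5 (.op .add (.v 3) (.c 1)) ;; .set 8 (.op .shr (.v 0) (.c 1)) ;;
    .set 9 (.op .add (.op .add (.v 0) (.v 0)) (.c 2))

/-- Only registers among those in `A` have changed. -/
def OnlyRegs (A : List ℕ) (s s' : NState) : Prop :=
  (∀ x, x ∉ A → s'.reg x = s.reg x) ∧ s'.out = s.out ∧ s'.arr = s.arr ∧ s'.tape = s.tape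

theorem OnlyRegs.refl (A : List ℕ) (s : NState) : OnlyRegs A s s :=
  ⟨fun _ _ => rfl, rfl, rfl, rfl⟩

theorem OnlyRegs.set {A : List ℕ} {s s' : NState} (h : OnlyRegs A s s') {x v : ℕ} (hx : x ∈ A) :
    OnlyRegs A s (s'.set x v) :=
  ⟨fun y hy => by rw [NState.set_reg, if_neg (by rintro rfl; exact hy hx), h.1 y hy], h.2⟩

theorem OnlyRegs.trans {A A' : List ℕ} {s s' s'' : NState} (h : OnlyRegs A s s')
    (h' : OnlyRegs A' s' s'') (hA : A' ⊆ A) : OnlyRegs A s s'' :=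
  ⟨fun x hx => (h'.1 x fun hx' => hx (hA hx')).trans (h.1 x hx), h'.2.1.trans h.2.1,
    h'.2.2.1.trans h.2.2.1, h'.2.2.2.trans h.2.2.2⟩

theorem sizeProg_spec {n : ℕ} (hn : s.reg 0 = n) (hw : n + 2 < 2 ^ ℓ.w)
    (hQ : ∀ s', OnlyRegs [2, 20] s s' → s'.reg 2 = n.size + 1 → Q s')
    (hT : 10 * n + 10 ≤ T) : HT ℓ sizeProg s T Q := by
  refine HT.of_pos fun hp _ => ?_
  have hsz : n.size ≤ n := Nat.size_le.mpr Nat.lt_two_pow_self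
  refine HT.seq (B₁ := 2) (B₂ := 10 * n + 8) (HT.set (by simp only [Expr.Ok]; omega) ?_ le_rfl)
    (by omega)
  refine HT.seq (B₁ := 2) (B₂ := 10 * n + 6) (HT.set trivial ?_ le_rfl) (by omega)
  refine HT.loop (m := n.size) (b := fun _ => 8) (I := fun k s' => OnlyRegs [2, 20] s s' ∧
    s'.reg 2 = k + 1 ∧ s'.reg 20 = n / 2 ^ k) ?_ ?_ ?_ ?_
  · rintro k hk s' ⟨ho, h2, h20⟩
    have hk' : 2 ^ k ≤ n := Nat.lt_size.mp hk
    refine ⟨trivial, ?_, ?_⟩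
    · rw [Expr.ev, h20]
      exact (Nat.div_pos hk' (by positivity)).ne'
    refine HT.seq (B₁ := 4) (B₂ := 4) (HT.set ?_ ?_ le_rfl) le_rfl
    · simp only [Expr.Ok, BinOp.Ok, and_true, true_and]; omega
    refine HT.set ?_ ⟨(ho.set (by simp)).set (by simp), ?_, ?_⟩ le_rfl
    · simp only [Expr.Ok, Expr.ev, BinOp.Ok, NState.set_reg, h2, true_and]
      rw [if_neg (by decide)]
      omega
    · simp [BinOp.nat, h2]
    · simp [BinOp.nat, h20, Nat.shiftRight_eq_div_pow, Nat.div_div_eq_div_mul, pow_succ]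
  · rintro s' ⟨ho, h2, h20⟩
    refine ⟨trivial, ?_, hQ s' ho h2⟩
    rw [Expr.ev, h20]
    exact Nat.div_eq_of_lt (Nat.lt_size_self n)
  · exact ⟨((OnlyRegs.refl _ s).set (by simp)).set (by simp), by simp, by simp [hn]⟩
  · simp
    omega

theorem divProg_spec {n B : ℕ} (hn : s.reg 0 = n) (hB : s.reg 2 = B) (hB' : 0 < B)
    (hw : n + 2 < 2 ^ ℓ.w)
    (hQ : ∀ s', OnlyRegs [3, 4] s s' → s'.reg 3 = n / B → s'.reg 4 = n % B → Q s')
    (hT : 14 * n + 20 ≤ T) : HT ℓ divProg s T Q := by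
  refine HT.of_pos fun hp _ => ?_
  have hle : n / B ≤ n := Nat.div_le_self _ _
  refine HT.seq (B₁ := 2) (B₂ := 14 * n + 18) (HT.set (by simp) ?_ le_rfl)
    (by omega)
  refine HT.seq (B₁ := 2) (B₂ := 14 * n + 16) (HT.set trivial ?_ le_rfl) (by omega)
  refine HT.loop (m := n / B) (b := fun _ => 8) (I := fun k s' => OnlyRegs [3, 4] s s' ∧
    s'.reg 3 = k ∧ s'.reg 4 = n - B * k) ?_ ?_ ?_ ?_
  · rintro k hk s' ⟨ho, h3, h4⟩
    have h2 : s'.reg 2 = B := by rw [ho.1 2 (by decide), hB]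
    have hk' : B * (k + 1) ≤ n :=
      (Nat.mul_le_mul_left _ hk).trans (Nat.mul_div_le n B)
    rw [Nat.mul_succ] at hk'
    refine ⟨by simp [BinOp.Ok], ?_, ?_⟩
    · simp [BinOp.nat, h2, h4]
      omega
    refine HT.seq (B₁ := 4) (B₂ := 4) (HT.set ?_ ?_ le_rfl) le_rfl
    · simp only [Expr.Ok, Expr.ev, BinOp.Ok, h2, h4, true_and]; omega
    refine HT.set ?_ ⟨(ho.set (by simp)).set (by simp), ?_, ?_⟩ le_rfl
    · simp only [Expr.Ok, Expr.ev, BinOp.Ok, NState.set_reg, h3, true_and]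
      rw [if_neg (by decide)]
      omega
    · simp [BinOp.nat, h3]
    · simp [BinOp.nat, h2, h4, Nat.mul_succ]
      omega
  · rintro s' ⟨ho, h3, h4⟩
    have h2 : s'.reg 2 = B := by rw [ho.1 2 (by decide), hB]
    have h := Nat.div_add_mod n B
    have h' := Nat.mod_lt n hB'
    have h4' : s'.reg 4 = n % B := by omega
    exact ⟨by simp [BinOp.Ok], by simp [BinOp.nat, h2, h4', h'], hQ s' ho h3 h4'⟩
  · exact ⟨((OnlyRegs.refl _ s).set (by simp)).set (by simp), by simp, by simp [hn]⟩
  · simp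
    omega

theorem setupProg_spec {n : ℕ} (hn : s.reg 0 = n) (hw : 2 * n + 2 < 2 ^ ℓ.w)
    (hw' : 2 ^ (n.size + 2) < 2 ^ ℓ.w)
    (hQ : ∀ s', OnlyRegs [2, 3, 4, 5, 6, 7, 8, 9, 20] s s' → Env (Ctx.of n) s' → Q s')
    (hT : 24 * n + 60 ≤ T) : HT ℓ setupProg s T Q := by
  refine HT.of_pos fun hp _ => ?_
  have hpow : 2 ^ (n.size + 2) = 4 * 2 ^ n.size := by ring
  refine HT.seq (B₁ := 10 * n + 10) (B₂ := 14 * n + 50)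
    (sizeProg_spec hn (by omega) ?_ le_rfl) (by omega)
  intro s₁ o₁ r₁
  have n₁ : s₁.reg 0 = n := by rw [o₁.1 0 (by decide), hn]
  refine HT.seq (B₁ := 6) (B₂ := 14 * n + 44) (HT.set ?_ ?_ le_rfl) (by omega)
  · simp only [Expr.Ok, Expr.ev, BinOp.Ok, BinOp.nat, r₁, Nat.one_shiftLeft, true_and,
      Nat.add_sub_cancel]
    omega
  generalize hs₂ : s₁.set 7 _ = s₂
  have r₂ : ∀ x, s₂.reg x = if x = 7 then 2 ^ n.size else s₁.reg x := by
    intro x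
    rw [← hs₂]
    simp [BinOp.nat, r₁, Nat.one_shiftLeft]
  have o₂ : OnlyRegs [2, 3, 4, 5, 6, 7, 8, 9, 20] s s₂ := by
    rw [← hs₂]
    exact ((OnlyRegs.refl _ s).trans o₁ (by decide)).set (by decide)
  clear hs₂
  have hpos : 0 < 2 ^ n.size := by positivity
  refine HT.seq (B₁ := 6) (B₂ := 14 * n + 38) (HT.set ?_ ?_ le_rfl) (by omega)
  · simp only [Expr.Ok, Expr.ev, BinOp.Ok, BinOp.nat, r₂, reduceIte, true_and]
    omega
  generalize hs₃ : s₂.set 6 _ = s₃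
  have r₃ : ∀ x, s₃.reg x = if x = 6 then 2 ^ (n.size + 1) - 1 else s₂.reg x := by
    intro x
    rw [← hs₃]
    simp [BinOp.nat, r₂, pow_succ, mul_two]
  have o₃ : OnlyRegs [2, 3, 4, 5, 6, 7, 8, 9, 20] s s₃ := by
    rw [← hs₃]
    exact o₂.set (by decide)
  clear hs₃
  refine HT.seq (B₁ := 14 * n + 20) (B₂ := 18) (divProg_spec (n := n) (B := n.size + 1)
    (by simp [r₃, r₂, n₁]) (by simp [r₃, r₂, r₁]) (by omega) (by omega) ?_ le_rfl) (by omega)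
  intro s₄ o₄ h3 h4
  have r₄ : ∀ x, x ∉ [3, 4] → s₄.reg x = s₃.reg x := o₄.1
  have o₄ := o₃.trans o₄ (by decide)
  have n₄ : s₄.reg 0 = n := by rw [r₄ 0 (by decide), r₃, if_neg (by decide), r₂,
    if_neg (by decide), n₁]
  have hle : n / (n.size + 1) ≤ n := Nat.div_le_self _ _
  refine HT.seq (B₁ := 4) (B₂ := 14) (HT.set ?_ ?_ le_rfl) (by omega)
  · simp only [Expr.Ok, Expr.ev, BinOp.Ok, h3, true_and]
    omega
  refine HT.seq (B₁ := 4) (B₂ := 10) (HT.set ?_ ?_ le_rfl) (by omega)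
  · simp only [Expr.Ok, BinOp.Ok, true_and, and_true]
    omega
  refine HT.set ?_ ?_ (by decide)
  · simp [BinOp.Ok, BinOp.nat, n₄, -Nat.one_lt_two_pow_iff]
    omega
  refine hQ _ (((o₄.set (by decide)).set (by decide)).set (by decide)) ?_
  constructor <;> simp [BinOp.nat, Ctx.of, Ctx.W, n₄, h3, h4, r₄, r₃, r₂, r₁,
    Nat.shiftRight_eq_div_pow, two_mul]

/-! ### Programs on the machine -/

/-- Lay out the memory: `n * T` input words, after `n` more words if `b`, then `3 * n * T` output
words, then the arrays. -/
def prologue (b : Bool) : Prog :=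
  -- Registers `5` and `7` are the variables `0` and `1`, which receive `n` and `T`. Register `3`
  -- collects `3 n T` before register `2` is enlarged to the full input length.
  .seq (.op .or 5 0 0) <| .seq (.op .or 7 1 1) <| .seq (.op .mul 2 0 1) <|
    .seq (.op .add 3 2 2) <| .seq (.op .add 3 3 2) <|
    .seq (if b then .op .add 2 2 0 else .op .or 2 2 2) <| .seq (.op .add 3 3 2) <|
    .seq (.const 6 2) (.op .add 4 0 6)

/-- The program that runs `P` and then returns the address of the output. -/
def program (b : Bool) (P : Stmt) : Prog :=
  .seq (prologue b) (.seq P.compile (.op .or 0 2 2))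

def layout (w n T : ℕ) (data : List ℕ) : Layout where
  w := w
  L := data.length
  M := 3 * n * T
  R := n + 1
  D := n + 2
  inp i := data.getD i 0

def initial (n T : ℕ) (ω : ℕ → Bool) : NState where
  reg x := if x = 0 then n else if x = 1 then T else 0
  out _ := 0
  arr _ _ _ := 0
  tape := ω

theorem prologue_spec {w n T : ℕ} {data : List ℕ} {ω : ℕ → Bool} {b : Bool}
    (hL : data.length = n * T + if b then n else 0) (hpos : 16 < 2 ^ w) (hT : T < 2 ^ w)
    (hdata : ∀ i, data.getD i 0 < 2)
    (hfit : data.length + 3 * n * T + 16 * ((n + 1) * (n + 2)) < 2 ^ w) :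
    ∃ τ, Exec (prologue b) (startState w n T data ω) 9 τ ∧
      Rep (layout w n T data) τ (initial n T ω) := by
  have h1 : 1 < 2 ^ w := by omega
  have hn : n + 2 < 2 ^ w := by nlinarith
  have hmul : 3 * n * T = 3 * (n * T) := by ring
  have key : ∀ (σ : State w) x v y, (σ.setReg x v).reg y = if y = x then v else σ.reg y :=
    fun σ x v y => State.setReg_reg σ x v y
  set σ := startState w n T data ω with hσ
  have r0 : (σ.reg 0).toNat = n := by
    simp [hσ, startState, Nat.mod_eq_of_lt (show n < 2 ^ w by omega)]
  have r1 : (σ.reg 1).toNat = T := by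
    simp [hσ, startState, Nat.mod_eq_of_lt hT]
  have rx : ∀ x, 2 ≤ x → (σ.reg x).toNat = 0 := fun x hx => by
    simp [hσ, startState, show x ≠ 0 by omega, show x ≠ 1 by omega]
  have hmem : σ.mem = fun a => BitVec.ofNat w (data.getD a.toNat 0) := rfl
  have htape : σ.tape = ω := rfl
  clear_value σ
  obtain ⟨v₁, e₁, n₁⟩ := exec_op h1 σ .or 5 0 0 trivial
  obtain ⟨v₂, e₂, n₂⟩ := exec_op h1 (σ.setReg 5 v₁) .or 7 1 1 trivial
  obtain ⟨v₃, e₃, n₃⟩ := exec_op h1 ((σ.setReg 5 v₁).setReg 7 v₂) .mul 2 0 1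
    (by simp only [key, BinOp.Ok]; simp [r0, r1]; omega)
  simp only [key, BinOp.nat, Nat.or_self, r0, r1, reduceIte, OfNat.zero_ne_ofNat,
    OfNat.one_ne_ofNat] at n₁ n₂ n₃
  set σ₃ := ((σ.setReg 5 v₁).setReg 7 v₂).setReg 2 v₃ with hσ₃
  obtain ⟨v₄, e₄, n₄⟩ := exec_op h1 σ₃ .add 3 2 2
    (by simp only [hσ₃, key, BinOp.Ok]; simp [n₃]; omega)
  have n₄ : v₄.toNat = n * T + n * T := by
    rw [n₄]; simp [hσ₃, n₃, BinOp.nat]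
  obtain ⟨v₅, e₅, n₅⟩ := exec_op h1 (σ₃.setReg 3 v₄) .add 3 3 2
    (by simp only [hσ₃, key, BinOp.Ok]; simp [n₃, n₄]; omega)
  have n₅ : v₅.toNat = n * T + n * T + n * T := by
    rw [n₅]; simp [hσ₃, n₃, n₄, BinOp.nat]
  set σ₅ := (σ₃.setReg 3 v₄).setReg 3 v₅ with hσ₅
  obtain ⟨v₆, e₆, n₆⟩ : ∃ v₆ : BitVec w, Exec (if b then .op .add 2 2 0 else .op .or 2 2 2) σ₅ 1
      (σ₅.setReg 2 v₆) ∧ v₆.toNat = data.length := by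
    cases b
    · obtain ⟨v₆, e₆, n₆⟩ := exec_op h1 σ₅ .or 2 2 2 trivial
      refine ⟨v₆, e₆, ?_⟩
      rw [n₆, hL]
      simp [hσ₅, hσ₃, n₃, BinOp.nat]
    · obtain ⟨v₆, e₆, n₆⟩ := exec_op h1 σ₅ .add 2 2 0
        (by simp only [hσ₅, hσ₃, key, BinOp.Ok]; simp [n₃, r0]; simp at hL; omega)
      refine ⟨v₆, e₆, ?_⟩
      rw [n₆, hL]
      simp [hσ₅, hσ₃, n₃, r0, BinOp.nat]
  obtain ⟨v₇, e₇, n₇⟩ := exec_op h1 (σ₅.setReg 2 v₆) .add 3 3 2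
    (by simp only [hσ₅, hσ₃, key, BinOp.Ok]; simp [n₅, n₆]; omega)
  have n₇ : v₇.toNat = data.length + 3 * n * T := by
    rw [n₇]; simp [hσ₅, n₅, n₆, BinOp.nat]; omega
  obtain ⟨v₈, e₈, n₈⟩ := exec_const ((σ₅.setReg 2 v₆).setReg 3 v₇) 6 2 (by omega)
  obtain ⟨v₉, e₉, n₉⟩ := exec_op h1 (((σ₅.setReg 2 v₆).setReg 3 v₇).setReg 6 v₈) .add 4 0 6
    (by simp only [hσ₅, hσ₃, key, BinOp.Ok]; simp [n₈, r0]; omega)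
  have n₉ : v₉.toNat = n + 2 := by
    rw [n₉]; simp [hσ₅, hσ₃, n₈, r0, BinOp.nat]
  refine ⟨_, Exec.seq e₁ (Exec.seq e₂ (Exec.seq e₃ (Exec.seq e₄ (Exec.seq e₅ (Exec.seq e₆
    (Exec.seq e₇ (Exec.seq e₈ e₉))))))), ?_⟩
  have hm : ∀ k, k < 2 ^ w → (σ.mem (BitVec.ofNat w k)).toNat = data.getD k 0 := by
    intro k hk
    have := hdata k
    rw [hmem]
    simp only [BitVec.toNat_ofNat]
    rw [Nat.mod_eq_of_lt hk, Nat.mod_eq_of_lt (by omega)]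
  have hz : ∀ k, data.length ≤ k → k < 2 ^ w → (σ.mem (BitVec.ofNat w k)).toNat = 0 := by
    intro k hk hk'
    rw [hm k hk', List.getD_eq_default _ _ hk]
  refine ⟨fun x => ?_, ?_, ?_, ?_, hfit, hpos, fun i hi => ?_, fun i hi => ?_,
    fun a ha i hi j hj => ?_, htape⟩
  · rcases x with _ | _ | x
    · simp [hσ₅, hσ₃, initial]
      exact n₁
    · simp [hσ₅, hσ₃, initial]
      exact n₂
    · simp [hσ₅, hσ₃, initial, show 2 * (x + 1 + 1) + 5 ≠ 4 by omega,
        show 2 * (x + 1 + 1) + 5 ≠ 6 by omega]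
      exact rx _ (by omega)
  · simp
    exact n₆
  · simp
    exact n₇
  · simp
    exact n₉
  · exact hm i (by simp only [layout] at hi ⊢; omega)
  · exact hz _ (by simp [layout]) (by simp only [layout] at hi ⊢; omega)
  · have := (layout w n T data).cell_lt hi hj
    refine hz _ ?_ ?_
    · simp [Layout.addr, layout]; omega
    · simp only [Layout.addr, layout] at this ⊢; omega

theorem program_spec {w n T B : ℕ} {data : List ℕ} {ω : ℕ → Bool} {b : Bool} {P : Stmt}
    (hL : data.length = n * T + if b then n else 0) (hpos : 16 < 2 ^ w) (hT : T < 2 ^ w)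
    (hdata : ∀ i, data.getD i 0 < 2)
    (hfit : data.length + 3 * n * T + 16 * ((n + 1) * (n + 2)) < 2 ^ w)
    (h : HT (layout w n T data) P (initial n T ω) B Q) :
    ∃ t τ s', Exec (program b P) (startState w n T data ω) t τ ∧ t ≤ B + 10 ∧ Q s' ∧
      ∀ k < 3 * n * T, τ.out k = s'.out k := by
  obtain ⟨τ, e, r⟩ := prologue_spec (ω := ω) hL hpos hT hdata hfit
  obtain ⟨t, (υ : State w), s', e', ht, r', q⟩ := h τ r
  have h2 : (υ.reg 2).toNat = data.length := r'.regL
  have hout : ∀ k < 3 * n * T, (υ.mem (BitVec.ofNat w (data.length + k))).toNat = s'.out k := r'.out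
  obtain ⟨v, e₂, n₂⟩ := exec_op (show 1 < 2 ^ w by omega) υ .or 0 2 2 trivial
  refine ⟨_, _, s', Exec.seq e (Exec.seq e' e₂), by omega, q, fun k hk => ?_⟩
  have hv : v = BitVec.ofNat w data.length := by
    apply BitVec.eq_of_toNat_eq
    rw [n₂, BinOp.nat, Nat.or_self, h2, BitVec.toNat_ofNat, Nat.mod_eq_of_lt (by omega)]
  rw [← hout k hk, State.out, State.setReg_mem, State.setReg_reg, if_pos rfl, hv, BitVec.ofNat_add]

theorem program_diverges {w n T : ℕ} {data : List ℕ} {ω : ℕ → Bool} {b : Bool} {P : Stmt}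
    (hL : data.length = n * T + if b then n else 0) (hpos : 16 < 2 ^ w) (hT : T < 2 ^ w)
    (hdata : ∀ i, data.getD i 0 < 2)
    (hfit : data.length + 3 * n * T + 16 * ((n + 1) * (n + 2)) < 2 ^ w)
    (h : ∀ (σ : State w), Rep (layout w n T data) σ (initial n T ω) →
      ∀ t τ, ¬ Exec P.compile σ t τ) (t : ℕ) (τ : State w) :
    ¬ Exec (program b P) (startState w n T data ω) t τ := by
  obtain ⟨σ, e, r⟩ := prologue_spec (ω := ω) hL hpos hT hdata hfit
  intro h'
  cases h' with
  | seq h1 h2 =>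
    obtain ⟨rfl, rfl⟩ := e.det h1
    cases h2 with
    | seq h3 h4 => exact h _ r _ _ h3

end MUB

/-! ### The two complete programs: size of words, step counts and output blocks. -/

namespace MUB

variable {w n T : ℕ} {data : List ℕ} {ω : ℕ → Bool}

/-- The words are long enough for degree `n`, for `T` circuits and for the given input. -/
structure Fits (w n T : ℕ) (data : List ℕ) : Prop where
  one_le : 1 ≤ n
  pos : 16 < 2 ^ w
  count : T < 2 ^ w
  deg : 2 * n + 2 < 2 ^ w
  size : 2 ^ (n.size + 2) < 2 ^ w
  fit : data.length + 3 * n * T + 16 * ((n + 1) * (n + 2)) < 2 ^ w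
  bits : ∀ i, data.getD i 0 < 2

/-- Put `S = 2 ^ (n + T).size`, which exceeds `n + T`. The memory in use is O(S²), and `64 S² ≤ 2 ^
w` because `10 k ≥ 2 k + 6` for `k ≥ 1`. -/
theorem Fits.of_size (hn : 1 ≤ n) (hw : 10 * (n + T).size ≤ w) (hL : data.length ≤ n + n * T)
    (hdata : ∀ i, data.getD i 0 < 2) : Fits w n T data := by
  have hlt := Nat.lt_size_self (n + T)
  have hsz : 1 ≤ (n + T).size := Nat.size_pos.mpr (by omega)
  have hle : n.size ≤ (n + T).size := Nat.size_le_size (by omega)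
  have h8 : 2 ^ ((n + T).size + (n + T).size + 6) ≤ 2 ^ w :=
    Nat.pow_le_pow_right two_pos (by omega)
  rw [pow_add, pow_add] at h8
  have hS : 2 ≤ 2 ^ (n + T).size := Nat.pow_le_pow_right two_pos hsz
  generalize 2 ^ (n + T).size = S at *
  have hSS : 2 * S ≤ S * S := Nat.mul_le_mul_right _ hS
  have h1 : n * T ≤ S * S := Nat.mul_le_mul (by omega) (by omega)
  have h2 : (n + 1) * (n + 2) ≤ S * (S + 1) := Nat.mul_le_mul (by omega) (by omega)
  have h4 : S * (S + 1) = S * S + S := Nat.mul_succ S S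
  have h3 : 3 * n * T = 3 * (n * T) := by ring
  exact ⟨hn, by omega, by omega, by omega, Nat.pow_lt_pow_right (by decide) (by omega), by omega,
    hdata⟩

theorem Fits.fits (h : Fits w n T data) : (Ctx.of n).Fits (layout w n T data) where
  one_le := h.one_le
  two_le := by
    have := Nat.size_pos.mpr h.one_le
    simp only [Ctx.of]
    omega
  eq := Nat.div_add_mod' _ _
  lt := Nat.mod_lt _ (Nat.succ_pos _)
  R := rfl
  D := rfl
  word := h.size
  cells := by
    have := h.fit
    simp only [Ctx.of, layout]
    omega

/-- The number of words of a square array. -/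
def words (n : ℕ) : ℕ := n * (Ctx.of n).W

theorem le_words (n : ℕ) : n ≤ words n := Nat.le_mul_of_pos_right _ (Nat.succ_pos _)

theorem words_le (n : ℕ) (hn : 1 ≤ n) : words n ≤ 2 * n ^ 2 := by
  have : n / (n.size + 1) ≤ n := Nat.div_le_self _ _
  simp only [words, Ctx.of, Ctx.W]
  nlinarith

/-- The output consists of the blocks for the indices that start at the input cell `p`. -/
def Blocks (data : List ℕ) (n T f p : ℕ) (out : ℕ → ℕ) : Prop :=
  ∀ i < T, Block n f (horner 0 (fun k => data.getD (p + i * n + n - 1 - k) 0) n) (3 * n * i) out n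

theorem Blocks.congr {f p : ℕ} {out out' : ℕ → ℕ} (h : Blocks data n T f p out)
    (h' : ∀ k < 3 * n * T, out' k = out k) : Blocks data n T f p out' := by
  intro i hi
  refine (h i hi).congr le_rfl fun k hk => h' k (hk.trans_le ?_)
  rw [← Nat.mul_succ]
  exact Nat.mul_le_mul_left _ hi

theorem initial_good (n T : ℕ) (ω : ℕ → Bool) : Good (Ctx.of n) (initial n T ω) :=
  fun _ _ => ⟨0, by positivity, by funext j; simp [initial, wd]⟩

/-- The modulus occupies the input cells `0, …, n - 1` and is read downwards from cell `n`; the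
indices begin at cell `n`. -/
def detStmt : Stmt :=
  setupProg ;; .set 17 (.v 0) ;; readProg 0 1 ;; .set 14 (.v 0) ;; circuitsProg

def randStmt : Stmt :=
  setupProg ;; searchProg ;; .set 14 (.c 0) ;; circuitsProg

/-- The number that encodes the modulus given in the input. -/
def givenPoly (data : List ℕ) (n : ℕ) : ℕ := horner 1 (fun k => data.getD (0 + n - 1 - k) 0) n

theorem detStmt_spec (h : Fits w n T data) (hL : data.length = n * T + n)
    (hf : IsDeg n (givenPoly data n)) :
    HT (layout w n T data) detStmt (initial n T ω) (390 * words n + 900 * (T * words n))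
      fun s' => Blocks data n T (givenPoly data n) n s'.out := by
  have hX := le_words n
  have hn := h.one_le
  have hw := h.deg
  refine HT.seq (B₁ := 24 * n + 60) (B₂ := 260 * words n + 900 * (T * words n) + 20)
    (setupProg_spec rfl h.deg h.size ?_ le_rfl) (by omega)
  intro s₁ o₁ e₁
  have g₁ : Good (Ctx.of n) s₁ := fun a i => by rw [o₁.2.2.1]; exact initial_good n T ω a i
  refine HT.seq (B₁ := 2) (B₂ := 260 * words n + 900 * (T * words n) + 18)
    (HT.set trivial ?_ le_rfl) (by omega)
  have n₁ : s₁.reg 0 = n := e₁.n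
  rw [Expr.ev, n₁]
  refine HT.seq (B₁ := 250 * words n) (B₂ := 10 * words n + 900 * (T * words n) + 18)
    (readProg_spec (p := 0) h.fits (e₁.of_eq fun x hx => ?_) g₁ (by decide) (by decide) ?_ ?_ h.bits
      ?_ le_rfl) (by omega)
  · rw [NState.set_reg, if_neg (by omega)]
  · simp [Ctx.of]
  · simp only [Ctx.of, layout]
    omega
  intro s₂ k₂ r₂
  have reg₂ : ∀ x < 17, s₂.reg x = s₁.reg x := fun x hx => by
    rw [k₂.reg hx, NState.set_reg, if_neg (by omega)]
  have n₂ : s₂.reg 0 = n := by rw [reg₂ 0 (by decide), n₁]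
  refine HT.seq (B₁ := 2) (B₂ := 10 * words n + 900 * (T * words n) + 16)
    (HT.set trivial ?_ le_rfl) (by omega)
  rw [Expr.ev, n₂]
  refine circuitsProg_spec (f := givenPoly data n) (p := n) (m := T) h.fits
    (e₁.of_eq fun x hx => ?_) (k₂.good g₁) r₂ hf ?_ (by simp) ?_ ?_ h.bits ?_ ?_
  · rw [NState.set_reg, if_neg (by omega), reg₂ x (by omega)]
  · rw [NState.set_reg, if_neg (by omega), reg₂ 1 (by omega), o₁.1 1 (by decide)]
    rfl
  · simp only [Ctx.of, layout, hL, mul_comm T n]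
    omega
  · exact le_rfl
  · exact fun s' hs' => hs'
  · have : T * (900 * words n) = 900 * (T * words n) := by ring
    change T * (900 * words n) + 8 ≤ _
    omega

theorem randStmt_spec {K : ℕ} (h : Fits w n T data) (hL : data.length = n * T)
    (hK : Irreducible (np (drawn n ω K))) (hK' : ∀ k < K, ¬ Irreducible (np (drawn n ω k))) :
    HT (layout w n T data) randStmt (initial n T ω)
      (140 * words n + 900 * (T * words n) + ∑ k ∈ Finset.range (K + 1),
        (1000 * words n + 1900 * words n * rounds n (np (drawn n ω k))))
      fun s' => Blocks data n T (drawn n ω K) 0 s'.out := by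
  have hX := le_words n
  have hn := h.one_le
  have hw := h.deg
  generalize hS : ∑ k ∈ Finset.range (K + 1),
    (1000 * words n + 1900 * words n * rounds n (np (drawn n ω k))) = S
  refine HT.seq (B₁ := 24 * n + 60) (B₂ := 30 * words n + 900 * (T * words n) + S + 20)
    (setupProg_spec rfl h.deg h.size ?_ le_rfl) (by omega)
  intro s₁ o₁ e₁
  have g₁ : Good (Ctx.of n) s₁ := fun a i => by rw [o₁.2.2.1]; exact initial_good n T ω a i
  have t₁ : s₁.tape = ω := o₁.2.2.2
  refine HT.seq (B₁ := S + 6) (B₂ := 30 * words n + 900 * (T * words n) + 14)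
    (searchProg_spec (K := K) h.fits e₁ g₁ (by rw [t₁]; exact hK) (by rw [t₁]; exact hK') ?_
      (by rw [t₁, ← hS]; exact le_rfl)) (by omega)
  intro s₂ reg₂ g₂ r₂
  rw [t₁] at r₂
  refine HT.seq (B₁ := 2) (B₂ := 30 * words n + 900 * (T * words n) + 12)
    (HT.set (by simp) ?_ le_rfl) (by omega)
  refine circuitsProg_spec (f := drawn n ω K) (p := 0) (m := T) h.fits
    (e₁.of_eq fun x hx => ?_) g₂ r₂ (isDeg_trialPoly hn _) ?_ (by simp) ?_ ?_ h.bits ?_ ?_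
  · rw [NState.set_reg, if_neg (by omega), reg₂ x (by omega)]
  · rw [NState.set_reg, if_neg (by omega), reg₂ 1 (by omega), o₁.1 1 (by decide)]
    rfl
  · simp only [Ctx.of, layout, hL, mul_comm T n]
    omega
  · exact le_rfl
  · exact fun s' hs' => hs'
  · have : T * (900 * words n) = 900 * (T * words n) := by ring
    change T * (900 * words n) + 8 ≤ _
    omega

theorem det_program (h : Fits w n T data) (hL : data.length = n * T + n)
    (hf : IsDeg n (givenPoly data n)) :
    ∃ t τ, Exec (program true detStmt) (startState w n T data ω) t τ ∧
      t ≤ 400 * words n + 900 * (T * words n) ∧ Blocks data n T (givenPoly data n) n τ.out := by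
  obtain ⟨t, τ, s', e, ht, hb, ho⟩ := program_spec (b := true) (by simpa using hL) h.pos h.count
    h.bits h.fit (detStmt_spec (ω := ω) h hL hf)
  have := le_words n
  have := h.one_le
  exact ⟨t, τ, e, by omega, hb.congr ho⟩

theorem rand_program {K : ℕ} (h : Fits w n T data) (hL : data.length = n * T)
    (hK : Irreducible (np (drawn n ω K))) (hK' : ∀ k < K, ¬ Irreducible (np (drawn n ω k))) :
    ∃ t τ, Exec (program false randStmt) (startState w n T data ω) t τ ∧
      t ≤ 150 * words n + 900 * (T * words n) + ∑ k ∈ Finset.range (K + 1),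
        (1000 * words n + 1900 * words n * rounds n (np (drawn n ω k))) ∧
      Blocks data n T (drawn n ω K) 0 τ.out := by
  obtain ⟨t, τ, s', e, ht, hb, ho⟩ := program_spec (b := false) (by simpa using hL) h.pos h.count
    h.bits h.fit (randStmt_spec h hL hK hK')
  have := le_words n
  have := h.one_le
  exact ⟨t, τ, e, by omega, hb.congr ho⟩

theorem rand_program_diverges (h : Fits w n T data) (hL : data.length = n * T)
    (hK : ∀ k, ¬ Irreducible (np (drawn n ω k))) (t : ℕ) (τ : State w) :
    ¬ Exec (program false randStmt) (startState w n T data ω) t τ := by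
  refine program_diverges (by simpa using hL) h.pos h.count h.bits h.fit (fun σ r t τ e => ?_) t τ
  cases e with
  | seq h1 h2 =>
    obtain ⟨t', τ', s₁, e', -, r', o₁, e₁⟩ := setupProg_spec (ℓ := layout w n T data)
      (s := initial n T ω) (n := n)
      (Q := fun s' => OnlyRegs [2, 3, 4, 5, 6, 7, 8, 9, 20] (initial n T ω) s' ∧ Env (Ctx.of n) s')
      rfl h.deg h.size (fun s' o e => ⟨o, e⟩) le_rfl σ r
    obtain ⟨rfl, rfl⟩ := e'.det h1
    have g₁ : Good (Ctx.of n) s₁ := fun a i => by rw [o₁.2.2.1]; exact initial_good n T ω a i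
    have t₁ : s₁.tape = ω := o₁.2.2.2
    cases h2 with
    | seq h3 h4 => exact searchProg_diverges h.fits e₁ g₁ (by rw [t₁]; exact hK) r' h3

theorem Expr.coinFree_compile (e : Expr) (t : ℕ) : (e.compile t).CoinFree := by
  induction e generalizing t with
  | c | v => exact trivial
  | op o e f ihe ihf => exact ⟨ihe _, ihf _, trivial⟩
  | inp e ihe => exact ⟨ihe _, trivial⟩
  | ld a e f ihe ihf =>
    exact ⟨ihe _, ihf _, by simp [addrProg, Prog.CoinFree], trivial⟩

def Stmt.coinFree : Stmt → Bool
  | .coin _ => false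
  | .seq P Q => P.coinFree && Q.coinFree
  | .ite _ P Q => P.coinFree && Q.coinFree
  | .loop _ P => P.coinFree
  | _ => true

theorem Stmt.coinFree_compile {P : Stmt} (h : P.coinFree = true) : P.compile.CoinFree := by
  induction P with
  | skip => exact trivial
  | coin => cases h
  | set x e => exact ⟨e.coinFree_compile _, trivial⟩
  | st a e f g =>
    exact ⟨g.coinFree_compile _, e.coinFree_compile _, f.coinFree_compile _,
      by simp [addrProg, Prog.CoinFree], trivial⟩
  | out e f => exact ⟨f.coinFree_compile _, e.coinFree_compile _, trivial, trivial⟩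
  | seq P Q ihP ihQ =>
    rw [Stmt.coinFree, Bool.and_eq_true] at h
    exact ⟨ihP h.1, ihQ h.2⟩
  | ite e P Q ihP ihQ =>
    rw [Stmt.coinFree, Bool.and_eq_true] at h
    exact ⟨e.coinFree_compile _, ihP h.1, ihQ h.2⟩
  | loop e P ih => exact ⟨e.coinFree_compile _, ih h, e.coinFree_compile _⟩

theorem det_program_coinFree : (program true detStmt).CoinFree :=
  ⟨by simp [prologue, Prog.CoinFree], Stmt.coinFree_compile rfl, trivial⟩

end MUB

namespace MUB

open Polynomial

/-! ### Coefficients and circuits -/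

theorem np_toInt {n : ℕ} (l : Bits n) : np (toInt l) = toPoly l := by
  induction n with
  | zero => simp [toInt, toPoly]
  | succ n ih =>
    have h1 : toInt l = 2 * toInt (fun r => l r.succ) + (l 0).val := by
      simp only [toInt, Fin.sum_univ_succ, Finset.mul_sum]
      rw [add_comm]
      congr 1
      · exact Finset.sum_congr rfl fun r _ => by rw [Fin.val_succ]; ring
      · simp
    have h2 : toPoly l = X * toPoly (fun r => l r.succ) + C (l 0) := by
      simp only [toPoly, Fin.sum_univ_succ, Finset.mul_sum]
      rw [add_comm]
      congr 1
      · exact Finset.sum_congr rfl fun r _ => by rw [Fin.val_succ]; ring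
      · simp
    rw [h1, np_two_mul_add _ _ (ZMod.val_lt _), ih, h2, ZMod.natCast_zmod_val]

theorem toPoly_coeff {n : ℕ} {q : (ZMod 2)[X]} (hq : q.degree < n) :
    toPoly (fun r : Fin n => q.coeff r) = q := by
  rcases n with _ | n
  · have : q = 0 := by
      rw [← degree_eq_bot]
      exact Nat.WithBot.lt_zero_iff.mp (by exact_mod_cast hq)
    simp [toPoly, this]
  · have h : q.natDegree < n + 1 := by
      by_cases h0 : q = 0
      · simp [h0]
      · exact (natDegree_lt_iff_degree_lt h0).mpr hq
    rw [toPoly, Fin.sum_univ_eq_sum_range (fun r => C (q.coeff r) * X ^ r)]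
    exact (as_sum_range_C_mul_X_pow' (p := q) h).symm

theorem toPoly_single {n : ℕ} (s : Fin n) (x : ZMod 2) :
    toPoly (Pi.single s x) = C x * X ^ (s : ℕ) := by
  rw [toPoly, Finset.sum_eq_single s]
  · simp
  · intro r _ hr
    simp [hr]
  · simp

section

variable {n f v : ℕ} {p : (ZMod 2)[X]}

theorem IsModulus.degree (hp : IsModulus n p) : p.degree = n := by
  rw [degree_eq_natDegree hp.1.ne_zero, hp.2.1]

theorem toPoly_odot (hp : IsModulus n p) (j k : Bits n) :
    toPoly (odot p j k) = (toPoly j * toPoly k) % p :=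
  toPoly_coeff (hp.degree ▸ EuclideanDomain.mod_lt _ hp.1.ne_zero)

theorem np_mulN (hf : IsDeg n f) (hv : v < 2 ^ n) (k : ℕ) :
    np (mulN n f v k) = (np v * X ^ k) % np f := by
  induction k with
  | zero =>
    rw [pow_zero, mul_one, (mod_eq_self_iff (np_ne_zero ?_)).mpr]
    · rfl
    · rw [hf.degree]; exact degree_np_lt.mpr hv
    · have := hf.le; have := Nat.two_pow_pos n; omega
  | succ k ih =>
    rw [mulN_succ, np_mulX hf (mulN_lt hf hv k), ih, mod_mul_mod]
    congr 1
    ring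

/-- The product is `x y` times `j X^(s+t)` modulo `p`, and `x y` is 0 or 1, so it can be pulled out
of the remainder and out of the integer encoding. -/
theorem expo_eq (hp : IsModulus n p) (hf : np f = p) (hf' : IsDeg n f) {j : Bits n}
    (s t : Fin n) (x y : ZMod 2) :
    expo p j s t x y = x.val * y.val * mulN n f (toInt j) (s.val + t.val) := by
  have hv : toInt j < 2 ^ n := by
    rw [← degree_np_lt, np_toInt]
    exact degree_sum_fin_lt j
  have hmod : ∀ a b : (ZMod 2)[X], (a % p * b) % p = (a * b) % p := fun a b => by
    rw [mul_comm, mod_mul_mod, mul_comm]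
  have key : np (expo p j s t x y) = (toPoly j * (C (x * y) * X ^ (s.val + t.val))) % p := by
    rw [expo, np_toInt, toPoly_odot hp, toPoly_odot hp, toPoly_single, toPoly_single, hmod, C_mul]
    congr 1
    ring
  apply np_injective
  rw [key]
  have hxy : ∀ x y : ZMod 2, (x * y = 0 ∧ x.val * y.val = 0) ∨ (x * y = 1 ∧ x.val * y.val = 1) := by
    decide
  rcases hxy x y with ⟨h1, h2⟩ | ⟨h1, h2⟩
  · rw [h1, h2, zero_mul, np_zero, C_0, zero_mul, mul_zero, EuclideanDomain.zero_mod]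
  · rw [h1, h2, one_mul, np_mulN hf' hv, np_toInt, hf, C_1, one_mul]

theorem conj_I_pow (N : ℕ) :
    (starRingEnd ℂ) (Complex.I ^ N) = Complex.I ^ ((4 - N % 4) % 4) := by
  have h : (starRingEnd ℂ) (Complex.I ^ N) = (starRingEnd ℂ) (Complex.I ^ (N % 4)) := by
    rw [← Complex.I_pow_eq_pow_mod]
  rw [h]
  have := Nat.mod_lt N (show 4 > 0 by decide)
  interval_cases N % 4 <;> simp [pow_succ]

theorem isCoefficients_of_block (hp : IsModulus n p) (hf : np f = p) (hf' : IsDeg n f) {j : Bits n}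
    {o : ℕ} {out : ℕ → ℕ} (h : Block n f (toInt j) o out n) :
    IsCoefficients p j (fun r => out (o + r)) (fun m => out (o + n + m)) := by
  have hx : ∀ x : ZMod 2, x.val = 0 ∨ x.val = 1 := by decide
  refine ⟨fun r => ⟨?_, fun x => ?_⟩, fun s t hst => ⟨?_, fun x y => ?_⟩⟩
  · dsimp only
    rw [h.1 r r.2]
    exact Nat.mod_lt _ (by decide)
  · dsimp only
    rw [h.1 r r.2, expo_eq hp hf hf', conj_I_pow, ← two_mul]
    rcases hx x with h1 | h1 <;> simp [h1]
  · dsimp only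
    rw [h.2 _ (by omega)]
    exact Nat.mod_lt _ (by decide)
  · dsimp only
    rw [h.2 _ (by omega), expo_eq hp hf hf']
    rcases hx x with h1 | h1 <;> rcases hx y with h2 | h2 <;>
      simp [h1, h2, ← neg_one_pow_eq_pow_mod_two]

/-! ### The operation of the circuit -/

theorem circuitMatrix_append (gs hs : List (Gate n)) :
    circuitMatrix (gs ++ hs) = circuitMatrix hs * circuitMatrix gs := by
  induction gs with
  | nil => simp [circuitMatrix]
  | cons g gs ih => rw [List.cons_append, circuitMatrix, ih, circuitMatrix, mul_assoc]

theorem circuitMatrix_replicate {g : Gate n} {d : Bits n → ℂ} (h : g.matrix = Matrix.diagonal d)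
    (k : ℕ) : circuitMatrix (List.replicate k g) = Matrix.diagonal fun l => d l ^ k := by
  induction k with
  | zero => simp [circuitMatrix]
  | succ k ih =>
    rw [List.replicate_succ, circuitMatrix, ih, h, Matrix.diagonal_mul_diagonal]
    simp [pow_succ]

theorem circuitMatrix_flatMap {ι : Type*} {F : ι → List (Gate n)} {d : ι → Bits n → ℂ}
    (h : ∀ i, circuitMatrix (F i) = Matrix.diagonal (d i)) (L : List ι) :
    circuitMatrix (L.flatMap F) = Matrix.diagonal fun l => (L.map fun i => d i l).prod := by
  induction L with
  | nil => simp [circuitMatrix]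
  | cons i L ih =>
    rw [List.flatMap_cons, circuitMatrix_append, ih, h, Matrix.diagonal_mul_diagonal]
    simp [mul_comm]

theorem matrix_S (q : Fin n) :
    (Gate.S q).matrix = Matrix.diagonal fun l : Bits n => Complex.I ^ (l q).val := by
  ext l k
  simp only [Gate.matrix, onQubit, Matrix.of_apply, Matrix.diagonal_apply]
  by_cases h : l = k
  · simp [h]
  · rw [if_neg h]
    split_ifs with h1 h2
    · exact absurd (funext fun r => if hr : r = q then hr ▸ h2 else h1 r hr) h
    · rfl
    · rfl

/-- The entries of the Hadamard matrix. -/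
noncomputable def had (a b : ZMod 2) : ℂ := ((1 / Real.sqrt 2 : ℝ) : ℂ) * (-1) ^ (a.val * b.val)

/-- The qubits in `L` are distinct, so the gates act on separate coordinates and the entries
multiply. -/
theorem circuitMatrix_H (L : List (Fin n)) (hL : L.Nodup) :
    circuitMatrix (L.map Gate.H) = Matrix.of fun l k : Bits n =>
      if ∀ r, r ∉ L → l r = k r then (L.map fun r => had (l r) (k r)).prod else 0 := by
  induction L with
  | nil =>
    ext l k
    simp [circuitMatrix, Matrix.one_apply, funext_iff]
  | cons q L ih =>
    rw [List.nodup_cons] at hL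
    rw [List.map_cons, circuitMatrix, ih hL.2]
    ext l k
    simp only [Matrix.mul_apply, Gate.matrix, onQubit, Matrix.of_apply]
    -- The only intermediate basis vector that contributes is `k` with coordinate `q` already
    -- replaced by that of `l`.
    rw [Finset.sum_eq_single (Function.update k q (l q))]
    · have h1 : (∀ r, r ∉ L → l r = Function.update k q (l q) r) ↔
          ∀ r, r ∉ q :: L → l r = k r := by
        constructor
        · intro h r hr
          rw [List.mem_cons, not_or] at hr
          rw [h r hr.2, Function.update_of_ne hr.1]
        · intro h r hr
          by_cases hq : r = q
          · rw [hq, Function.update_self]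
          · rw [Function.update_of_ne hq]
            exact h r (by simp [hq, hr])
      have h2 : L.map (fun r => had (l r) (Function.update k q (l q) r)) =
          L.map fun r => had (l r) (k r) :=
        List.map_congr_left fun r hr => by
          rw [Function.update_of_ne (by rintro rfl; exact hL.1 hr)]
      rw [h2, if_pos (fun r hr => Function.update_of_ne hr _ _), Function.update_self]
      simp only [h1, List.map_cons, List.prod_cons, had]
      split_ifs
      · ring
      · ring
    · intro m _ hm
      by_cases h : ∀ r, r ≠ q → m r = k r
      · rw [if_neg, zero_mul]
        intro h'
        refine hm (funext fun r => ?_)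
        by_cases hr : r = q
        · rw [hr, Function.update_self, h' q hL.1]
        · rw [Function.update_of_ne hr, h r hr]
      · rw [if_neg h, mul_zero]
    · simp

/-- Pairing `(s, t)` with `(t, s)` matches the product over all ordered pairs with the gates: one
`S` stage on the diagonal and one `CZ` for each `s < t`. -/
theorem prod_split (F : Fin n → Fin n → ℂ) :
    ∏ s, ∏ t, F s t = (∏ s, F s s) * ∏ s, ∏ t, if s < t then F s t * F t s else 1 := by
  have h1 : ∀ s t, F s t = (if s = t then F s t else 1) *
      ((if s < t then F s t else 1) * if t < s then F s t else 1) := by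
    intro s t
    rcases lt_trichotomy s t with h | h | h
    · simp [h, h.ne, h.not_gt]
    · simp [h]
    · simp [h, h.ne', h.not_gt]
  have h2 : ∀ s t, (if s < t then F s t * F t s else 1) =
      (if s < t then F s t else 1) * if s < t then F t s else 1 := by
    intro s t
    split_ifs <;> simp
  simp_rw [h2, Finset.prod_mul_distrib]
  conv_lhs => enter [2, s, 2, t]; rw [h1]
  simp_rw [Finset.prod_mul_distrib]
  congr 1
  · simp
  · congr 1
    exact Finset.prod_comm

/-- All gates after the Hadamard stage are diagonal. Their product is `alpha`, and the Hadamard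
stage supplies the normalisation and the sign `(-1) ^ (k · l)`. -/
theorem circuitMatrix_circuit (hp : IsModulus n p) (hf : np f = p) (hf' : IsDeg n f) {j : Bits n}
    {a : Fin n → ℕ} {b : ℕ → ℕ} (h : IsCoefficients p j a b) :
    circuitMatrix (circuit a b) = U p j := by
  have hS := circuitMatrix_flatMap (F := fun r => List.replicate (a r) (Gate.S r))
    (fun r => circuitMatrix_replicate (matrix_S r) (a r)) (List.finRange n)
  have hC : ∀ s t : Fin n, circuitMatrix
      (if s < t then List.replicate (b (s.val + t.val)) (Gate.CZ s t) else []) =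
      Matrix.diagonal fun l : Bits n => if s < t then
        ((-1 : ℂ) ^ ((l s).val * (l t).val)) ^ b (s.val + t.val) else 1 := by
    intro s t
    split_ifs
    · exact circuitMatrix_replicate rfl _
    · simp [circuitMatrix]
  have hC := circuitMatrix_flatMap (fun s => circuitMatrix_flatMap (hC s) (List.finRange n))
    (List.finRange n)
  rw [circuit, circuitMatrix_append, circuitMatrix_append, hS, hC,
    circuitMatrix_H _ (List.nodup_finRange n)]
  ext l k
  simp only [Matrix.diagonal_mul, Matrix.of_apply, U, alpha, ← Fin.prod_univ_def, List.mem_finRange,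
    not_true, false_implies, implies_true, if_true]
  rw [prod_split fun s t => (starRingEnd ℂ) (Complex.I ^ expo p j s t (l s) (l t))]
  have e1 : ∏ r, had (l r) (k r) = ((1 / Real.sqrt (2 ^ n) : ℝ) : ℂ) *
      (-1) ^ (∑ r : Fin n, (k r).val * (l r).val) := by
    simp only [had, Finset.prod_mul_distrib, Finset.prod_const, Finset.card_univ, Fintype.card_fin,
      Finset.prod_pow_eq_pow_sum, mul_comm]
    congr 2
    rw [← Complex.ofReal_pow, div_pow, one_pow, Real.sqrt_eq_rpow, Real.sqrt_eq_rpow,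
      ← Real.rpow_natCast, ← Real.rpow_mul (by norm_num), ← Real.rpow_natCast 2 n,
      ← Real.rpow_mul (by norm_num), mul_comm]
  have e2 : ∏ r, (Complex.I ^ (l r).val) ^ a r =
      ∏ s, (starRingEnd ℂ) (Complex.I ^ expo p j s s (l s) (l s)) :=
    Finset.prod_congr rfl fun r _ => by rw [← (h.1 r).2, ← pow_mul, mul_comm]
  have e3 : (∏ s : Fin n, ∏ t : Fin n, if s < t then
        ((-1 : ℂ) ^ ((l s).val * (l t).val)) ^ b (s.val + t.val) else 1) =
      ∏ s, ∏ t, if s < t then (starRingEnd ℂ) (Complex.I ^ expo p j s t (l s) (l t)) *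
        (starRingEnd ℂ) (Complex.I ^ expo p j t s (l t) (l s)) else 1 := by
    refine Finset.prod_congr rfl fun s _ => Finset.prod_congr rfl fun t _ => ?_
    split_ifs with hst
    -- The exponent `e` is symmetric in the two qubits, so the pair contributes the square of the
    -- conjugate of `i^e`, which is `(-1)^e`.
    · have hsymm : expo p j t s (l t) (l s) = expo p j s t (l s) (l t) := by
        rw [expo_eq hp hf hf', expo_eq hp hf hf', mul_comm (l t).val, add_comm t.val]
      have := congrArg (Int.cast : ℤ → ℂ) ((h.2 s t hst).2 (l s) (l t))
      push_cast at this
      rw [hsymm, ← map_mul, ← mul_pow, Complex.I_mul_I, map_pow, map_neg, map_one, ← this,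
        ← pow_mul, mul_comm]
    · rfl
  rw [e1, e2, e3]
  ring

end

/-! ### The encoding of the input -/

theorem np_horner {u : ℕ} (hu : u < 2) {b : ℕ → ℕ} (hb : ∀ k, b k < 2) (m : ℕ) :
    np (horner u b m) = C (u : ZMod 2) * X ^ m +
      ∑ k ∈ Finset.range m, C (b k : ZMod 2) * X ^ (m - 1 - k) := by
  induction m with
  | zero =>
    rw [pow_zero, mul_one, Finset.sum_range_zero, add_zero]
    change np u = _
    obtain rfl | rfl : u = 0 ∨ u = 1 := by omega
    · rw [np_zero, Nat.cast_zero, C_0]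
    · rw [np_one, Nat.cast_one, C_1]
  | succ m ih =>
    have h1 : ∑ k ∈ Finset.range m, C (b k : ZMod 2) * X ^ (m + 1 - 1 - k) =
        X * ∑ k ∈ Finset.range m, C (b k : ZMod 2) * X ^ (m - 1 - k) := by
      rw [Finset.mul_sum]
      refine Finset.sum_congr rfl fun k hk => ?_
      have := Finset.mem_range.mp hk
      rw [show m + 1 - 1 - k = (m - 1 - k) + 1 by omega, pow_succ]
      ring
    rw [horner, np_two_mul_add _ _ (hb m), ih, Finset.sum_range_succ, h1, Nat.add_sub_cancel,
      Nat.sub_self, pow_zero, mul_one]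
    ring

theorem np_horner_reverse {u : ℕ} (hu : u < 2) {d : ℕ → ℕ} (hd : ∀ k, d k < 2) (p n : ℕ) :
    np (horner u (fun k => d (p + n - 1 - k)) n) = C (u : ZMod 2) * X ^ n +
      ∑ r ∈ Finset.range n, C (d (p + r) : ZMod 2) * X ^ r := by
  rw [np_horner hu (fun k => hd _), ← Finset.sum_range_reflect
    (fun r => C (d (p + r) : ZMod 2) * X ^ r)]
  congr 1
  refine Finset.sum_congr rfl fun k hk => ?_
  have := Finset.mem_range.mp hk
  rw [show p + n - 1 - k = p + (n - 1 - k) by omega]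

theorem encodeIndices_eq {n T : ℕ} (j : Fin T → Bits n) :
    encodeIndices j = List.ofFn fun k : Fin (T * n) => (j k.divNat k.modNat).val := by
  rw [List.ofFn_mul, encodeIndices, List.flatMap_def, List.map_ofFn]
  congr 2
  funext i
  simp only [Function.comp]
  congr 1
  funext r
  have hn : 0 < n := r.pos
  have hlt : i.val * n + r.val < T * n :=
    (Nat.add_lt_add_left r.2 _).trans_le (by rw [← Nat.succ_mul]; exact Nat.mul_le_mul_right _ i.2)
  have h1 : Fin.divNat ⟨i.val * n + r.val, hlt⟩ = i := Fin.ext (by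
    simp [Fin.divNat, Nat.add_div_of_dvd_right, hn, Nat.div_eq_of_lt r.2])
  have h2 : Fin.modNat ⟨i.val * n + r.val, hlt⟩ = r := Fin.ext (by
    simp [Fin.modNat, Nat.mod_eq_of_lt r.2])
  rw [h1, h2]

theorem encodeIndices_length {n T : ℕ} (j : Fin T → Bits n) : (encodeIndices j).length = T * n := by
  rw [encodeIndices_eq, List.length_ofFn]

theorem encodeIndices_getD {n T : ℕ} (j : Fin T → Bits n) (i : Fin T) (r : Fin n) :
    (encodeIndices j).getD (i * n + r) 0 = (j i r).val := by
  have hn : 0 < n := r.pos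
  have hlt : i.val * n + r.val < T * n :=
    (Nat.add_lt_add_left r.2 _).trans_le (by rw [← Nat.succ_mul]; exact Nat.mul_le_mul_right _ i.2)
  have h1 : Fin.divNat ⟨i.val * n + r.val, hlt⟩ = i := Fin.ext (by
    simp [Fin.divNat, Nat.add_div_of_dvd_right, hn, Nat.div_eq_of_lt r.2])
  have h2 : Fin.modNat ⟨i.val * n + r.val, hlt⟩ = r := Fin.ext (by
    simp [Fin.modNat, Nat.mod_eq_of_lt r.2])
  rw [List.getD_eq_getElem _ _ (by rw [encodeIndices_length]; exact hlt)]
  simp only [encodeIndices_eq, List.getElem_ofFn, h1, h2]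

theorem getD_lt {L : List ℕ} (h : ∀ x ∈ L, x < 2) (i : ℕ) : L.getD i 0 < 2 := by
  rcases Nat.lt_or_ge i L.length with hi | hi
  · rw [List.getD_eq_getElem _ _ hi]
    exact h _ (List.getElem_mem hi)
  · rw [List.getD_eq_default _ _ hi]
    exact two_pos

theorem encodeIndices_lt {n T : ℕ} (j : Fin T → Bits n) : ∀ x ∈ encodeIndices j, x < 2 := by
  intro x hx
  rw [encodeIndices_eq, List.mem_ofFn] at hx
  obtain ⟨k, rfl⟩ := hx
  exact ZMod.val_lt _

theorem encodePoly_length (n : ℕ) (p : (ZMod 2)[X]) : (encodePoly n p).length = n := by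
  simp [encodePoly]

theorem encodePoly_lt (n : ℕ) (p : (ZMod 2)[X]) : ∀ x ∈ encodePoly n p, x < 2 := by
  intro x hx
  obtain ⟨k, -, rfl⟩ := List.mem_map.mp hx
  exact ZMod.val_lt _

/-- The input cells from number `o` on hold the index `v`. -/
theorem toInt_eq_horner {n o : ℕ} {d : ℕ → ℕ} (hd : ∀ k, d k < 2) {v : Bits n}
    (h : ∀ r : Fin n, d (o + r) = (v r).val) :
    toInt v = horner 0 (fun k => d (o + n - 1 - k)) n := by
  apply np_injective
  rw [np_toInt, np_horner_reverse (by decide) hd, toPoly, Nat.cast_zero, C_0, zero_mul, zero_add,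
    ← Fin.sum_univ_eq_sum_range (fun r => C (d (o + r) : ZMod 2) * X ^ r)]
  exact Finset.sum_congr rfl fun r _ => by rw [h, ZMod.natCast_zmod_val]

/-- Over `𝔽₂` the modulus is monic, so the leading coefficient missing in the input is the initial 1
of `horner`. -/
theorem np_givenPoly {n : ℕ} {p : (ZMod 2)[X]} (hp : IsModulus n p) {L : List ℕ}
    (hL : ∀ x ∈ L, x < 2) : np (givenPoly (encodePoly n p ++ L) n) = p := by
  have hlt : ∀ x ∈ encodePoly n p ++ L, x < 2 := fun x hx =>
    (List.mem_append.mp hx).elim (encodePoly_lt n p x) (hL x)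
  rw [givenPoly, np_horner_reverse (by decide) (getD_lt hlt), Nat.cast_one, C_1, one_mul]
  have h1 : p.coeff n = 1 := by
    rw [← hp.2.1]
    exact monic_zmod_two hp.1.ne_zero
  conv_rhs => rw [p.as_sum_range_C_mul_X_pow, hp.2.1, Finset.sum_range_succ, h1, C_1, one_mul,
    add_comm]
  congr 1
  refine Finset.sum_congr rfl fun r hr => ?_
  have hr := Finset.mem_range.mp hr
  rw [zero_add, List.getD_append _ _ _ _ (by rwa [encodePoly_length]),
    List.getD_eq_getElem _ _ (by rwa [encodePoly_length])]
  simp [encodePoly]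

/-- Blocks of coefficients are the required output. -/
theorem isOutput_of_blocks {w n T o f : ℕ} {p : (ZMod 2)[X]} (hp : IsModulus n p) (hf : np f = p)
    {j : Fin T → Bits n} {L : List ℕ} (hL : ∀ x ∈ L, x < 2) (ho : L.length = o) {τ : State w}
    (h : Blocks (L ++ encodeIndices j) n T f o τ.out) : IsOutput p j τ := by
  have hlt : ∀ x ∈ L ++ encodeIndices j, x < 2 := fun x hx =>
    (List.mem_append.mp hx).elim (hL x) (encodeIndices_lt j x)
  have hf' : IsDeg n f := isDeg_of_natDegree (by rw [hf, hp.2.1]) (by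
    rintro rfl
    exact hp.1.ne_zero (hf ▸ np_zero))
  intro i
  have hb := h i i.2
  rw [← toInt_eq_horner (v := j i) (getD_lt hlt) fun r => ?_] at hb
  · have hc := isCoefficients_of_block hp hf hf' hb
    exact ⟨hc, circuitMatrix_circuit hp hf hf' hc⟩
  · rw [List.getD_append_right _ _ _ _ (by omega), ← encodeIndices_getD]
    congr 1
    omega

end MUB

namespace MUB

open Polynomial MeasureTheory ProbabilityTheory

/-! ### Random polynomials -/

/-- The block number `k` of `d` coin tosses. -/
def block (d : ℕ) (ω : ℕ → Bool) (k : ℕ) : Fin d → Bool := fun i => ω (k * d + i)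

/-- The polynomial that is drawn with the coin tosses `x`. -/
def coinPoly (n : ℕ) (x : Fin (n - 1) → Bool) : ℕ :=
  trialPoly n fun i => if h : i < n - 1 then x ⟨i, h⟩ else false

theorem horner_congr {u : ℕ} {b b' : ℕ → ℕ} {m : ℕ} (h : ∀ k < m, b k = b' k) :
    horner u b m = horner u b' m := by
  induction m with
  | zero => rfl
  | succ m ih => rw [horner, horner, ih fun k hk => h k (by omega), h m (by omega)]

theorem horner_inj {u : ℕ} {b b' : ℕ → ℕ} (hb : ∀ k, b k < 2) (hb' : ∀ k, b' k < 2) {m : ℕ}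
    (h : horner u b m = horner u b' m) : ∀ k < m, b k = b' k := by
  induction m with
  | zero => simp
  | succ m ih =>
    rw [horner, horner] at h
    have h1 := hb m
    have h2 := hb' m
    intro k hk
    rcases Nat.lt_succ_iff_lt_or_eq.mp hk with hk | rfl
    · exact ih (by omega) k hk
    · omega

theorem drawn_eq (n : ℕ) (ω : ℕ → Bool) (k : ℕ) :
    drawn n ω k = coinPoly n (block (n - 1) ω k) := by
  rw [drawn, coinPoly, trialPoly, trialPoly]
  congr 2
  refine horner_congr fun i hi => ?_
  rw [dif_pos hi, block]

theorem coinPoly_injective (n : ℕ) : Function.Injective (coinPoly n) := by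
  intro x y h
  rw [coinPoly, coinPoly, trialPoly, trialPoly] at h
  funext i
  have := horner_inj (fun k => Bool.toNat_lt _) (fun k => Bool.toNat_lt _)
    (Nat.mul_left_cancel two_pos (Nat.add_right_cancel h)) i i.2
  revert this
  simp only [Fin.is_lt, dite_true, Fin.eta]
  cases x i <;> cases y i <;> simp

/-- Injectivity gives `2 ^ (n - 1)` values among the odd numbers with `n + 1` binary digits, of
which there are just as many. -/
theorem coinPoly_surjective {n v : ℕ} (hn : 1 ≤ n) (hv : IsDeg n v) (hodd : v % 2 = 1) :
    ∃ x, coinPoly n x = v := by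
  have hpow : 2 ^ n = 2 * 2 ^ (n - 1) := by rw [← pow_succ']; congr 1; omega
  set A := (Finset.Ico (2 ^ (n - 1)) (2 ^ n)).image fun k => 2 * k + 1
  have hsub : Finset.univ.image (coinPoly n) ⊆ A := by
    intro v hv
    obtain ⟨x, -, rfl⟩ := Finset.mem_image.mp hv
    have h1 := isDeg_trialPoly hn fun i => if h : i < n - 1 then x ⟨i, h⟩ else false
    have h2 := trialPoly_odd n fun i => if h : i < n - 1 then x ⟨i, h⟩ else false
    have h3 := h1.lt
    have h4 := h1.le
    rw [pow_succ] at h3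
    refine Finset.mem_image.mpr ⟨coinPoly n x / 2, Finset.mem_Ico.mpr ?_, ?_⟩ <;>
    · rw [coinPoly]; omega
  have hcard : A.card ≤ (Finset.univ.image (coinPoly n)).card := by
    rw [Finset.card_image_of_injective _ (coinPoly_injective n), Finset.card_univ,
      Fintype.card_fun, Fintype.card_fin, Fintype.card_bool]
    refine Finset.card_image_le.trans ?_
    rw [Nat.card_Ico]
    omega
  have hmem : v ∈ A := by
    have h3 := hv.lt
    have h4 := hv.le
    rw [pow_succ] at h3
    exact Finset.mem_image.mpr ⟨v / 2, Finset.mem_Ico.mpr (by omega), by omega⟩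
  rw [← Finset.eq_of_subset_of_card_le hsub hcard] at hmem
  obtain ⟨x, -, hx⟩ := Finset.mem_image.mp hmem
  exact ⟨x, hx⟩

theorem isDeg_coinPoly {n : ℕ} (hn : 1 ≤ n) (x : Fin (n - 1) → Bool) : IsDeg n (coinPoly n x) :=
  isDeg_trialPoly hn _

theorem isModulus_coinPoly {n : ℕ} (hn : 1 ≤ n) {x : Fin (n - 1) → Bool}
    (h : Irreducible (np (coinPoly n x))) : IsModulus n (np (coinPoly n x)) :=
  ⟨h, (isDeg_coinPoly hn x).natDegree, by rw [coeff_zero_np, coinPoly, trialPoly_odd, Nat.cast_one]⟩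

-- For `n ≥ 2` an irreducible polynomial has constant term 1 and hence can be drawn, so
-- `two_pow_le_card_irreds` applies. For `n = 1` this fails for `X`, but the one polynomial that can
-- be drawn is linear.
open scoped Classical in
theorem two_pow_le_card_coinPoly {n : ℕ} (hn : 1 ≤ n) : 2 ^ (n - 1) ≤
    n * (Finset.univ.filter fun x => Irreducible (np (coinPoly n x))).card := by
  obtain rfl | hn2 : n = 1 ∨ 2 ≤ n := by omega
  · have h : ∀ x, Irreducible (np (coinPoly 1 x)) := fun x =>
      irreducible_of_degree_eq_one (isDeg_coinPoly le_rfl x).degree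
    simp [h]
  · have h1 := two_pow_le_card_irreds hn
    have hpow : 2 ^ n = 2 * 2 ^ (n - 1) := by rw [← pow_succ']; congr 1; omega
    have h2 : irreds n ⊆ (Finset.univ.filter fun x => Irreducible (np (coinPoly n x))).image
        fun x => np (coinPoly n x) := by
      intro f hf
      obtain ⟨hirr, hdeg⟩ := mem_irreds.mp hf
      obtain ⟨v, rfl⟩ := np_surjective f
      have hv : IsDeg n v := isDeg_of_natDegree hdeg (by
        rintro rfl
        exact hirr.ne_zero np_zero)
      have hodd : v % 2 = 1 := by
        by_contra hne
        have h0 : (np v).coeff 0 = 0 := by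
          rw [coeff_zero_np, show v % 2 = 0 by omega, Nat.cast_zero]
        have := natDegree_eq_of_degree_eq (degree_eq_degree_of_associated
          (irreducible_X.associated_of_dvd hirr (X_dvd_iff.mpr h0)))
        rw [natDegree_X] at this
        omega
      obtain ⟨x, rfl⟩ := coinPoly_surjective hn hv hodd
      exact Finset.mem_image.mpr ⟨x, by simpa using hirr, rfl⟩
    have h3 := (Finset.card_le_card h2).trans Finset.card_image_le
    have h4 := Nat.mul_le_mul_left n h3
    omega

/-- The harmonic sum in dyadic form: on `[2^k, 2^(k+1))` there are `2^k` terms, each at most `N /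
2^k`, so each of the `m` intervals contributes at most `N`. -/
theorem sum_le_of_mul_le {N : ℕ} {a : ℕ → ℕ} (h : ∀ i, i * a i ≤ N) (m : ℕ) :
    ∑ i ∈ Finset.Ico 1 (2 ^ m), a i ≤ m * N := by
  induction m with
  | zero => simp
  | succ m ih =>
    rw [← Finset.sum_Ico_consecutive _ Nat.one_le_two_pow (Nat.pow_le_pow_right two_pos m.le_succ),
      Nat.succ_mul]
    refine Nat.add_le_add ih ?_
    refine Nat.le_of_mul_le_mul_left ?_ (Nat.two_pow_pos m)
    calc 2 ^ m * ∑ i ∈ Finset.Ico (2 ^ m) (2 ^ (m + 1)), a i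
        ≤ ∑ i ∈ Finset.Ico (2 ^ m) (2 ^ (m + 1)), N := by
          rw [Finset.mul_sum]
          exact Finset.sum_le_sum fun i hi =>
            (Nat.mul_le_mul_right _ (Finset.mem_Ico.mp hi).1).trans (h i)
      _ = 2 ^ m * N := by
          rw [Finset.sum_const, Nat.card_Ico, smul_eq_mul, pow_succ]
          congr 1
          omega

-- Exchanging summations, the total is the sum over `i < n / 2` of the number `a i` of draws without
-- a factor of degree at most `i`. Here `a 0 ≤ 2^(n-1)` and `i * a i ≤ 2^n` by `mul_card_rough_le`;
-- the harmonic sum over `i` gives the logarithmic factor `n.size`.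
open scoped Classical in
theorem sum_rounds_le {n : ℕ} (hn : 1 ≤ n) :
    ∑ x, rounds n (np (coinPoly n x)) ≤ 2 ^ (n - 1) * (2 * n.size + 1) := by
  have hpow : 2 ^ n = 2 * 2 ^ (n - 1) := by rw [← pow_succ']; congr 1; omega
  set a : ℕ → ℕ := fun i => (Finset.univ.filter fun x => NoFactor i (np (coinPoly n x))).card
  have ha : ∀ i, i * a i ≤ 2 * 2 ^ (n - 1) := by
    intro i
    rw [← hpow]
    refine (Nat.mul_le_mul_left i ?_).trans (mul_card_rough_le i n hn)
    refine Finset.card_le_card_of_injOn (fun x => np (coinPoly n x)) (fun x hx => ?_)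
      ((np_injective.comp (coinPoly_injective n)).injOn)
    have hd := isDeg_coinPoly hn x
    have hx : NoFactor i (np (coinPoly n x)) := by simpa using hx
    exact Finset.mem_coe.mpr (mem_rough.mpr ⟨⟨np_ne_zero (by
      have := hd.le; have := Nat.two_pow_pos n; omega), hd.natDegree⟩, hx⟩)
  have h1 : ∑ x, rounds n (np (coinPoly n x)) = ∑ i ∈ Finset.range (n / 2), a i := by
    simp only [rounds, a, Finset.card_filter]
    exact Finset.sum_comm
  have h2 : a 0 ≤ 2 ^ (n - 1) :=
    (Finset.card_le_univ _).trans (by simp)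
  have h3 := sum_le_of_mul_le ha n.size
  have h4 : ∑ i ∈ Finset.range (n / 2), a i ≤ ∑ i ∈ Finset.range (2 ^ n.size), a i :=
    Finset.sum_le_sum_of_subset (Finset.range_subset_range.mpr
      ((Nat.div_le_self n 2).trans (Nat.lt_size_self n).le))
  rw [Finset.range_eq_Ico, Finset.range_eq_Ico,
    Finset.sum_eq_sum_Ico_succ_bot (Nat.two_pow_pos n.size)] at h4
  rw [h1, Finset.range_eq_Ico]
  have h5 : 2 ^ (n - 1) * (2 * n.size + 1) = n.size * (2 * 2 ^ (n - 1)) + 2 ^ (n - 1) := by ring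
  rw [h5]
  exact h4.trans (by rw [zero_add]; omega)

/-! ### Independent blocks of coin tosses -/

instance : IsProbabilityMeasure (PMF.uniformOfFintype Bool).toMeasure :=
  PMF.toMeasure.isProbabilityMeasure _

instance : IsProbabilityMeasure coinLaw := by
  unfold coinLaw
  infer_instance

theorem measurable_block (d : ℕ) : Measurable (block d) := by
  unfold block
  fun_prop

/-- The map `(k, i) ↦ k d + i` is injective, so the coins indexed by pairs are again independent and
fair; currying then groups them into independent blocks. -/
theorem map_block (d : ℕ) : coinLaw.map (block d) = Measure.infinitePi fun _ : ℕ =>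
    Measure.infinitePi fun _ : Fin d => (PMF.uniformOfFintype Bool).toMeasure := by
  have hinj : Function.Injective fun q : ℕ × Fin d => q.1 * d + q.2.val := by
    rintro ⟨k, i⟩ ⟨k', i'⟩ h
    have hd : 0 < d := i.pos
    have h1 := congrArg (· / d) h
    have h2 := congrArg (· % d) h
    simp [Nat.add_div_of_dvd_right, hd, Nat.div_eq_of_lt] at h1
    simp [Nat.mod_eq_of_lt] at h2
    exact Prod.ext h1 (Fin.ext h2)
  have h1 := Measure.map_infinitePi_infinitePi_of_inj
    (P := fun _ : ℕ => (PMF.uniformOfFintype Bool).toMeasure) hinj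
  rw [← Measure.infinitePi_map_curry fun _ _ => (PMF.uniformOfFintype Bool).toMeasure, ← h1,
    Measure.map_map (by fun_prop) (by fun_prop)]
  rfl

/-- Blocks are independent, so the integral of the product factors, and each block is uniform on `2
^ d` values. -/
theorem lintegral_prod_block {d : ℕ} (G : ℕ → (Fin d → Bool) → ENNReal) (s : Finset ℕ) :
    ∫⁻ ω, ∏ k ∈ s, G k (block d ω k) ∂coinLaw = ∏ k ∈ s, (∑ x, G k x) / 2 ^ d := by
  have hG : ∀ k, Measurable (G k) := fun k => measurable_of_countable _
  have h1 : ∫⁻ ω, ∏ k ∈ s, G k (block d ω k) ∂coinLaw =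
      ∫⁻ z, ∏ k ∈ s, G k (z k) ∂(coinLaw.map (block d)) := by
    rw [lintegral_map (by fun_prop) (measurable_block d)]
  rw [h1, map_block]
  refine (lintegral_prod_eq_prod_lintegral_of_indepFun s
    (fun k (z : ℕ → Fin d → Bool) => G k (z k)) (iIndepFun_infinitePi hG)
    (fun k => by fun_prop)).trans ?_
  refine Finset.prod_congr rfl fun k _ => ?_
  have h2 : ∀ f : ℕ → Measure (Fin d → Bool), ∀ [∀ i, IsProbabilityMeasure (f i)],
      ∫⁻ z, G k (z k) ∂(Measure.infinitePi f) = ∫⁻ x, G k x ∂(f k) := by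
    intro f _
    rw [← Measure.infinitePi_map_eval f k, lintegral_map (hG k) (by fun_prop)]
  rw [h2, lintegral_fintype, div_eq_mul_inv, Finset.sum_mul]
  refine Finset.sum_congr rfl fun x _ => ?_
  congr 1
  rw [Measure.infinitePi_singleton_of_fintype]
  simp [ENNReal.inv_pow]

end MUB

namespace MUB

open Polynomial MeasureTheory

variable {w n T : ℕ} {data : List ℕ} {ω : ℕ → Bool}

/-! ### The expected running time -/

open scoped Classical in
/-- `1` if the polynomial that is drawn with the coin tosses `x` is rejected, else `0`. -/
noncomputable def reject (n : ℕ) (x : Fin (n - 1) → Bool) : ENNReal :=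
  if Irreducible (np (coinPoly n x)) then 0 else 1

/-- A bound for the time to draw and test a polynomial. -/
noncomputable def drawCost (n : ℕ) (x : Fin (n - 1) → Bool) : ℕ :=
  1000 * words n + 1900 * words n * rounds n (np (coinPoly n x))

/-- The cost of draw number `k` if all earlier draws are rejected, else `0`, as a product over the
draws. -/
noncomputable def drawFactor (n k i : ℕ) (x : Fin (n - 1) → Bool) : ENNReal :=
  if i < k then reject n x else drawCost n x

/-- Summand `k` vanishes as soon as one of the first `k` draws is accepted. Written as a product
with one factor for each block, it can be integrated by independence. -/
noncomputable def searchCost (n : ℕ) (ω : ℕ → Bool) : ENNReal :=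
  ∑' k, ∏ i ∈ Finset.range (k + 1), drawFactor n k i (block (n - 1) ω i)

theorem prod_drawFactor {k : ℕ} (h : ∀ i < k, ¬ Irreducible (np (drawn n ω i))) :
    ∏ i ∈ Finset.range (k + 1), drawFactor n k i (block (n - 1) ω i) =
      drawCost n (block (n - 1) ω k) := by
  rw [Finset.prod_range_succ, Finset.prod_eq_one, one_mul, drawFactor, if_neg (lt_irrefl k)]
  intro i hi
  have hi := Finset.mem_range.mp hi
  rw [drawFactor, if_pos hi, reject, if_neg]
  rw [← drawn_eq]
  exact h i hi

/-- The bound holds for every sequence of tosses: if no irreducible polynomial is ever drawn, every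
summand of `searchCost` is at least 1 and the right side is infinite. No separate argument is needed
for that event. -/
theorem runTime_le_searchCost (h : Fits w n T data) (hL : data.length = n * T) :
    runTime (program false randStmt) (startState w n T data ω) ≤
      ((150 * words n + 900 * (T * words n) : ℕ) : ENNReal) + searchCost n ω := by
  classical
  by_cases hirr : ∃ k, Irreducible (np (drawn n ω k))
  · obtain ⟨t, τ, e, ht, -⟩ := rand_program h hL (Nat.find_spec hirr) fun k hk =>
      Nat.find_min hirr hk
    refine (runTime_le e).trans ((Nat.cast_le.mpr ht).trans ?_)
    rw [Nat.cast_add, Nat.cast_sum]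
    refine add_le_add le_rfl (le_trans (le_of_eq ?_)
      (ENNReal.sum_le_tsum (Finset.range (Nat.find hirr + 1))))
    refine Finset.sum_congr rfl fun k hk => ?_
    have hk := Finset.mem_range.mp hk
    rw [prod_drawFactor fun i hi => Nat.find_min hirr (by omega), drawCost, drawn_eq]
  · have hall : ∀ k, ¬ Irreducible (np (drawn n ω k)) := fun k hk => hirr ⟨k, hk⟩
    have htop : searchCost n ω = ⊤ := by
      rw [searchCost, eq_top_iff, ← ENNReal.tsum_const_eq_top_of_ne_zero (α := ℕ) one_ne_zero]
      refine ENNReal.tsum_le_tsum fun k => ?_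
      rw [prod_drawFactor fun i _ => hall i]
      have h1 := le_words n
      have h2 := h.one_le
      exact_mod_cast show 1 ≤ drawCost n _ by rw [drawCost]; omega
    rw [htop, add_top]
    exact le_top

/-- Here the packing pays off: a row has `W`, about `n / log n`, words, which absorbs the factor
`log n` from the expected number of rounds. -/
theorem words_mul_le (hn : 1 ≤ n) :
    n * (words n * (1000 + 1900 * (2 * n.size + 1))) ≤ 13400 * n ^ 3 := by
  have hs : n.size ≤ n := Nat.size_le.mpr Nat.lt_two_pow_self
  have h1 : n / (n.size + 1) ≤ n := Nat.div_le_self _ _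
  have h2 : n / (n.size + 1) * (n.size + 1) ≤ n := Nat.div_mul_le_self _ _
  have h3 : (Ctx.of n).W * (1000 + 1900 * (2 * n.size + 1)) ≤ 13400 * n := by
    simp only [Ctx.of, Ctx.W]
    nlinarith
  calc n * (words n * (1000 + 1900 * (2 * n.size + 1)))
      = n ^ 2 * ((Ctx.of n).W * (1000 + 1900 * (2 * n.size + 1))) := by rw [words]; ring
    _ ≤ n ^ 2 * (13400 * n) := Nat.mul_le_mul_left _ h3
    _ = 13400 * n ^ 3 := by ring

theorem sum_drawCost_le (hn : 1 ≤ n) : ∑ x, drawCost n x ≤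
    words n * (1000 + 1900 * (2 * n.size + 1)) * 2 ^ (n - 1) := by
  have h := Nat.mul_le_mul_left (1900 * words n) (sum_rounds_le hn)
  simp only [drawCost, Finset.sum_add_distrib, ← Finset.mul_sum, Finset.sum_const, Finset.card_univ,
    Fintype.card_fun, Fintype.card_fin, Fintype.card_bool, smul_eq_mul]
  nlinarith

/-- With rejection probability `a` and mean cost `b` of a draw, the expectation is the geometric
series `∑ a^k b = b / (1 - a)`. Here `1 - a` is the proportion of irreducible polynomials among
those drawn, at least `1 / n`, and `b` is O(n²). -/
theorem lintegral_searchCost_le (hn : 1 ≤ n) :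
    ∫⁻ ω, searchCost n ω ∂coinLaw ≤ ((13400 * n ^ 3 : ℕ) : ENNReal) := by
  classical
  have hmeas : ∀ k i, Measurable fun ω => drawFactor n k i (block (n - 1) ω i) := fun k i =>
    (measurable_of_countable (drawFactor n k i)).comp
      ((measurable_pi_apply i).comp (measurable_block (n - 1)))
  have h0 : ((2 : ENNReal) ^ (n - 1)) ≠ 0 := by positivity
  have h1 : ((2 : ENNReal) ^ (n - 1)) ≠ ⊤ := by finiteness
  set N : ENNReal := 2 ^ (n - 1) with hN
  set a : ENNReal := (∑ x, reject n x) / N with ha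
  set b : ENNReal := (∑ x, (drawCost n x : ENNReal)) / N with hb
  set c : ℕ := (Finset.univ.filter fun x => Irreducible (np (coinPoly n x))).card with hc
  have hcard := two_pow_le_card_coinPoly hn
  rw [← hc] at hcard
  have hc0 : c ≠ 0 := by
    intro h
    rw [h, mul_zero] at hcard
    have := Nat.two_pow_pos (n - 1)
    omega
  have hint : ∫⁻ ω, searchCost n ω ∂coinLaw = ∑' k, a ^ k * b := by
    unfold searchCost
    rw [lintegral_tsum fun k => (Finset.measurable_prod _ fun i _ => hmeas k i).aemeasurable]
    refine tsum_congr fun k => ?_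
    rw [lintegral_prod_block (drawFactor n k), Finset.prod_range_succ]
    congr 1
    · rw [Finset.prod_congr rfl (g := fun _ => a), Finset.prod_const, Finset.card_range]
      intro i hi
      rw [ha]
      congr 1
      exact Finset.sum_congr rfl fun x _ => by rw [drawFactor, if_pos (Finset.mem_range.mp hi)]
    · rw [hb]
      congr 1
      exact Finset.sum_congr rfl fun x _ => by rw [drawFactor, if_neg (lt_irrefl k)]
  have hsum : ∑ x, reject n x + c = N := by
    have h2 : ∀ x, reject n x + (if Irreducible (np (coinPoly n x)) then 1 else 0) = 1 := by
      intro x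
      rw [reject]
      split_ifs <;> simp
    rw [hc, Finset.card_filter, Nat.cast_sum, ← Finset.sum_add_distrib]
    simp only [Nat.cast_ite, Nat.cast_one, Nat.cast_zero, h2]
    simp [hN]
  have hac : a + c / N = 1 := by
    rw [ha, ENNReal.div_add_div_same, hsum, ENNReal.div_self h0 h1]
  have hcN : (c : ENNReal) / N ≠ ⊤ := ENNReal.div_ne_top (by simp) h0
  have hinv : (1 - a)⁻¹ ≤ n := by
    have ha1 : a ≠ ⊤ := fun h => by simp [h] at hac
    rw [← hac, ENNReal.add_sub_cancel_left ha1, ENNReal.inv_div (Or.inl h1) (Or.inl h0)]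
    refine ENNReal.div_le_of_le_mul ?_
    rw [hN]
    exact_mod_cast hcard
  have hbB : b ≤ ((words n * (1000 + 1900 * (2 * n.size + 1)) : ℕ) : ENNReal) := by
    refine ENNReal.div_le_of_le_mul ?_
    rw [hN]
    exact_mod_cast sum_drawCost_le hn
  rw [hint, ENNReal.tsum_mul_right, ENNReal.tsum_geometric]
  refine (mul_le_mul' hinv hbB).trans ?_
  exact_mod_cast words_mul_le hn

theorem lintegral_runTime_le (h : Fits w n T data) (hL : data.length = n * T) :
    ∫⁻ ω, runTime (program false randStmt) (startState w n T data ω) ∂coinLaw ≤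
      ((20000 * (n ^ 3 + T * n ^ 2) : ℕ) : ENNReal) := by
  have hn := h.one_le
  refine (lintegral_mono fun ω => runTime_le_searchCost h hL).trans ?_
  rw [lintegral_add_left measurable_const, lintegral_const, measure_univ, mul_one]
  refine (add_le_add le_rfl (lintegral_searchCost_le hn)).trans ?_
  rw [← Nat.cast_add]
  refine Nat.cast_le.mpr ?_
  have h1 := words_le n hn
  have h2 := Nat.mul_le_mul_left T h1
  have h3 : n ^ 2 ≤ n ^ 3 := Nat.pow_le_pow_right hn (by decide)
  nlinarith

/-! ### The two programs -/

open scoped Classical in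
/-- The modulus that is used with the coin tosses `ω`. -/
noncomputable def chosen (n : ℕ) (ω : ℕ → Bool) : (ZMod 2)[X] :=
  if h : ∃ k, Irreducible (np (drawn n ω k)) then np (drawn n ω (Nat.find h))
  else if h : ∃ p, IsModulus n p then h.choose else 0

theorem isModulus_chosen (hn : 1 ≤ n) (ω : ℕ → Bool) : IsModulus n (chosen n ω) := by
  classical
  rw [chosen]
  split_ifs with h1 h2
  · have h := Nat.find_spec h1
    rw [drawn_eq] at h ⊢
    exact isModulus_coinPoly hn h
  · exact h2.choose_spec
  · have h3 := two_pow_le_card_coinPoly hn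
    obtain ⟨x, hx⟩ : (Finset.univ.filter fun x => Irreducible (np (coinPoly n x))).Nonempty := by
      rw [← Finset.card_pos]
      refine Nat.pos_of_ne_zero fun h => ?_
      rw [h, mul_zero] at h3
      have := Nat.two_pow_pos (n - 1)
      omega
    exact absurd ⟨_, isModulus_coinPoly hn (Finset.mem_filter.mp hx).2⟩ h2

/-- If an irreducible polynomial occurs among the draws, determinism identifies the given execution
with the known one; otherwise there is no halting execution at all. -/
theorem rand_program_correct (h : Fits w n T data) {j : Fin T → Bits n}
    (hd : data = encodeIndices j) {t : ℕ} {τ : State w}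
    (e : Exec (program false randStmt) (startState w n T data ω) t τ) :
    IsOutput (chosen n ω) j τ := by
  classical
  have hL : data.length = n * T := by rw [hd, encodeIndices_length, mul_comm]
  by_cases hirr : ∃ k, Irreducible (np (drawn n ω k))
  · obtain ⟨t', τ', e', -, hb⟩ := rand_program h hL (Nat.find_spec hirr) fun k hk =>
      Nat.find_min hirr hk
    obtain ⟨rfl, rfl⟩ := e'.det e
    refine isOutput_of_blocks (L := []) (isModulus_chosen h.one_le ω) ?_ (by simp) rfl
      (by rw [List.nil_append, ← hd]; exact hb)
    rw [chosen, dif_pos hirr]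
  · exact absurd e (rand_program_diverges h hL (fun k hk => hirr ⟨k, hk⟩) t τ)

theorem det_program_correct {p : (ZMod 2)[X]} (hp : IsModulus n p) {j : Fin T → Bits n}
    (h : Fits w n T (encodePoly n p ++ encodeIndices j)) :
    ∃ t τ, Exec (program true detStmt)
      (startState w n T (encodePoly n p ++ encodeIndices j) ω) t τ ∧ IsOutput p j τ ∧
      t ≤ 2000 * (n ^ 3 + T * n ^ 2) := by
  have hf := np_givenPoly hp (encodeIndices_lt j)
  have hn := h.one_le
  obtain ⟨t, τ, e, ht, hb⟩ := det_program (ω := ω) h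
    (by rw [List.length_append, encodePoly_length, encodeIndices_length, mul_comm, add_comm])
    (isDeg_of_natDegree (by rw [hf, hp.2.1]) (by
      intro h0
      rw [h0, np_zero] at hf
      exact hp.1.ne_zero hf.symm))
  refine ⟨t, τ, e, isOutput_of_blocks hp hf (encodePoly_lt n p) (encodePoly_length n p) hb,
    ht.trans ?_⟩
  have h1 := words_le n hn
  have h2 := Nat.mul_le_mul_left T h1
  have h3 : n ^ 2 ≤ n ^ 3 := Nat.pow_le_pow_right hn (by decide)
  nlinarith

end MUB

theorem mainTheorem6 :
    (∃ (P : MUB.Prog) (c C : ℕ) (p : ℕ → (ℕ → Bool) → Polynomial (ZMod 2)),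
      (∀ n : ℕ, 1 ≤ n → ∀ ω : ℕ → Bool, MUB.IsModulus n (p n ω)) ∧
      ∀ n : ℕ, 1 ≤ n → ∀ (T : ℕ) (j : Fin T → MUB.Bits n) (w : ℕ), c * Nat.size (n + T) ≤ w →
        (∀ (ω : ℕ → Bool) (t : ℕ) (τ : MUB.State w),
          MUB.Exec P (MUB.startState w n T (MUB.encodeIndices j) ω) t τ →
            MUB.IsOutput (p n ω) j τ) ∧
        (T = 1 → ∫⁻ ω, MUB.runTime P (MUB.startState w n T (MUB.encodeIndices j) ω) ∂MUB.coinLaw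
          ≤ ((C * n ^ 3 : ℕ) : ENNReal)) ∧
        ∫⁻ ω, MUB.runTime P (MUB.startState w n T (MUB.encodeIndices j) ω) ∂MUB.coinLaw
          ≤ ((C * (n ^ 3 + T * n ^ 2) : ℕ) : ENNReal)) ∧
    (∃ (P : MUB.Prog) (c C : ℕ), P.CoinFree ∧
      ∀ n : ℕ, 1 ≤ n → ∀ p : Polynomial (ZMod 2), MUB.IsModulus n p →
        ∀ (T : ℕ) (j : Fin T → MUB.Bits n) (w : ℕ), c * Nat.size (n + T) ≤ w →
        ∀ ω : ℕ → Bool, ∃ (t : ℕ) (τ : MUB.State w),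
          MUB.Exec P
            (MUB.startState w n T (MUB.encodePoly n p ++ MUB.encodeIndices j) ω) t τ ∧
          MUB.IsOutput p j τ ∧
          (T = 1 → t ≤ C * n ^ 3) ∧ t ≤ C * (n ^ 3 + T * n ^ 2)) := by
  have hpow : ∀ n : ℕ, 1 ≤ n → n ^ 2 ≤ n ^ 3 := fun n hn => Nat.pow_le_pow_right hn (by decide)
  -- The time constants are twice the proved ones, since for `T = 1` the bound `n ^ 3 + n ^ 2` is at
  -- most `2 * n ^ 3`.
  refine ⟨⟨MUB.program false MUB.randStmt, 10, 40000, MUB.chosen,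
    fun n hn ω => MUB.isModulus_chosen hn ω, fun n hn T j w hw => ?_⟩,
    ⟨MUB.program true MUB.detStmt, 10, 4000, MUB.det_program_coinFree,
      fun n hn p hp T j w hw ω => ?_⟩⟩
  · have hL : (MUB.encodeIndices j).length = n * T := by
      rw [MUB.encodeIndices_length, mul_comm]
    have h := MUB.Fits.of_size hn hw (hL.trans_le (by omega))
      (MUB.getD_lt (MUB.encodeIndices_lt j))
    have hE := MUB.lintegral_runTime_le h hL
    refine ⟨fun ω t τ e => MUB.rand_program_correct h rfl e, fun hT => ?_, ?_⟩
    · refine hE.trans (Nat.cast_le.mpr ?_)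
      have := hpow n hn
      subst hT
      omega
    · exact hE.trans (Nat.cast_le.mpr (Nat.mul_le_mul_right _ (by decide)))
  · have hL : (MUB.encodePoly n p ++ MUB.encodeIndices j).length = n + n * T := by
      rw [List.length_append, MUB.encodePoly_length, MUB.encodeIndices_length, mul_comm]
    have h := MUB.Fits.of_size hn hw hL.le (MUB.getD_lt fun x hx =>
      (List.mem_append.mp hx).elim (MUB.encodePoly_lt n p x) (MUB.encodeIndices_lt j x))
    obtain ⟨t, τ, e, ho, ht⟩ := MUB.det_program_correct (ω := ω) hp h
    refine ⟨t, τ, e, ho, fun hT => ?_, ht.trans (Nat.mul_le_mul_right _ (by decide))⟩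
    have := hpow n hn
    subst hT
    omega
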